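/- Setting. Let $M\ge 1$ and $P_1,\dots,P_M\ge 0$. For each $N$ let $\mathbf a(N)\in\{1,\dots,M\}^N$ be deterministic with $\lim_{N\to\infty}\frac1N|\{k: a_k(N)=m\}|=\delta_m$ for every $m$, and suppose $\overline P:=\sum_m\delta_mP_m>0$. Let $\mathbf V(N)$, $N\ge1$, be random $N\times N$ unitary matrices on a common probability space, each Haar distributed (with an arbitrary joint law). Let $Q_{\rm tx},Q_{\rm rx}:\mathbb C\to\mathbb C$ and $F:\mathbb C\times\mathbb C\to\mathbb C$ be Lipschitz functions that do not depend on $N$, applied componentwise to vectors. Let $\mathbf z\in\mathbb C^N$ have independent components $z_k\sim\mathcal{CN}(0,P_m)$ for $a_k=m$ ($\mathcal{CN}$ is the circularly symmetric complex Gaussian law), let $\boldsymbol\xi\in\mathbb C^N$ have i.i.d. components distributed as a complex random variable $\Xi$ with $\mathbb E|\Xi|^2<\infty$, and let $\mathbf z,\boldsymbol\xi,\mathbf V$ be independent. Put $$\widehat{\mathbf z}=\mathbf V\,Q_{\rm rx}\big(F(Q_{\rm tx}(\mathbf V^{\mathsf H}\mathbf z),\boldsymbol\xi)\big),\qquad R_{\rm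 lin}:=\liminf_{N\to\infty}\frac1N I(\mathbf z;\widehat{\mathbf z}),$$ where $I(\mathbf z;\widehat{\mathbf z})\in[0,\infty]$ is the mutual information (in nats) under the law of $(\mathbf z,\boldsymbol\xi)$ for the given realization of $\mathbf V=\mathbf V(N)$, so that $R_{\rm lin}$ is a function of $(\mathbf V(N))_N$. Let $S=Q_{\rm rx}(F(Q_{\rm tx}(U),\Xi))$ with $U\sim\mathcal{CN}(0,\overline P)$ independent of $\Xi$, and $$\alpha_{\rm rx}:=\frac1{\overline P}\mathbb E[S^*U],\qquad \tau_{\rm rx}:=\frac1{\overline P}\mathbb E|S-\alpha_{\rm rx}U|^2 .$$ Theorem. Almost surely (with respect to $(\mathbf V(N))_N$), $$R_{\rm lin}\ \ge\ \sum_{m=1}^M\delta_m\log\Big(1+\frac{|\alpha_{\rm rx}|^2P_m}{\tau_{\rm rx}\overline P}\Big),$$ and the same bound also holds when $\alpha_{\rm rx}$ is replaced by its complex conjugate $\frac1{\overline P}\mathbb E[U^*S]$ throughout, that is, with $\tau_{\rm rx}$ replaced by $\frac1{\overline P}\mathbb E|S-\alpha_{\rm rx}^*U|^2$. If the denominator vanishes,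 the quotient is read as $0$ when its numerator is $0$ and as $+\infty$ otherwise, and $0\cdot\infty=0$. -/

import Mathlib

open MeasureTheory ProbabilityTheory Filter Topology
open scoped ENNReal NNReal ComplexConjugate Matrix

namespace QuantizedLink

noncomputable section

/-- The group of `N × N` complex unitary matrices carries its Borel σ-algebra. -/
instance instMeasurableSpaceUnitary (N : ℕ) :
    MeasurableSpace (Matrix.unitaryGroup (Fin N) ℂ) := borel _

instance instBorelSpaceUnitary (N : ℕ) :
    BorelSpace (Matrix.unitaryGroup (Fin N) ℂ) := ⟨rfl⟩

/-- The circularly symmetric complex Gaussian law `CN(0, P)`: real and imaginary parts are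
independent real Gaussians with mean `0` and variance `P / 2`. -/
def complexGaussian (P : ℝ≥0) : Measure ℂ :=
  ((gaussianReal 0 (P / 2)).prod (gaussianReal 0 (P / 2))).map
    Complex.measurableEquivRealProd.symm

/-- The mutual information `I(X; Y)` (in nats) of two random variables: the Kullback-Leibler
divergence of their joint law from the product of their marginal laws. -/
def mutualInfo {Ω α β : Type*} [MeasurableSpace Ω] [MeasurableSpace α] [MeasurableSpace β]
    (X : Ω → α) (Y : Ω → β) (μ : Measure Ω) : ℝ≥0∞ :=
  InformationTheory.klDiv (μ.map (fun ω => (X ω, Y ω))) ((μ.map X).prod (μ.map Y))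

/-- The law of the symbol vector `z`: independent components, with `z_k ∼ CN(0, P_m)` for
`a_k = m`. -/
def inputLaw {M N : ℕ} (P : Fin M → ℝ≥0) (a : Fin N → Fin M) : Measure (Fin N → ℂ) :=
  Measure.pi fun k => complexGaussian (P (a k))

/-- The law of the noise vector `ξ`: i.i.d. components with law `ν`. -/
def noiseLaw (N : ℕ) (ν : Measure ℂ) : Measure (Fin N → ℂ) :=
  Measure.pi fun _ => ν

/-- The scalar composite map `(u, ξ) ↦ Q_rx(F(Q_tx(u), ξ))`. -/
def scalarLink (Qtx : ℂ → ℂ) (F : ℂ → ℂ → ℂ) (Qrx : ℂ → ℂ) (u ξ : ℂ) : ℂ :=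
  Qrx (F (Qtx u) ξ)

/-- The received vector `ẑ = V Q_rx(F(Q_tx(Vᴴ z), ξ))`, with `Q_tx`, `F`, `Q_rx` acting
componentwise. -/
def received {N : ℕ} (Qtx : ℂ → ℂ) (F : ℂ → ℂ → ℂ) (Qrx : ℂ → ℂ)
    (V : Matrix.unitaryGroup (Fin N) ℂ) (z ξ : Fin N → ℂ) : Fin N → ℂ :=
  let u : Fin N → ℂ := (V : Matrix (Fin N) (Fin N) ℂ)ᴴ *ᵥ z
  let x : Fin N → ℂ := fun n => Qtx (u n)
  let y : Fin N → ℂ := fun n => F (x n) (ξ n)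
  let s : Fin N → ℂ := fun n => Qrx (y n)
  (V : Matrix (Fin N) (Fin N) ℂ) *ᵥ s

/-- The mutual information `I(z; ẑ)` for a given realization `V` of the transform. -/
def linkInfo {M N : ℕ} (Qtx : ℂ → ℂ) (F : ℂ → ℂ → ℂ) (Qrx : ℂ → ℂ) (P : Fin M → ℝ≥0)
    (ν : Measure ℂ) (a : Fin N → Fin M) (V : Matrix.unitaryGroup (Fin N) ℂ) : ℝ≥0∞ :=
  mutualInfo (fun p : (Fin N → ℂ) × (Fin N → ℂ) => p.1)
    (fun p => received Qtx F Qrx V p.1 p.2)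
    ((inputLaw P a).prod (noiseLaw N ν))

/-- The linear rate `liminf_N I(z; ẑ) / N` along a sequence of transforms `V(N)`. -/
def linearRate {M : ℕ} (Qtx : ℂ → ℂ) (F : ℂ → ℂ → ℂ) (Qrx : ℂ → ℂ) (P : Fin M → ℝ≥0)
    (ν : Measure ℂ) (a : (N : ℕ) → Fin N → Fin M)
    (V : (N : ℕ) → Matrix.unitaryGroup (Fin N) ℂ) : ℝ≥0∞ :=
  liminf (fun N : ℕ => linkInfo Qtx F Qrx P ν (a N) (V N) / (N : ℝ≥0∞)) atTop

/-- The average symbol energy `P̄ = ∑ δ_m P_m`. -/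
def avgPower {M : ℕ} (δ P : Fin M → ℝ≥0) : ℝ≥0 := ∑ m, δ m * P m

/-- `α_rx = E[S^* U] / P̄`, where `S = φ(U, Ξ)` and `U ∼ CN(0, P̄)` is independent of
`Ξ ∼ ν`. -/
def alphaRx (φ : ℂ → ℂ → ℂ) (ν : Measure ℂ) (Pbar : ℝ≥0) : ℂ :=
  (1 / ((Pbar : ℝ) : ℂ)) *
    ∫ p : ℂ × ℂ, conj (φ p.1 p.2) * p.1 ∂((complexGaussian Pbar).prod ν)

/-- `τ_rx(α) = E|S - α U|² / P̄`, where `S = φ(U, Ξ)` and `U ∼ CN(0, P̄)` is independent of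
`Ξ ∼ ν`. -/
def tauRx (φ : ℂ → ℂ → ℂ) (ν : Measure ℂ) (Pbar : ℝ≥0) (α : ℂ) : ℝ :=
  (1 / (Pbar : ℝ)) *
    ∫ p : ℂ × ℂ, ‖φ p.1 p.2 - α * p.1‖ ^ 2 ∂((complexGaussian Pbar).prod ν)

/-- The rate `∑ δ_m log(1 + |α|² P_m / (τ P̄))`, as an extended real number. The conventions for
`τ = 0` are those of `ℝ≥0∞`: the quotient is `0` if its numerator is `0` and `∞` otherwise, and
`0 * ∞ = 0`. -/
def gaussianRate {M : ℕ} (δ P : Fin M → ℝ≥0) (α : ℂ) (τ : ℝ) : EReal :=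
  ∑ m, ((δ m : ℝ) : EReal) *
    ENNReal.log (1 + ENNReal.ofReal (‖α‖ ^ 2 * P m) / ENNReal.ofReal (τ * avgPower δ P))

end

end QuantizedLink

namespace QuantizedLink

/-! ### The complex Gaussian law -/

/-! The mutual information is bounded below by testing the joint law against the log-likelihood
ratio of a fictitious Gaussian channel `y = β x + w`, `w ∼ CN(0, v)`, used independently in every
coordinate. The exponential of this ratio integrates to one over the Gaussian input for every fixed
`y`. The Donsker-Varadhan inequality therefore applies whatever the true law of the output is
(`ofReal_integral_le_klDiv`, `ofReal_sum_le_mutualInfo`), and only second moments of `(z, ẑ)`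
remain: the total error energy `∑ E|ẑ_k - β z_k|²` and the output energy of each symbol class.

Take `β = conj α`, the linear least-squares coefficient of `S` on `U`, and let `T = E|S - β U|²`. As
`V` is unitary, the error energy equals that of the components of `Vᴴ z`, whose variances are
uniformly close to `P̄`; hence it is asymptotically `N T` (`IsSpread.tendsto_error`). The energy of
class `m` is a quadratic form in the nonlinear outputs with matrix `Vᴴ diag(1_m) V`. Its
off-diagonal entries are individually negligible but correlate with the covariance of `Vᴴ z`. A
first-order expansion of Gaussian cross moments in the correlation
(`exists_norm_integral_stdVec_sub_le`) gives, per symbol, at least `δ_m (T + |α|² P_m)` in the limit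
(`IsSpread.energy_lower_bound`). With `v = T` the error and energy terms of the bound then cancel,
and the logarithms are left.

The expansion has four contributions besides the diagonal one. The constant term, from the mean of
the nonlinearity, vanishes because the off-diagonal entries of each class Gram matrix sum to `o(N)`.
The term linear in the correlation is computed by a trace identity and yields the excess `|α|² δ_m
(P_m - P̄)`. The conjugate-linear term vanishes by phase cancellation. The quadratic remainder is
small since off-diagonal Gram entries tend to zero uniformly while Frobenius norms squared are
`O(N)`.

These properties, collected in `IsSpread`, hold almost surely for Haar matrices (`ae_isSpread`).
Moments on the sphere are obtained from Gaussian vectors, and all the resulting bounds are `O(N⁻²)`,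
hence summable; no independence between different `N` enters. The bound with `α` in place of `conj
α` is weaker, because `conj α` minimizes the error. -/

theorem integrable_exp_quadratic_gaussianReal_half {t : ℝ} (ht : -1 < t) (b : ℝ) :
    Integrable (fun x : ℝ => Real.exp (-t * x ^ 2 + 2 * b * x)) (gaussianReal 0 (1 / 2)) ∧
      ∫ x, Real.exp (-t * x ^ 2 + 2 * b * x) ∂(gaussianReal 0 (1 / 2)) =
        (Real.sqrt (1 + t))⁻¹ * Real.exp (b ^ 2 / (1 + t)) := by
  have h1 : 0 < 1 + t := by linarith
  have hv : (1 / 2 : ℝ≥0) ≠ 0 := by norm_num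
  -- Variance `1 / 2` makes the density `π^(-1/2) exp(-x²)`, and the square is completed around `b /
  -- (1 + t)`.
  have key : ∀ x : ℝ, gaussianPDFReal 0 (1 / 2) x * Real.exp (-t * x ^ 2 + 2 * b * x) =
      ((Real.sqrt Real.pi)⁻¹ * Real.exp (b ^ 2 / (1 + t))) *
        Real.exp (-(1 + t) * (x - b / (1 + t)) ^ 2) := by
    intro x
    have e1 : (2 * Real.pi * ((1 / 2 : ℝ≥0) : ℝ)) = Real.pi := by push_cast; ring
    rw [gaussianPDFReal, e1, mul_assoc (Real.sqrt Real.pi)⁻¹, mul_assoc (Real.sqrt Real.pi)⁻¹,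
      ← Real.exp_add, ← Real.exp_add]
    congr 2
    push_cast
    field_simp
    ring
  constructor
  · rw [gaussianReal_of_var_ne_zero _ hv, integrable_withDensity_iff_integrable_smul₀'
      (measurable_gaussianPDF _ _).aemeasurable (by simp [gaussianPDF])]
    simp only [toReal_gaussianPDF, smul_eq_mul, key]
    exact ((integrable_exp_neg_mul_sq h1).comp_sub_right _).const_mul _
  · rw [integral_gaussianReal_eq_integral_smul hv]
    simp only [smul_eq_mul, key]
    rw [integral_const_mul, integral_sub_right_eq_self (fun x => Real.exp (-(1 + t) * x ^ 2)),
      integral_gaussian, Real.sqrt_div Real.pi_pos.le]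
    have : Real.sqrt Real.pi ≠ 0 := by positivity
    field_simp

instance isProbabilityMeasure_complexGaussian (P : ℝ≥0) :
    IsProbabilityMeasure (complexGaussian P) :=
  Measure.isProbabilityMeasure_map (by fun_prop)

theorem measurePreserving_complexGaussian (P : ℝ≥0) :
    MeasurePreserving Complex.measurableEquivRealProd.symm
      ((gaussianReal 0 (P / 2)).prod (gaussianReal 0 (P / 2))) (complexGaussian P) :=
  ⟨by fun_prop, rfl⟩

/-- Reduces every power to unit power. The case `P = 0` is included, so classes with zero power need
no separate treatment. -/
theorem complexGaussian_eq_map (P : ℝ≥0) :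
    complexGaussian P = (complexGaussian 1).map (fun x => ((Real.sqrt P : ℝ) : ℂ) * x) := by
  have h : gaussianReal 0 (P / 2) = (gaussianReal 0 (1 / 2)).map (fun x => Real.sqrt P * x) := by
    rw [gaussianReal_map_const_mul]
    congr 1
    · simp
    · ext
      push_cast
      rw [Real.sq_sqrt (NNReal.coe_nonneg P)]
      ring
  rw [complexGaussian, complexGaussian, h, Measure.map_prod_map _ _ (by fun_prop) (by fun_prop),
    Measure.map_map (by fun_prop) (by fun_prop), Measure.map_map (by fun_prop) (by fun_prop)]
  congr 1
  ext p
  apply Complex.ext <;> simp [Complex.measurableEquivRealProd]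

/-- Real and imaginary parts factor. Negative `t` gives exponential moments of `‖x‖²`, used for
domination and for chi-square concentration; the linear term gives the normalization of the Gaussian
likelihood ratio. -/
theorem integrable_exp_quadratic {t : ℝ} (ht : -1 < t) (h : ℂ) :
    Integrable (fun x : ℂ => Real.exp (-t * ‖x‖ ^ 2 + 2 * (conj h * x).re)) (complexGaussian 1) ∧
      ∫ x, Real.exp (-t * ‖x‖ ^ 2 + 2 * (conj h * x).re) ∂(complexGaussian 1) =
        (1 + t)⁻¹ * Real.exp (‖h‖ ^ 2 / (1 + t)) := by
  have h1 : 0 < 1 + t := by linarith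
  have key : ∀ p : ℝ × ℝ, Real.exp (-t * ‖Complex.measurableEquivRealProd.symm p‖ ^ 2 +
      2 * (conj h * Complex.measurableEquivRealProd.symm p).re) =
      Real.exp (-t * p.1 ^ 2 + 2 * h.re * p.1) * Real.exp (-t * p.2 ^ 2 + 2 * h.im * p.2) := by
    intro p
    rw [← Real.exp_add, ← Complex.normSq_eq_norm_sq, Complex.normSq_apply]
    congr 1
    simp [Complex.measurableEquivRealProd]
    ring
  have hR := integrable_exp_quadratic_gaussianReal_half ht h.re
  have hI := integrable_exp_quadratic_gaussianReal_half ht h.im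
  constructor
  · rw [← (measurePreserving_complexGaussian 1).integrable_comp_emb
      (MeasurableEquiv.measurableEmbedding _)]
    simp only [Function.comp_def, key]
    exact hR.1.mul_prod hI.1
  · rw [← (measurePreserving_complexGaussian 1).integral_comp
      (MeasurableEquiv.measurableEmbedding _)]
    simp only [key]
    rw [integral_prod_mul (fun x : ℝ => Real.exp (-t * x ^ 2 + 2 * h.re * x))
      (fun x : ℝ => Real.exp (-t * x ^ 2 + 2 * h.im * x)), hR.2, hI.2]
    rw [← Complex.normSq_eq_norm_sq, Complex.normSq_apply]
    have e : (Real.sqrt (1 + t))⁻¹ * (Real.sqrt (1 + t))⁻¹ = (1 + t)⁻¹ := by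
      rw [← mul_inv, Real.mul_self_sqrt h1.le]
    rw [mul_mul_mul_comm, e, ← Real.exp_add]
    congr 2
    ring

theorem charFun_complexGaussian_one (c : ℂ) :
    ∫ x, Complex.exp ((conj c * x).re * Complex.I) ∂(complexGaussian 1) =
      Complex.exp (-(‖c‖ ^ 2 / 4 : ℝ)) := by
  rw [← (measurePreserving_complexGaussian 1).integral_comp
      (MeasurableEquiv.measurableEmbedding _)]
  have key : ∀ p : ℝ × ℝ, Complex.exp ((conj c * Complex.measurableEquivRealProd.symm p).re *
      Complex.I) = Complex.exp (c.re * p.1 * Complex.I) * Complex.exp (c.im * p.2 * Complex.I) := by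
    intro p
    rw [← Complex.exp_add]
    congr 1
    simp [Complex.measurableEquivRealProd]
    ring
  simp only [key]
  rw [integral_prod_mul (fun x : ℝ => Complex.exp (c.re * x * Complex.I))
      (fun x : ℝ => Complex.exp (c.im * x * Complex.I))]
  rw [← charFun_apply_real, ← charFun_apply_real, charFun_gaussianReal, charFun_gaussianReal,
    ← Complex.exp_add]
  congr 1
  rw [← Complex.normSq_eq_norm_sq, Complex.normSq_apply]
  push_cast
  simp
  ring


theorem integrable_norm_pow_complexGaussian (n : ℕ) :
    Integrable (fun x : ℂ => ‖x‖ ^ n) (complexGaussian 1) := by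
  -- At `t = -1/2` this is integrability of `exp(‖x‖² / 2)`, which dominates `exp ‖x‖` because `‖x‖
  -- ≤ 1/2 + ‖x‖² / 2`.
  have h := (integrable_exp_quadratic (t := -1 / 2) (by norm_num) 0).1
  refine (h.const_mul (n.factorial * Real.exp (1 / 2))).mono' (by fun_prop) (ae_of_all _ fun x => ?_)
  have h0 := norm_nonneg x
  rw [Real.norm_of_nonneg (by positivity), mul_assoc, ← Real.exp_add]
  have h1 := Real.pow_div_factorial_le_exp _ h0 n
  rw [div_le_iff₀' (by positivity)] at h1
  refine h1.trans ?_
  gcongr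
  simp
  nlinarith [sq_nonneg (‖x‖ - 1)]

theorem integral_sq_gaussianReal_half :
    ∫ x, x ^ 2 ∂(gaussianReal 0 (1 / 2)) = 1 / 2 := by
  have h := variance_of_integral_eq_zero (X := id) (μ := gaussianReal 0 (1 / 2))
    aemeasurable_id integral_id_gaussianReal
  rw [variance_id_gaussianReal] at h
  simpa using h.symm

theorem integral_norm_sq_complexGaussian_one :
    ∫ x, ‖x‖ ^ 2 ∂(complexGaussian 1) = 1 := by
  rw [← (measurePreserving_complexGaussian 1).integral_comp
      (MeasurableEquiv.measurableEmbedding _)]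
  have key : ∀ p : ℝ × ℝ, ‖Complex.measurableEquivRealProd.symm p‖ ^ 2 = p.1 ^ 2 + p.2 ^ 2 := by
    intro p
    rw [← Complex.normSq_eq_norm_sq, Complex.normSq_apply]
    simp [Complex.measurableEquivRealProd]
    ring
  have hi : Integrable (fun x : ℝ => x ^ 2) (gaussianReal 0 (1 / 2)) := by
    have := (memLp_id_gaussianReal (μ := 0) (v := 1 / 2) 2).integrable_sq
    simpa using this
  simp only [key]
  rw [integral_add (hi.comp_fst _) (hi.comp_snd _), integral_fun_fst (fun x : ℝ => x ^ 2),
    integral_fun_snd (fun x : ℝ => x ^ 2), integral_sq_gaussianReal_half]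
  norm_num

theorem integrable_norm_sq_complexGaussian (P : ℝ≥0) :
    Integrable (fun x : ℂ => ‖x‖ ^ 2) (complexGaussian P) := by
  rw [complexGaussian_eq_map, integrable_map_measure (by fun_prop) (by fun_prop)]
  simp only [Function.comp_def, norm_mul, mul_pow]
  exact (integrable_norm_pow_complexGaussian 2).const_mul _

theorem integral_norm_sq_complexGaussian (P : ℝ≥0) :
    ∫ x, ‖x‖ ^ 2 ∂(complexGaussian P) = P := by
  rw [complexGaussian_eq_map, integral_map (by fun_prop) (by fun_prop)]
  simp only [norm_mul, mul_pow]
  rw [integral_const_mul, integral_norm_sq_complexGaussian_one]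
  simp

/-! ### Linear images of standard complex Gaussian vectors -/

/-- The law of a vector with independent standard complex Gaussian components. -/
noncomputable def stdVec (ι : Type*) [Fintype ι] : Measure (ι → ℂ) :=
  Measure.pi fun _ => complexGaussian 1

instance (ι : Type*) [Fintype ι] : IsProbabilityMeasure (stdVec ι) := by
  unfold stdVec; infer_instance

theorem strongDual_pi_complex_apply {p : Type*} [Fintype p] [DecidableEq p]
    (L : StrongDual ℝ (p → ℂ)) :
    ∃ c : p → ℂ, ∀ y, L y = (star c ⬝ᵥ y).re := by
  refine ⟨fun i => ⟨L (Pi.single i 1), L (Pi.single i Complex.I)⟩, fun y => ?_⟩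
  have hy : y = ∑ i, ((y i).re • (Pi.single i 1 : p → ℂ) +
      (y i).im • (Pi.single i Complex.I : p → ℂ)) := by
    ext j
    simp [Finset.sum_apply, Pi.single_apply, Finset.sum_add_distrib]
  conv_lhs => rw [hy]
  simp only [map_sum, map_add, map_smul, smul_eq_mul, dotProduct, Complex.re_sum]
  refine Finset.sum_congr rfl fun i _ => ?_
  simp
  ring

theorem integral_exp_dotProduct_stdVec {n : Type*} [Fintype n] (d : n → ℂ) :
    ∫ x, Complex.exp ((star d ⬝ᵥ x).re * Complex.I) ∂(stdVec n) =
      Complex.exp (-((star d ⬝ᵥ d).re / 4 : ℝ)) := by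
  have key : ∀ x : n → ℂ, Complex.exp ((star d ⬝ᵥ x).re * Complex.I) =
      ∏ k, Complex.exp ((conj (d k) * x k).re * Complex.I) := by
    intro x
    rw [← Complex.exp_sum, ← Finset.sum_mul, dotProduct, Complex.re_sum]
    push_cast
    rfl
  simp only [key]
  rw [stdVec, integral_fintype_prod_eq_prod
    (f := fun k (y : ℂ) => Complex.exp ((conj (d k) * y).re * Complex.I))]
  simp only [charFun_complexGaussian_one]
  rw [← Complex.exp_sum, dotProduct, Complex.re_sum, Finset.sum_div]
  push_cast
  rw [← Finset.sum_neg_distrib]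
  congr 2
  ext k
  rw [Pi.star_apply, Complex.star_def, Complex.conj_mul', ← Complex.ofReal_pow, Complex.ofReal_re,
    Complex.ofReal_pow]

theorem measurable_mulVec {p m : Type*} [Fintype p] [Fintype m] (C : Matrix p m ℂ) :
    Measurable (fun x : m → ℂ => C *ᵥ x) :=
  (Continuous.matrix_mulVec continuous_const continuous_id).measurable

theorem star_dotProduct_mulVec {p m : Type*} [Fintype p] [Fintype m] (C : Matrix p m ℂ)
    (c : p → ℂ) (x : m → ℂ) : star c ⬝ᵥ (C *ᵥ x) = star (Cᴴ *ᵥ c) ⬝ᵥ x := by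
  rw [Matrix.star_mulVec, Matrix.conjTranspose_conjTranspose, Matrix.dotProduct_mulVec]

/-- The characteristic functional of a linear image at `c` depends only on `cᴴ A Aᴴ c`: circular
symmetry leaves no pseudo-covariance. Unitary invariance and the joint law of two linear functionals
are both instances. -/
theorem map_mulVec_stdVec_eq {p n n' : Type*} [Fintype p] [DecidableEq p] [Fintype n] [Fintype n']
    (A : Matrix p n ℂ) (B : Matrix p n' ℂ) (h : A * Aᴴ = B * Bᴴ) :
    (stdVec n).map (fun x => A *ᵥ x) = (stdVec n').map (fun x => B *ᵥ x) := by
  have : IsProbabilityMeasure ((stdVec n).map (fun x => A *ᵥ x)) :=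
    Measure.isProbabilityMeasure_map (measurable_mulVec A).aemeasurable
  have : IsProbabilityMeasure ((stdVec n').map (fun x => B *ᵥ x)) :=
    Measure.isProbabilityMeasure_map (measurable_mulVec B).aemeasurable
  apply Measure.ext_of_charFunDual
  ext L
  obtain ⟨c, hc⟩ := strongDual_pi_complex_apply L
  rw [charFunDual_apply, charFunDual_apply, integral_map (measurable_mulVec A).aemeasurable (by fun_prop),
    integral_map (measurable_mulVec B).aemeasurable (by fun_prop)]
  simp only [hc]
  simp only [star_dotProduct_mulVec]
  rw [integral_exp_dotProduct_stdVec, integral_exp_dotProduct_stdVec, ← star_dotProduct_mulVec,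
    ← star_dotProduct_mulVec,
    Matrix.mulVec_mulVec, Matrix.mulVec_mulVec, h]


/-! ### A variational lower bound on the mutual information -/

/-- The easy half of the Donsker-Varadhan formula. The function `q = exp(f) dν/dμ` has `μ`-integral
at most one, and discarding the part of `ν` singular to `μ` only helps. Integrating `log q ≤ q - 1`,
where `log q = f - llr`, gives the claim. -/
theorem ofReal_integral_le_klDiv {α : Type*} [MeasurableSpace α] {μ ν : Measure α}
    [IsProbabilityMeasure μ] [IsProbabilityMeasure ν] {f : α → ℝ} (hfm : Measurable f)
    (hf : Integrable f μ) (h : ∫⁻ x, ENNReal.ofReal (Real.exp (f x)) ∂ν ≤ 1) :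
    ENNReal.ofReal (∫ x, f x ∂μ) ≤ InformationTheory.klDiv μ ν := by
  by_cases htop : InformationTheory.klDiv μ ν = ∞
  · simp [htop]
  obtain ⟨hac, hint⟩ := InformationTheory.klDiv_ne_top_iff.1 htop
  rw [InformationTheory.klDiv_of_ac_of_integrable hac hint]
  apply ENNReal.ofReal_le_ofReal
  simp only [probReal_univ, add_sub_cancel_right]
  set q : α → ℝ≥0∞ := fun x => ENNReal.ofReal (Real.exp (f x)) * ν.rnDeriv μ x with hq
  have hqm : Measurable q := by
    have := Measure.measurable_rnDeriv ν μ
    fun_prop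
  have hlint : ∫⁻ x, q x ∂μ ≤ 1 := by
    refine le_trans ?_ h
    calc ∫⁻ x, q x ∂μ = ∫⁻ x, ENNReal.ofReal (Real.exp (f x)) ∂(μ.withDensity (ν.rnDeriv μ)) := by
          rw [lintegral_withDensity_eq_lintegral_mul _ (Measure.measurable_rnDeriv ν μ)
            (by fun_prop)]
          simp only [hq, Pi.mul_apply, mul_comm]
      _ ≤ _ := lintegral_mono' (Measure.withDensity_rnDeriv_le _ _) le_rfl
  have hqi : Integrable (fun x => (q x).toReal) μ :=
    integrable_toReal_of_lintegral_ne_top hqm.aemeasurable (hlint.trans_lt ENNReal.one_lt_top).ne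
  have hq1 : ∫ x, (q x).toReal ∂μ ≤ 1 := by
    rw [integral_toReal hqm.aemeasurable
      (ae_lt_top hqm (hlint.trans_lt ENNReal.one_lt_top).ne)]
    exact ENNReal.toReal_le_of_le_ofReal zero_le_one (by simpa using hlint)
  have hpt : ∀ᵐ x ∂μ, f x - llr μ ν x ≤ (q x).toReal - 1 := by
    filter_upwards [exp_neg_llr hac] with x hx
    have : (q x).toReal = Real.exp (f x - llr μ ν x) := by
      rw [sub_eq_add_neg, Real.exp_add, hx, hq, ENNReal.toReal_mul,
        ENNReal.toReal_ofReal (Real.exp_pos _).le]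
    rw [this]
    linarith [Real.add_one_le_exp (f x - llr μ ν x)]
  have hmono := integral_mono_ae (hf.sub hint) (hqi.sub (integrable_const 1)) hpt
  rw [integral_sub' hf hint, integral_sub' hqi (integrable_const 1)] at hmono
  simp only [integral_const, probReal_univ, smul_eq_mul, mul_one] at hmono
  linarith

/-- The log-likelihood ratio of the Gaussian channel `y = β x + w`, `w ∼ CN(0, v)`, with input law
`CN(0, P)`. -/
noncomputable def gaussianLLR (β : ℂ) (v P : ℝ) (x y : ℂ) : ℝ :=
  Real.log (1 + ‖β‖ ^ 2 * P / v) - ‖y - β * x‖ ^ 2 / v + ‖y‖ ^ 2 / (‖β‖ ^ 2 * P + v)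

/-- The exponential is the likelihood of `y` given `x` divided by the marginal density of `y` in the
Gaussian model, so averaging over the input gives one at every single `y`. This pointwise form is
what permits an arbitrary output law. -/
theorem lintegral_exp_gaussianLLR (β : ℂ) {v : ℝ} (hv : 0 < v) (P : ℝ≥0) (y : ℂ) :
    ∫⁻ x, ENNReal.ofReal (Real.exp (gaussianLLR β v P x y)) ∂(complexGaussian P) = 1 := by
  have hP : (0 : ℝ) ≤ P := P.2
  -- `t` is the signal-to-noise ratio, and `h` below is chosen so that the cross term of `‖y - β x‖²
  -- / v` becomes `2 Re(conj h g)`, with `g` the input scaled to unit power.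
  set t : ℝ := ‖β‖ ^ 2 * P / v with ht
  have ht0 : 0 ≤ t := by positivity
  set h : ℂ := conj (conj y * β * ((Real.sqrt P : ℝ) : ℂ) / (v : ℂ)) with hh
  have key : ∀ g : ℂ, Real.exp (gaussianLLR β v P (((Real.sqrt P : ℝ) : ℂ) * g) y) =
      ((1 + t) * Real.exp (-(‖y‖ ^ 2 / v) + ‖y‖ ^ 2 / (‖β‖ ^ 2 * P + v))) *
        Real.exp (-t * ‖g‖ ^ 2 + 2 * (conj h * g).re) := by
    intro g
    have e1 : 1 + t = Real.exp (Real.log (1 + t)) := (Real.exp_log (by positivity)).symm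
    conv_rhs => rw [e1]
    rw [← Real.exp_add, ← Real.exp_add, gaussianLLR, ← ht]
    congr 1
    have e2 : ‖y - β * (((Real.sqrt P : ℝ) : ℂ) * g)‖ ^ 2 = ‖y‖ ^ 2 + ‖β‖ ^ 2 * P * ‖g‖ ^ 2 -
        2 * v * (conj h * g).re := by
      have e3 : v * (conj h * g).re = (y * conj (β * (((Real.sqrt P : ℝ) : ℂ) * g))).re := by
        rw [← Complex.conj_re (y * _), ← Complex.re_ofReal_mul]
        congr 1
        have : (v : ℂ) ≠ 0 := by exact_mod_cast hv.ne'
        simp [hh]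
        field_simp
      have e4 : ‖β * (((Real.sqrt P : ℝ) : ℂ) * g)‖ ^ 2 = ‖β‖ ^ 2 * P * ‖g‖ ^ 2 := by
        simp only [norm_mul, mul_pow, Complex.norm_real, Real.norm_eq_abs, sq_abs,
          Real.sq_sqrt hP]
        ring
      rw [mul_assoc 2 v, e3, ← e4, ← Complex.normSq_eq_norm_sq, Complex.normSq_sub,
        Complex.normSq_eq_norm_sq, Complex.normSq_eq_norm_sq]
    rw [e2, ht]
    field_simp
    ring
  have hmeas : Measurable (fun x => gaussianLLR β v P x y) := by
    unfold gaussianLLR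
    fun_prop
  rw [complexGaussian_eq_map, lintegral_map (by fun_prop) (by fun_prop)]
  simp only [key]
  have hI := integrable_exp_quadratic (t := t) (by linarith) h
  rw [← ofReal_integral_eq_lintegral_ofReal (hI.1.const_mul _) (ae_of_all _ fun x => by positivity),
    integral_const_mul, hI.2]
  have : (1 + t) * Real.exp (-(‖y‖ ^ 2 / v) + ‖y‖ ^ 2 / (‖β‖ ^ 2 * P + v)) *
      ((1 + t)⁻¹ * Real.exp (‖h‖ ^ 2 / (1 + t))) = 1 := by
    have h1 : (1 + t) ≠ 0 := by positivity
    have e : ‖h‖ ^ 2 = ‖y‖ ^ 2 * ‖β‖ ^ 2 * P / v ^ 2 := by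
      simp only [hh, RCLike.norm_conj, norm_mul, norm_div, mul_pow, div_pow, Complex.norm_real,
        Real.norm_eq_abs, sq_abs, Real.sq_sqrt hP]
    rw [mul_mul_mul_comm, mul_inv_cancel₀ h1, one_mul, ← Real.exp_add, e, ht]
    rw [Real.exp_eq_one_iff]
    have h2 : 0 < ‖β‖ ^ 2 * P + v := by positivity
    field_simp
    ring
  rw [this, ENNReal.ofReal_one]

theorem integral_exp_gaussianLLR (β : ℂ) {v : ℝ} (hv : 0 < v) (P : ℝ≥0) (y : ℂ) :
    Integrable (fun x => Real.exp (gaussianLLR β v P x y)) (complexGaussian P) ∧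
      ∫ x, Real.exp (gaussianLLR β v P x y) ∂(complexGaussian P) = 1 := by
  have h := lintegral_exp_gaussianLLR β hv P y
  have hm : AEStronglyMeasurable (fun x => Real.exp (gaussianLLR β v P x y))
      (complexGaussian P) := by
    unfold gaussianLLR
    fun_prop
  have h0 : 0 ≤ᵐ[complexGaussian P] fun x => Real.exp (gaussianLLR β v P x y) :=
    ae_of_all _ fun x => (Real.exp_pos _).le
  refine ⟨(lintegral_ofReal_ne_top_iff_integrable hm h0).1 (by rw [h]; simp), ?_⟩
  rw [integral_eq_lintegral_of_nonneg_ae h0 hm, h, ENNReal.toReal_one]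

theorem integrable_gaussianLLR {Ω : Type*} [MeasurableSpace Ω] {μ : Measure Ω}
    [IsProbabilityMeasure μ] {X Y : Ω → ℂ} (hX : MemLp X 2 μ) (hY : MemLp Y 2 μ) (β : ℂ) (v P : ℝ) :
    Integrable (fun ω => gaussianLLR β v P (X ω) (Y ω)) μ ∧
      ∫ ω, gaussianLLR β v P (X ω) (Y ω) ∂μ = Real.log (1 + ‖β‖ ^ 2 * P / v) -
        (∫ ω, ‖Y ω - β * X ω‖ ^ 2 ∂μ) / v + (∫ ω, ‖Y ω‖ ^ 2 ∂μ) / (‖β‖ ^ 2 * P + v) := by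
  have h1 : Integrable (fun ω => ‖Y ω - β * X ω‖ ^ 2) μ := (hY.sub (hX.const_mul β)).integrable_norm_pow (by norm_num)
  have h2 : Integrable (fun ω => ‖Y ω‖ ^ 2) μ := hY.integrable_norm_pow (by norm_num)
  have h1' := h1.div_const v
  have h2' := h2.div_const (‖β‖ ^ 2 * P + v)
  refine ⟨((integrable_const _).sub h1').add h2', ?_⟩
  unfold gaussianLLR
  have e1 := integral_add ((integrable_const (Real.log (1 + ‖β‖ ^ 2 * P / v))).sub h1') h2'
  have e2 := integral_sub (integrable_const (Real.log (1 + ‖β‖ ^ 2 * P / v))) h1'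
  simp only [Pi.sub_apply] at e1
  rw [e1, e2, integral_div, integral_div]
  simp

/-- The test function is a sum of scalar likelihood ratios. Its exponential factors over the
independent inputs for each fixed output vector, so the outputs may be dependent and non-Gaussian;
they enter only through second moments. -/
theorem ofReal_sum_le_mutualInfo {Ω ι : Type*} [Fintype ι] [MeasurableSpace Ω] {μ : Measure Ω}
    [IsProbabilityMeasure μ] {X Y : Ω → ι → ℂ} {P : ι → ℝ≥0}
    (hXm : Measurable X) (hYm : Measurable Y)
    (hlaw : μ.map X = Measure.pi fun k => complexGaussian (P k))
    (hX : ∀ k, MemLp (fun ω => X ω k) 2 μ) (hY : ∀ k, MemLp (fun ω => Y ω k) 2 μ)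
    (β : ℂ) {v : ℝ} (hv : 0 < v) :
    ENNReal.ofReal (∑ k, (Real.log (1 + ‖β‖ ^ 2 * P k / v) -
        (∫ ω, ‖Y ω k - β * X ω k‖ ^ 2 ∂μ) / v + (∫ ω, ‖Y ω k‖ ^ 2 ∂μ) / (‖β‖ ^ 2 * P k + v))) ≤
      mutualInfo X Y μ := by
  set f : (ι → ℂ) × (ι → ℂ) → ℝ := fun p => ∑ k, gaussianLLR β v (P k) (p.1 k) (p.2 k) with hf
  have hfm : Measurable f := by
    unfold f gaussianLLR
    fun_prop
  have hXY : Measurable (fun ω => (X ω, Y ω)) := hXm.prodMk hYm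
  have : IsProbabilityMeasure (μ.map X) := Measure.isProbabilityMeasure_map hXm.aemeasurable
  have : IsProbabilityMeasure (μ.map Y) := Measure.isProbabilityMeasure_map hYm.aemeasurable
  have : IsProbabilityMeasure (μ.map (fun ω => (X ω, Y ω))) :=
    Measure.isProbabilityMeasure_map hXY.aemeasurable
  have hI := fun k => integrable_gaussianLLR (hX k) (hY k) β v (P k)
  have hfi : Integrable f (μ.map (fun ω => (X ω, Y ω))) := by
    rw [integrable_map_measure hfm.aestronglyMeasurable hXY.aemeasurable]
    exact integrable_finsetSum _ fun k _ => (hI k).1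
  have hle : ∫⁻ p, ENNReal.ofReal (Real.exp (f p)) ∂((μ.map X).prod (μ.map Y)) ≤ 1 := by
    rw [lintegral_prod_symm' _ (by fun_prop)]
    have hin : ∀ y : ι → ℂ, ∫⁻ x, ENNReal.ofReal (Real.exp (f (x, y))) ∂(μ.map X) = 1 := by
      intro y
      rw [hlaw]
      have e : ∀ x : ι → ℂ, ENNReal.ofReal (Real.exp (f (x, y))) =
          ∏ k, ENNReal.ofReal (Real.exp (gaussianLLR β v (P k) (x k) (y k))) := by
        intro x
        rw [← ENNReal.ofReal_prod_of_nonneg (fun _ _ => (Real.exp_pos _).le), ← Real.exp_sum]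
      simp only [e, ← ENNReal.ofReal_prod_of_nonneg (fun _ _ => (Real.exp_pos _).le)]
      have hk := fun k => integral_exp_gaussianLLR β hv (P k) (y k)
      rw [← ofReal_integral_eq_lintegral_ofReal
        (Integrable.fintype_prod fun k => (hk k).1)
        (ae_of_all _ fun x => Finset.prod_nonneg fun _ _ => (Real.exp_pos _).le),
        integral_fintype_prod_eq_prod
        (f := fun k (z : ℂ) => Real.exp (gaussianLLR β v (P k) z (y k)))]
      simp [fun k => (hk k).2]
    simp [hin]
  have h := ofReal_integral_le_klDiv hfm hfi hle
  rw [integral_map hXY.aemeasurable hfm.aestronglyMeasurable] at h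
  simp only [hf] at h
  rw [integral_finsetSum _ fun k _ => (hI k).1] at h
  simp only [fun k => (hI k).2] at h
  exact h


/-! ### Translation and correlation expansions of Gaussian averages -/

theorem complexGaussian_one_eq_withDensity :
    complexGaussian 1 = (volume : Measure ℂ).withDensity
      (fun x => ENNReal.ofReal (Real.pi⁻¹ * Real.exp (-‖x‖ ^ 2))) := by
  have hv : (1 / 2 : ℝ≥0) ≠ 0 := by norm_num
  have e : (gaussianReal 0 (1 / 2)).prod (gaussianReal 0 (1 / 2)) =
      (volume : Measure (ℝ × ℝ)).withDensity
        (fun p => gaussianPDF 0 (1 / 2) p.1 * gaussianPDF 0 (1 / 2) p.2) := by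
    rw [gaussianReal_of_var_ne_zero _ hv, prod_withDensity (measurable_gaussianPDF _ _)
      (measurable_gaussianPDF _ _)]
    rfl
  rw [complexGaussian, e]
  ext s hs
  rw [Measure.map_apply (by fun_prop) hs, withDensity_apply _ hs,
    withDensity_apply _ ((MeasurableEquiv.measurable _) hs)]
  rw [← (Complex.volume_preserving_equiv_real_prod.symm).setLIntegral_comp_preimage_emb
    (MeasurableEquiv.measurableEmbedding _)]
  refine setLIntegral_congr_fun ((MeasurableEquiv.measurable _) hs) fun p _ => ?_
  simp only [gaussianPDF]
  rw [← ENNReal.ofReal_mul (gaussianPDFReal_nonneg _ _ _)]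
  congr 1
  have e1 : (2 * Real.pi * ((1 / 2 : ℝ≥0) : ℝ)) = Real.pi := by push_cast; ring
  rw [gaussianPDFReal, gaussianPDFReal, e1, mul_mul_mul_comm, ← Real.exp_add, ← mul_inv,
    Real.mul_self_sqrt Real.pi_pos.le, ← Complex.normSq_eq_norm_sq, Complex.normSq_apply]
  congr 2
  simp [Complex.measurableEquivRealProd]
  ring

theorem integral_complexGaussian_one {E : Type*} [NormedAddCommGroup E] [NormedSpace ℝ E]
    (f : ℂ → E) :
    ∫ x, f x ∂(complexGaussian 1) = ∫ x, (Real.pi⁻¹ * Real.exp (-‖x‖ ^ 2)) • f x := by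
  rw [complexGaussian_one_eq_withDensity, integral_withDensity_eq_integral_toReal_smul
    (by fun_prop) (by simp)]
  refine integral_congr_ae (ae_of_all _ fun x => ?_)
  have := Real.pi_pos
  simp only
  rw [ENNReal.toReal_ofReal (by positivity)]

/-- The Cameron-Martin formula. It moves the shift from `g` to a smooth weight, so that expansions
in `h` need no differentiability of `g`. -/
theorem integral_add_left_complexGaussian (g : ℂ → ℂ) (h : ℂ) :
    ∫ x, g (h + x) ∂(complexGaussian 1) =
      ∫ x, (Real.exp (2 * (conj h * x).re - ‖h‖ ^ 2)) • g x ∂(complexGaussian 1) := by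
  rw [integral_complexGaussian_one, integral_complexGaussian_one,
    ← integral_add_left_eq_self (fun x => (Real.pi⁻¹ * Real.exp (-‖x‖ ^ 2)) •
      Real.exp (2 * (conj h * x).re - ‖h‖ ^ 2) • g x) h]
  refine integral_congr_ae (ae_of_all _ fun x => ?_)
  simp only
  rw [smul_smul, mul_assoc, ← Real.exp_add]
  congr 3
  simp only [← Complex.normSq_eq_norm_sq, Complex.normSq_apply]
  simp
  ring

theorem integrable_exp_mul_norm_complexGaussian (c : ℝ) :
    Integrable (fun x : ℂ => Real.exp (c * ‖x‖)) (complexGaussian 1) := by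
  have h := (integrable_exp_quadratic (t := -1 / 2) (by norm_num) 0).1
  refine (h.const_mul (Real.exp (c ^ 2 / 2))).mono' (by fun_prop) (ae_of_all _ fun x => ?_)
  rw [Real.norm_of_nonneg (by positivity), ← Real.exp_add]
  apply Real.exp_le_exp.2
  simp
  nlinarith [sq_nonneg (‖x‖ - c)]

theorem norm_le_add_of_lipschitzWith {g : ℂ → ℂ} {K : ℝ≥0} (hg : LipschitzWith K g) (x : ℂ) :
    ‖g x‖ ≤ ‖g 0‖ + K * ‖x‖ := by
  have := hg.dist_le_mul x 0
  rw [dist_eq_norm, dist_zero_right] at this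
  calc ‖g x‖ = ‖g 0 + (g x - g 0)‖ := by congr 1; ring
    _ ≤ _ := (norm_add_le _ _).trans (by linarith)

theorem norm_le_mul_exp_of_lipschitzWith {g : ℂ → ℂ} {K : ℝ≥0} (hg : LipschitzWith K g) (x : ℂ) :
    ‖g x‖ ≤ (‖g 0‖ + K) * Real.exp ‖x‖ := by
  have h1 := norm_le_add_of_lipschitzWith hg x
  have h2 := Real.add_one_le_exp ‖x‖
  have h3 : (1 : ℝ) ≤ Real.exp ‖x‖ := Real.one_le_exp (norm_nonneg x)
  have h4 : ‖x‖ ≤ Real.exp ‖x‖ := by linarith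
  nlinarith [norm_nonneg (g 0), K.2, mul_le_mul_of_nonneg_left h3 (norm_nonneg (g 0)),
    mul_le_mul_of_nonneg_left h4 K.2]

/-- First-order Taylor expansion of the Cameron-Martin weight. In the factor 3, two come from the
quadratic remainder of the exponential and one from the term `-‖h‖²` of the exponent. -/
theorem abs_exp_sub_linear_le {h : ℂ} (hh : ‖h‖ ≤ 1) (x : ℂ) :
    |Real.exp (2 * (conj h * x).re - ‖h‖ ^ 2) - 1 - 2 * (conj h * x).re| ≤
      3 * Real.exp 2 * ‖h‖ ^ 2 * Real.exp (4 * ‖x‖) := by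
  set y := 2 * (conj h * x).re - ‖h‖ ^ 2 with hy
  have hre : |(conj h * x).re| ≤ ‖h‖ * ‖x‖ := by
    refine (Complex.abs_re_le_norm _).trans ?_
    simp
  have hh0 := norm_nonneg h
  have hx0 := norm_nonneg x
  have hyle : |y| ≤ ‖h‖ * (2 * ‖x‖ + 1) := by
    rw [abs_le] at hre ⊢
    constructor <;> nlinarith
  have hyle' : |y| ≤ 2 * ‖x‖ + 1 := hyle.trans (by nlinarith)
  have h1 : |Real.exp y - 1 - y| ≤ |y| ^ 2 * Real.exp |y| := by
    have := Complex.norm_exp_sub_sum_le_norm_mul_exp (y : ℂ) 2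
    simp only [Finset.sum_range_succ, Finset.sum_range_zero, zero_add, pow_zero, Nat.factorial,
      Nat.cast_one, div_one, pow_one, mul_one, Complex.norm_real, Real.norm_eq_abs] at this
    rw [← Real.norm_eq_abs, ← Complex.norm_real]
    refine le_trans (le_of_eq ?_) this
    push_cast
    congr 1
    ring
  have h2 : |y| ^ 2 * Real.exp |y| ≤ 2 * Real.exp 2 * ‖h‖ ^ 2 * Real.exp (4 * ‖x‖) := by
    have e1 : |y| ^ 2 ≤ ‖h‖ ^ 2 * (2 * ‖x‖ + 1) ^ 2 := by
      rw [← mul_pow]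
      exact pow_le_pow_left₀ (abs_nonneg _) hyle 2
    have e2 : (2 * ‖x‖ + 1) ^ 2 ≤ 2 * Real.exp (2 * ‖x‖ + 1) := by
      have := Real.pow_div_factorial_le_exp (2 * ‖x‖ + 1) (by positivity) 2
      rw [div_le_iff₀ (by positivity)] at this
      simpa [Nat.factorial, mul_comm] using this
    calc |y| ^ 2 * Real.exp |y| ≤ (‖h‖ ^ 2 * (2 * Real.exp (2 * ‖x‖ + 1))) *
          Real.exp (2 * ‖x‖ + 1) := by
          gcongr
          exact e1.trans (by gcongr)
      _ = 2 * ‖h‖ ^ 2 * (Real.exp (2 * ‖x‖ + 1) * Real.exp (2 * ‖x‖ + 1)) := by ring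
      _ = 2 * ‖h‖ ^ 2 * (Real.exp 2 * Real.exp (4 * ‖x‖)) := by
          rw [← Real.exp_add, ← Real.exp_add]
          congr 2
          ring
      _ = _ := by ring
  have h3 : ‖h‖ ^ 2 ≤ Real.exp 2 * ‖h‖ ^ 2 * Real.exp (4 * ‖x‖) := by
    have := Real.one_le_exp (show (0 : ℝ) ≤ 2 by norm_num)
    have := Real.one_le_exp (show (0 : ℝ) ≤ 4 * ‖x‖ by positivity)
    calc ‖h‖ ^ 2 = 1 * ‖h‖ ^ 2 * 1 := by ring
      _ ≤ _ := by gcongr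
  have h4 : Real.exp y - 1 - 2 * (conj h * x).re = (Real.exp y - 1 - y) - ‖h‖ ^ 2 := by
    rw [hy]; ring
  rw [h4]
  calc |Real.exp y - 1 - y - ‖h‖ ^ 2| ≤ |Real.exp y - 1 - y| + |‖h‖ ^ 2| := abs_sub _ _
    _ = |Real.exp y - 1 - y| + ‖h‖ ^ 2 := by rw [abs_of_nonneg (sq_nonneg ‖h‖)]
    _ ≤ _ := by linarith

theorem integrable_complexGaussian_of_lipschitzWith {g : ℂ → ℂ} {K : ℝ≥0} (hg : LipschitzWith K g) :
    Integrable g (complexGaussian 1) := by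
  refine ((integrable_exp_mul_norm_complexGaussian 1).const_mul (‖g 0‖ + K)).mono'
    hg.continuous.aestronglyMeasurable (ae_of_all _ fun x => ?_)
  simpa using norm_le_mul_exp_of_lipschitzWith hg x

theorem integrable_norm_mul_pow_of_lipschitzWith {g : ℂ → ℂ} {K : ℝ≥0}
    (hg : LipschitzWith K g) (n : ℕ) :
    Integrable (fun x => ‖g x‖ * ‖x‖ ^ n) (complexGaussian 1) := by
  refine ((integrable_exp_mul_norm_complexGaussian 2).const_mul ((‖g 0‖ + K) * n.factorial)).mono'
    (by have := hg.continuous; fun_prop) (ae_of_all _ fun x => ?_)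
  rw [Real.norm_of_nonneg (by positivity)]
  have h1 := Real.pow_div_factorial_le_exp _ (norm_nonneg x) n
  rw [div_le_iff₀' (by positivity)] at h1
  calc ‖g x‖ * ‖x‖ ^ n ≤ ((‖g 0‖ + K) * Real.exp ‖x‖) * (n.factorial * Real.exp ‖x‖) := by
        gcongr
        exact norm_le_mul_exp_of_lipschitzWith hg x
    _ = (‖g 0‖ + K) * n.factorial * (Real.exp ‖x‖ * Real.exp ‖x‖) := by ring
    _ = _ := by rw [← Real.exp_add, ← two_mul]

/-- The linear part of the Cameron-Martin weight, `h conj x + conj h x`, produces the two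
coefficients. The estimate must hold for all `h`, not only small ones, because it is applied with `h
= r w` for a Gaussian, hence unbounded, `w`. -/
theorem exists_norm_integral_add_left_sub_le {g : ℂ → ℂ} {K : ℝ≥0}
    (hg : LipschitzWith K g) :
    ∃ C : ℝ, 0 ≤ C ∧ ∀ h : ℂ, ‖∫ x, g (h + x) ∂(complexGaussian 1) - (∫ x, g x ∂(complexGaussian 1) +
      h * ∫ x, g x * conj x ∂(complexGaussian 1) + conj h * ∫ x, g x * x ∂(complexGaussian 1))‖ ≤
        C * ‖h‖ ^ 2 := by
  have hgc := hg.continuous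
  set γ := complexGaussian 1
  have hi0 : Integrable g γ := integrable_complexGaussian_of_lipschitzWith hg
  have hi1 : Integrable (fun x => g x * conj x) γ := by
    refine (integrable_norm_mul_pow_of_lipschitzWith hg 1).mono' (by fun_prop)
      (ae_of_all _ fun x => by simp)
  have hi2 : Integrable (fun x => g x * x) γ := by
    refine (integrable_norm_mul_pow_of_lipschitzWith hg 1).mono' (by fun_prop)
      (ae_of_all _ fun x => by simp)
  set a := ∫ x, g x * conj x ∂γ
  set b := ∫ x, g x * x ∂γ
  have hD := (integrable_exp_mul_norm_complexGaussian 5).const_mul ((‖g 0‖ + K) * (3 * Real.exp 2))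
  set D := ∫ x : ℂ, ((‖g 0‖ + K) * (3 * Real.exp 2)) * Real.exp (5 * ‖x‖) ∂γ
  have hD0 : 0 ≤ D := integral_nonneg fun x => by positivity
  refine ⟨D + (K + ‖a‖ + ‖b‖), by positivity, fun h => ?_⟩
  have hshift : Integrable (fun x => g (h + x)) γ := by
    have : LipschitzWith K (fun x => g (h + x)) := by
      have := hg.comp (LipschitzWith.of_dist_le_mul (K := 1) (f := fun x : ℂ => h + x)
        (fun x y => by simp))
      simpa [Function.comp_def] using this
    exact integrable_complexGaussian_of_lipschitzWith this
  -- For `‖h‖ ≤ 1` the weight is expanded; for `‖h‖ ≥ 1` the Lipschitz bound is linear in `‖h‖`,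
  -- which is at most `‖h‖²`.
  rcases le_total ‖h‖ 1 with hh | hh
  · have hE : ∀ x, ‖Real.exp (2 * (conj h * x).re - ‖h‖ ^ 2) • g x - (g x + h * (g x * conj x) +
        conj h * (g x * x))‖ ≤ ‖h‖ ^ 2 * (((‖g 0‖ + K) * (3 * Real.exp 2)) * Real.exp (5 * ‖x‖)) := by
      intro x
      have e : Real.exp (2 * (conj h * x).re - ‖h‖ ^ 2) • g x - (g x + h * (g x * conj x) +
          conj h * (g x * x)) =
          (Real.exp (2 * (conj h * x).re - ‖h‖ ^ 2) - 1 - 2 * (conj h * x).re : ℝ) • g x := by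
        have e2 : ((2 * (conj h * x).re : ℝ) : ℂ) = h * conj x + conj h * x := by
          have := Complex.add_conj (conj h * x)
          rw [← this]
          simp
          ring
        rw [Complex.real_smul, Complex.real_smul]
        push_cast at e2 ⊢
        rw [e2]
        ring
      rw [e, norm_smul, Real.norm_eq_abs]
      calc _ ≤ (3 * Real.exp 2 * ‖h‖ ^ 2 * Real.exp (4 * ‖x‖)) *
            ((‖g 0‖ + K) * Real.exp ‖x‖) := by
            gcongr
            · exact abs_exp_sub_linear_le hh x
            · exact norm_le_mul_exp_of_lipschitzWith hg x
        _ = ‖h‖ ^ 2 * (((‖g 0‖ + K) * (3 * Real.exp 2)) *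
            (Real.exp (4 * ‖x‖) * Real.exp ‖x‖)) := by ring
        _ = _ := by
            rw [← Real.exp_add]
            congr 4
            ring
    have hlin : ∫ x, (g x + h * (g x * conj x) + conj h * (g x * x)) ∂γ =
        ∫ x, g x ∂γ + h * a + conj h * b := by
      have e1 := integral_add (hi0.add (hi1.const_mul h)) (hi2.const_mul (conj h))
      have e2 := integral_add hi0 (hi1.const_mul h)
      simp only [Pi.add_apply] at e1
      rw [e1, e2, integral_const_mul, integral_const_mul]
    have hlini : Integrable (fun x => g x + h * (g x * conj x) + conj h * (g x * x)) γ :=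
      (hi0.add (hi1.const_mul h)).add (hi2.const_mul (conj h))
    have hexpi : Integrable (fun x => Real.exp (2 * (conj h * x).re - ‖h‖ ^ 2) • g x) γ := by
      have hd : Integrable (fun x => Real.exp (2 * (conj h * x).re - ‖h‖ ^ 2) • g x -
          (g x + h * (g x * conj x) + conj h * (g x * x))) γ :=
        (hD.const_mul (‖h‖ ^ 2)).mono' (by fun_prop) (ae_of_all _ hE)
      exact (hd.add hlini).congr (ae_of_all _ fun x => sub_add_cancel _ _)
    rw [integral_add_left_complexGaussian, ← hlin, ← integral_sub hexpi hlini]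
    calc _ ≤ ∫ x, ‖h‖ ^ 2 * (((‖g 0‖ + K) * (3 * Real.exp 2)) * Real.exp (5 * ‖x‖)) ∂γ :=
          norm_integral_le_of_norm_le (hD.const_mul (‖h‖ ^ 2)) (ae_of_all _ hE)
      _ = D * ‖h‖ ^ 2 := by rw [integral_const_mul, mul_comm]
      _ ≤ _ := by
          gcongr
          have : 0 ≤ (K : ℝ) + ‖a‖ + ‖b‖ := by positivity
          linarith
  · have e : ∫ x, g (h + x) ∂γ - (∫ x, g x ∂γ + h * a + conj h * b) =
        ∫ x, (g (h + x) - g x) ∂γ - h * a - conj h * b := by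
      rw [integral_sub hshift hi0]
      ring
    rw [e]
    have h1 : ‖∫ x, (g (h + x) - g x) ∂γ‖ ≤ K * ‖h‖ := by
      have := norm_integral_le_of_norm_le_const (μ := γ) (f := fun x => g (h + x) - g x)
        (C := K * ‖h‖) (ae_of_all _ fun x => by
          have := hg.dist_le_mul (h + x) x
          simpa [dist_eq_norm] using this)
      simpa using this
    calc _ ≤ K * ‖h‖ + ‖h‖ * ‖a‖ + ‖h‖ * ‖b‖ := by
          refine (norm_sub_le _ _).trans (add_le_add ((norm_sub_le _ _).trans
            (add_le_add h1 (by simp))) (by simp))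
      _ = (K + ‖a‖ + ‖b‖) * ‖h‖ := by ring
      _ ≤ (K + ‖a‖ + ‖b‖) * ‖h‖ ^ 2 := by
          gcongr
          nlinarith
      _ ≤ _ := mul_le_mul_of_nonneg_right (by linarith) (sq_nonneg _)

/-- Condition on `w = p.2`. In the inner average, changing the scale `s` to 1 costs `O(1 - s) =
O(‖r‖²)`, after which the shift expansion applies with `h = r w`. Multiplying by `conj (g w)` and
averaging turns each coefficient into its squared modulus. -/
theorem exists_norm_integral_integral_sub_le {g : ℂ → ℂ} {K : ℝ≥0} (hg : LipschitzWith K g) :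
    ∃ C : ℝ, 0 ≤ C ∧ ∀ (r : ℂ) (s : ℝ), 0 ≤ s → ‖r‖ ^ 2 + s ^ 2 = 1 →
      ‖∫ p : ℂ × ℂ, g (r * p.2 + s * p.1) * conj (g p.2)
          ∂((complexGaussian 1).prod (complexGaussian 1)) -
        ((‖∫ x, g x ∂(complexGaussian 1)‖ ^ 2 : ℝ) +
          (‖∫ x, g x * conj x ∂(complexGaussian 1)‖ ^ 2 : ℝ) * r +
          (‖∫ x, g x * x ∂(complexGaussian 1)‖ ^ 2 : ℝ) * conj r)‖ ≤ C * ‖r‖ ^ 2 := by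
  have hgc := hg.continuous
  obtain ⟨C, hC0, hC⟩ := exists_norm_integral_add_left_sub_le hg
  set γ := complexGaussian 1 with hγ
  have hi0 : Integrable g γ := integrable_complexGaussian_of_lipschitzWith hg
  have hi1 : Integrable (fun x => g x * conj x) γ := by
    refine (integrable_norm_mul_pow_of_lipschitzWith hg 1).mono' (by fun_prop)
      (ae_of_all _ fun x => by simp)
  have hi2 : Integrable (fun x => g x * x) γ := by
    refine (integrable_norm_mul_pow_of_lipschitzWith hg 1).mono' (by fun_prop)
      (ae_of_all _ fun x => by simp)
  have hi3 : Integrable (fun x => ‖g x‖ * ‖x‖ ^ 2) γ :=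
    integrable_norm_mul_pow_of_lipschitzWith hg 2
  have hn1 : Integrable (fun x : ℂ => ‖x‖) γ := by
    simpa using integrable_norm_pow_complexGaussian 1
  set m := ∫ x, g x ∂γ
  set a := ∫ x, g x * conj x ∂γ
  set b := ∫ x, g x * x ∂γ
  set A := ∫ x : ℂ, ‖x‖ ∂γ
  have hA0 : 0 ≤ A := integral_nonneg fun x => norm_nonneg x
  have hD : Integrable (fun x => K * A * ‖g x‖ + C * (‖g x‖ * ‖x‖ ^ 2)) γ :=
    (hi0.norm.const_mul _).add (hi3.const_mul _)
  refine ⟨∫ x, (K * A * ‖g x‖ + C * (‖g x‖ * ‖x‖ ^ 2)) ∂γ,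
    integral_nonneg fun x => by positivity, fun r s hs hrs => ?_⟩
  have hr1 : ‖r‖ ≤ 1 := by nlinarith [sq_nonneg s, norm_nonneg r]
  have hs1 : s ≤ 1 := by nlinarith [sq_nonneg ‖r‖]
  -- Since `0 ≤ s ≤ 1`, `1 - s ≤ (1 - s)(1 + s) = ‖r‖²`.
  have hsr : 1 - s ≤ ‖r‖ ^ 2 := by nlinarith
  have hshift : ∀ (c : ℝ) (w : ℂ), Integrable (fun x => g (w + c * x)) γ := by
    intro c w
    have h1 : LipschitzWith ‖c‖₊ (fun x : ℂ => w + c * x) :=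
      LipschitzWith.of_dist_le_mul fun x y => by
        rw [dist_add_left, dist_eq_norm, dist_eq_norm, ← mul_sub, norm_mul]
        simp
    exact integrable_complexGaussian_of_lipschitzWith (hg.comp h1)
  have hin : ∀ w : ℂ, ‖∫ x, g (r * w + s * x) ∂γ - (m + r * w * a + conj (r * w) * b)‖ ≤
      ‖r‖ ^ 2 * (K * A + C * ‖w‖ ^ 2) := by
    intro w
    have h1 := hC (r * w)
    have h2 : ‖∫ x, g (r * w + s * x) ∂γ - ∫ x, g (r * w + x) ∂γ‖ ≤ ‖r‖ ^ 2 * (K * A) := by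
      have hs1' := hshift 1 (r * w)
      simp only [Complex.ofReal_one, one_mul] at hs1'
      rw [← integral_sub (hshift s (r * w)) hs1']
      calc _ ≤ ∫ x : ℂ, ‖r‖ ^ 2 * K * ‖x‖ ∂γ := by
            refine norm_integral_le_of_norm_le (hn1.const_mul _) (ae_of_all _ fun x => ?_)
            have := hg.dist_le_mul (r * w + s * x) (r * w + x)
            rw [dist_eq_norm, dist_add_left, dist_eq_norm] at this
            refine this.trans ?_
            have e : (s : ℂ) * x - x = ((s - 1 : ℝ) : ℂ) * x := by push_cast; ring
            rw [e, norm_mul, Complex.norm_real, Real.norm_eq_abs, abs_sub_comm,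
              abs_of_nonneg (by linarith)]
            have := mul_le_mul_of_nonneg_right hsr (norm_nonneg x)
            calc K * ((1 - s) * ‖x‖) ≤ K * (‖r‖ ^ 2 * ‖x‖) := by gcongr
              _ = _ := by ring
        _ = _ := by rw [integral_const_mul]; ring
    rw [norm_mul, mul_pow] at h1
    calc _ = ‖(∫ x, g (r * w + s * x) ∂γ - ∫ x, g (r * w + x) ∂γ) +
          (∫ x, g (r * w + x) ∂γ - (m + r * w * a + conj (r * w) * b))‖ := by congr 1; ring
      _ ≤ _ := (norm_add_le _ _).trans (by linarith)
  have hint : Integrable (fun p : ℂ × ℂ => g (r * p.2 + s * p.1) * conj (g p.2)) (γ.prod γ) := by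
    have hm2 := (integrable_exp_mul_norm_complexGaussian 1).mul_prod
      (integrable_exp_mul_norm_complexGaussian 2)
    refine (hm2.const_mul ((‖g 0‖ + K) * (‖g 0‖ + K))).mono' (by fun_prop)
      (ae_of_all _ fun p => ?_)
    rw [norm_mul, RCLike.norm_conj]
    calc _ ≤ ((‖g 0‖ + K) * Real.exp ‖r * p.2 + s * p.1‖) * ((‖g 0‖ + K) * Real.exp ‖p.2‖) := by
          gcongr <;> exact norm_le_mul_exp_of_lipschitzWith hg _
      _ ≤ ((‖g 0‖ + K) * (Real.exp ‖p.2‖ * Real.exp ‖p.1‖)) *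
            ((‖g 0‖ + K) * Real.exp ‖p.2‖) := by
          gcongr
          rw [← Real.exp_add]
          apply Real.exp_le_exp.2
          refine (norm_add_le _ _).trans ?_
          rw [norm_mul, norm_mul, Complex.norm_real, Real.norm_of_nonneg hs]
          nlinarith [norm_nonneg p.1, norm_nonneg p.2]
      _ = (‖g 0‖ + K) * (‖g 0‖ + K) * (Real.exp ‖p.1‖ * (Real.exp ‖p.2‖ * Real.exp ‖p.2‖)) := by
          ring
      _ = _ := by
          rw [← Real.exp_add ‖p.2‖, ← two_mul, one_mul]
  rw [integral_prod_symm _ hint]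
  simp only [integral_mul_const]
  have hI1 : Integrable (fun w => (∫ x, g (r * w + s * x) ∂γ) * conj (g w)) γ := by
    have := hint.integral_prod_right
    simpa only [integral_mul_const] using this
  have hg' : Integrable (fun w => conj (g w)) γ :=
    hi0.norm.mono' (by fun_prop) (ae_of_all _ fun x => by simp)
  have hga' : Integrable (fun w => w * conj (g w)) γ :=
    hi2.norm.mono' (by fun_prop) (ae_of_all _ fun x => by simp [mul_comm])
  have hgb' : Integrable (fun w => conj w * conj (g w)) γ :=
    hi2.norm.mono' (by fun_prop) (ae_of_all _ fun x => by simp [mul_comm])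
  have hlin : ∫ w, (m + r * w * a + conj (r * w) * b) * conj (g w) ∂γ =
      (‖m‖ ^ 2 : ℝ) + (‖a‖ ^ 2 : ℝ) * r + (‖b‖ ^ 2 : ℝ) * conj r := by
    have e0 : ∀ w, (m + r * w * a + conj (r * w) * b) * conj (g w) =
        (m * conj (g w) + (r * a) * (w * conj (g w))) + (conj r * b) * (conj w * conj (g w)) := by
      intro w
      rw [map_mul]
      ring
    simp only [e0]
    have e1 := integral_add ((hg'.const_mul m).add (hga'.const_mul (r * a)))
      (hgb'.const_mul (conj r * b))
    have e2 := integral_add (hg'.const_mul m) (hga'.const_mul (r * a))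
    simp only [Pi.add_apply] at e1
    rw [e1, e2, integral_const_mul, integral_const_mul, integral_const_mul]
    have f1 : ∫ w, conj (g w) ∂γ = conj m := integral_conj
    have f2 : ∫ w, w * conj (g w) ∂γ = conj a := by
      rw [← integral_conj]
      congr 1
      ext w
      simp [mul_comm]
    have f3 : ∫ w, conj w * conj (g w) ∂γ = conj b := by
      rw [← integral_conj]
      congr 1
      ext w
      simp [mul_comm]
    rw [f1, f2, f3, mul_assoc r, mul_assoc (conj r), Complex.mul_conj', Complex.mul_conj',
      Complex.mul_conj']
    push_cast
    ring
  have hlini : Integrable (fun w => (m + r * w * a + conj (r * w) * b) * conj (g w)) γ := by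
    have := ((hg'.const_mul m).add (hga'.const_mul (r * a))).add (hgb'.const_mul (conj r * b))
    refine this.congr (ae_of_all _ fun w => ?_)
    simp only [Pi.add_apply, map_mul]
    ring
  rw [← hlin, ← integral_sub hI1 hlini]
  calc _ ≤ ∫ w, ‖r‖ ^ 2 * (K * A * ‖g w‖ + C * (‖g w‖ * ‖w‖ ^ 2)) ∂γ := by
        refine norm_integral_le_of_norm_le (hD.const_mul _) (ae_of_all _ fun w => ?_)
        rw [← sub_mul, norm_mul, RCLike.norm_conj]
        calc _ ≤ ‖r‖ ^ 2 * (K * A + C * ‖w‖ ^ 2) * ‖g w‖ := by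
              gcongr
              exact hin w
          _ = _ := by ring
    _ = _ := by rw [integral_const_mul, mul_comm]

theorem map_dotProduct_stdVec {n : Type*} [Fintype n] (x : n → ℂ) (hx : x ⬝ᵥ star x = 1) :
    (stdVec n).map (fun ζ => x ⬝ᵥ ζ) = complexGaussian 1 := by
  have h := map_mulVec_stdVec_eq (Matrix.of fun (_ : Fin 1) k => x k)
    (1 : Matrix (Fin 1) (Fin 1) ℂ) (by
      ext i j
      fin_cases i; fin_cases j
      simpa [Matrix.mul_apply, dotProduct] using hx)
  have h2 := congrArg (fun μ : Measure (Fin 1 → ℂ) => μ.map (fun y => y 0)) h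
  rw [Measure.map_map (by fun_prop) (measurable_mulVec _),
    Measure.map_map (by fun_prop) (measurable_mulVec _)] at h2
  simp only [Function.comp_def, Matrix.one_mulVec] at h2
  have h3 : (stdVec (Fin 1)).map (fun y => y 0) = complexGaussian 1 :=
    (measurePreserving_eval (fun _ : Fin 1 => complexGaussian 1) 0).map_eq
  rw [h3] at h2
  exact h2

/-- A triangular factorization of the 2×2 correlation matrix: the rows `(s, r)` and `(0, 1)` have
the same Gram matrix as `x` and `y`. -/
theorem map_dotProduct_prodMk_stdVec {n : Type*} [Fintype n] (x y : n → ℂ)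
    (hx : x ⬝ᵥ star x = 1) (hy : y ⬝ᵥ star y = 1) (s : ℝ) (hs : ‖x ⬝ᵥ star y‖ ^ 2 + s ^ 2 = 1) :
    (stdVec n).map (fun ζ => (x ⬝ᵥ ζ, y ⬝ᵥ ζ)) =
      ((complexGaussian 1).prod (complexGaussian 1)).map
        (fun p => ((x ⬝ᵥ star y) * p.2 + s * p.1, p.2)) := by
  set r := x ⬝ᵥ star y with hr
  have hr' : y ⬝ᵥ star x = conj r := by
    rw [hr, ← Complex.star_def, ← Matrix.star_dotProduct_star, star_star]
  have h := map_mulVec_stdVec_eq (Matrix.of ![x, y]) (!![(s : ℂ), r; 0, 1]) (by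
      have hrs : (s : ℂ) * s + r * conj r = 1 := by
        rw [Complex.mul_conj']
        exact_mod_cast (by rw [← hs]; ring : s * s + ‖r‖ ^ 2 = 1)
      ext i j
      fin_cases i <;> fin_cases j <;>
      simp [Matrix.mul_apply, Fin.sum_univ_two]
      · rw [hrs]; exact hx
      · exact hr.symm
      · exact hr'
      · exact hy)
  have h2 := congrArg (fun μ : Measure (Fin 2 → ℂ) => μ.map (fun y => (y 0, y 1))) h
  rw [Measure.map_map (by fun_prop) (measurable_mulVec _),
    Measure.map_map (by fun_prop) (measurable_mulVec _)] at h2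
  have h3 : (stdVec (Fin 2)).map (fun y => (y 0, y 1)) =
      (complexGaussian 1).prod (complexGaussian 1) :=
    (measurePreserving_finTwoArrow (complexGaussian 1)).map_eq
  rw [← h3, Measure.map_map (by fun_prop) (by fun_prop)]
  convert h2 using 2
  · funext ζ
    simp
  · funext ζ
    simp [dotProduct, Fin.sum_univ_two, add_comm]

theorem norm_dotProduct_star_le_one {n : Type*} [Fintype n] (x y : n → ℂ)
    (hx : x ⬝ᵥ star x = 1) (hy : y ⬝ᵥ star y = 1) : ‖x ⬝ᵥ star y‖ ≤ 1 := by
  have hn : ∀ z : n → ℂ, z ⬝ᵥ star z = 1 → ‖WithLp.toLp 2 z‖ = 1 := by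
    intro z hz
    have : ‖WithLp.toLp 2 z‖ ^ 2 = 1 := by
      have h := inner_self_eq_norm_sq (𝕜 := ℂ) (WithLp.toLp 2 z)
      rw [EuclideanSpace.inner_toLp_toLp, hz] at h
      simpa using h.symm
    nlinarith [norm_nonneg (WithLp.toLp 2 z)]
  have h := norm_inner_le_norm (𝕜 := ℂ) (WithLp.toLp 2 y) (WithLp.toLp 2 x)
  rw [EuclideanSpace.inner_toLp_toLp, hn x hx, hn y hy] at h
  simpa using h

/-- First-order expansion, in the correlation, of the cross moment of a Lipschitz function of two
jointly circular Gaussian variables. -/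
theorem exists_norm_integral_stdVec_sub_le {g : ℂ → ℂ} {K : ℝ≥0} (hg : LipschitzWith K g) :
    ∃ C : ℝ, 0 ≤ C ∧ ∀ (N : ℕ) (x y : Fin N → ℂ), x ⬝ᵥ star x = 1 → y ⬝ᵥ star y = 1 →
      ‖∫ ζ, g (x ⬝ᵥ ζ) * conj (g (y ⬝ᵥ ζ)) ∂(stdVec (Fin N)) -
        ((‖∫ x, g x ∂(complexGaussian 1)‖ ^ 2 : ℝ) +
          (‖∫ x, g x * conj x ∂(complexGaussian 1)‖ ^ 2 : ℝ) * (x ⬝ᵥ star y) +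
          (‖∫ x, g x * x ∂(complexGaussian 1)‖ ^ 2 : ℝ) * conj (x ⬝ᵥ star y))‖ ≤
        C * ‖x ⬝ᵥ star y‖ ^ 2 := by
  obtain ⟨C, hC0, hC⟩ := exists_norm_integral_integral_sub_le hg
  refine ⟨C, hC0, fun N x y hx hy => ?_⟩
  have hgc := hg.continuous
  have hr1 := norm_dotProduct_star_le_one x y hx hy
  have hs : ‖x ⬝ᵥ star y‖ ^ 2 + (Real.sqrt (1 - ‖x ⬝ᵥ star y‖ ^ 2)) ^ 2 = 1 := by
    rw [Real.sq_sqrt (by nlinarith [norm_nonneg (x ⬝ᵥ star y)])]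
    ring
  have hlaw := map_dotProduct_prodMk_stdVec x y hx hy _ hs
  have hd : ∀ x : Fin N → ℂ, Continuous fun ζ : Fin N → ℂ => x ⬝ᵥ ζ := fun x =>
    continuous_const.dotProduct continuous_id
  have e1 : ∫ ζ, g (x ⬝ᵥ ζ) * conj (g (y ⬝ᵥ ζ)) ∂(stdVec (Fin N)) =
      ∫ q : ℂ × ℂ, g q.1 * conj (g q.2) ∂((stdVec (Fin N)).map (fun ζ => (x ⬝ᵥ ζ, y ⬝ᵥ ζ))) := by
    rw [integral_map ((hd x).prodMk (hd y)).measurable.aemeasurable (by fun_prop)]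
  rw [e1, hlaw, integral_map (by fun_prop) (by fun_prop)]
  exact hC _ _ (Real.sqrt_nonneg _) hs


/-! ### Second moments of componentwise nonlinear functions of Gaussian vectors -/

theorem memLp_two_of_lipschitzWith {Ω : Type*} [MeasurableSpace Ω] {μ : Measure Ω}
    [IsFiniteMeasure μ] {X Y : Ω → ℂ} (hX : MemLp X 2 μ) (hY : MemLp Y 2 μ)
    {ψ : ℂ → ℂ → ℂ} {K : ℝ≥0} (hψ : LipschitzWith K (fun p : ℂ × ℂ => ψ p.1 p.2)) :
    MemLp (fun ω => ψ (X ω) (Y ω)) 2 μ := by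
  have h := (memLp_const (μ := μ) (p := 2) (‖ψ 0 0‖)).add
    ((hX.norm.add hY.norm).const_mul (K : ℝ))
  refine h.mono (hψ.continuous.comp_aestronglyMeasurable (hX.1.prodMk hY.1))
    (ae_of_all _ fun ω => ?_)
  have h1 := hψ.dist_le_mul (X ω, Y ω) (0, 0)
  rw [dist_eq_norm, Prod.dist_eq] at h1
  simp only [dist_zero_right] at h1
  have h2 : max ‖X ω‖ ‖Y ω‖ ≤ ‖X ω‖ + ‖Y ω‖ :=
    max_le (by linarith [norm_nonneg (Y ω)]) (by linarith [norm_nonneg (X ω)])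
  have h3 := mul_le_mul_of_nonneg_left h2 K.2
  simp only [Pi.add_apply]
  rw [Real.norm_of_nonneg (by positivity)]
  calc ‖ψ (X ω) (Y ω)‖ = ‖ψ 0 0 + (ψ (X ω) (Y ω) - ψ 0 0)‖ := by congr 1; ring
    _ ≤ _ := (norm_add_le _ _).trans (by linarith!)

/-- Averaging out the noise leaves a Lipschitz function of the Gaussian variable alone, to which the
correlation expansion applies. -/
theorem lipschitzWith_integral_right {ν : Measure ℂ} [IsProbabilityMeasure ν]
    (hν : MemLp (fun ξ : ℂ => ξ) 2 ν) {ψ : ℂ → ℂ → ℂ} {K : ℝ≥0}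
    (hψ : LipschitzWith K (fun p : ℂ × ℂ => ψ p.1 p.2)) :
    LipschitzWith K (fun w => ∫ ξ, ψ w ξ ∂ν) := by
  refine LipschitzWith.of_dist_le_mul fun w w' => ?_
  have hi : ∀ w, Integrable (fun ξ => ψ w ξ) ν := fun w =>
    (memLp_two_of_lipschitzWith (memLp_const w) hν hψ).integrable (by norm_num)
  rw [dist_eq_norm, ← integral_sub (hi w) (hi w')]
  have := norm_integral_le_of_norm_le_const (μ := ν) (f := fun ξ => ψ w ξ - ψ w' ξ)
    (C := K * dist w w') (ae_of_all _ fun ξ => by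
      have := hψ.dist_le_mul (w, ξ) (w', ξ)
      simpa [dist_eq_norm, Prod.dist_eq] using this)
  simpa using this

theorem memLp_id_complexGaussian (P : ℝ≥0) : MemLp (fun x : ℂ => x) 2 (complexGaussian P) :=
  (memLp_two_iff_integrable_sq_norm (by fun_prop)).2 (integrable_norm_sq_complexGaussian P)

instance (N : ℕ) (ν : Measure ℂ) [IsProbabilityMeasure ν] :
    IsProbabilityMeasure (noiseLaw N ν) := by
  unfold noiseLaw; infer_instance

instance {M N : ℕ} (P : Fin M → ℝ≥0) (a : Fin N → Fin M) :
    IsProbabilityMeasure (inputLaw P a) := by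
  unfold inputLaw; infer_instance

theorem memLp_eval_noiseLaw {N : ℕ} {ν : Measure ℂ} [IsProbabilityMeasure ν]
    (hν : MemLp (fun ξ : ℂ => ξ) 2 ν) (i : Fin N) :
    MemLp (fun ξ : Fin N → ℂ => ξ i) 2 (noiseLaw N ν) :=
  hν.comp_measurePreserving (measurePreserving_eval (fun _ : Fin N => ν) i)

theorem memLp_eval_stdVec {n : Type*} [Fintype n] (i : n) :
    MemLp (fun ζ : n → ℂ => ζ i) 2 (stdVec n) :=
  (memLp_id_complexGaussian 1).comp_measurePreserving
    (measurePreserving_eval (fun _ : n => complexGaussian 1) i)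

theorem memLp_dotProduct_stdVec {n : Type*} [Fintype n] (x : n → ℂ) :
    MemLp (fun ζ : n → ℂ => x ⬝ᵥ ζ) 2 (stdVec n) := by
  unfold dotProduct
  exact memLp_finsetSum _ fun i _ => (memLp_eval_stdVec i).const_mul _

/-- The law of `(w, ξ_i)`, where `w` is a standard Gaussian linear functional of the input. -/
theorem measurePreserving_dotProduct_prodMk {N : ℕ} (ν : Measure ℂ) [IsProbabilityMeasure ν]
    {x : Fin N → ℂ} (hx : x ⬝ᵥ star x = 1) (i : Fin N) :
    MeasurePreserving (fun p : (Fin N → ℂ) × (Fin N → ℂ) => (x ⬝ᵥ p.1, p.2 i))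
      ((stdVec (Fin N)).prod (noiseLaw N ν)) ((complexGaussian 1).prod ν) := by
  have h1 : MeasurePreserving (fun ζ : Fin N → ℂ => x ⬝ᵥ ζ) (stdVec (Fin N)) (complexGaussian 1) :=
    ⟨(continuous_const.dotProduct continuous_id).measurable, map_dotProduct_stdVec x hx⟩
  exact h1.prod (measurePreserving_eval (fun _ : Fin N => ν) i)

theorem integral_noiseLaw_mul_conj {N : ℕ} {ν : Measure ℂ} [IsProbabilityMeasure ν]
    (f h : ℂ → ℂ) (hf : Measurable f) (hh : Measurable h) {i j : Fin N} (hij : i ≠ j) :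
    ∫ ξ, f (ξ i) * conj (h (ξ j)) ∂(noiseLaw N ν) = (∫ ξ, f ξ ∂ν) * conj (∫ ξ, h ξ ∂ν) := by
  have hind : iIndepFun (fun (k : Fin N) (ξ : Fin N → ℂ) => ξ k) (noiseLaw N ν) :=
    iIndepFun_pi (μ := fun _ : Fin N => ν) (X := fun _ x => x) (fun _ => aemeasurable_id)
  have h2 := (hind.indepFun hij).comp hf (φ := f) (ψ := fun x => conj (h x))
    (RCLike.continuous_conj.measurable.comp hh)
  have h3 := h2.integral_fun_mul_eq_mul_integral
    (hf.comp (measurable_pi_apply i)).aestronglyMeasurable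
    ((RCLike.continuous_conj.measurable.comp hh).comp (measurable_pi_apply j)).aestronglyMeasurable
  simp only [Function.comp_def] at h3
  rw [h3]
  have hmp := fun k : Fin N => measurePreserving_eval (fun _ : Fin N => ν) k
  have e1 : ∫ ξ, f (ξ i) ∂(noiseLaw N ν) = ∫ ξ, f ξ ∂ν := by
    conv_rhs => rw [← (hmp i).map_eq]
    rw [integral_map (hmp i).measurable.aemeasurable hf.aestronglyMeasurable]
    rfl
  have hch : Measurable (fun ξ => conj (h ξ)) := RCLike.continuous_conj.measurable.comp hh
  have e2 : ∫ ξ, conj (h (ξ j)) ∂(noiseLaw N ν) = ∫ ξ, conj (h ξ) ∂ν := by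
    conv_rhs => rw [← (hmp j).map_eq]
    rw [integral_map (hmp j).measurable.aemeasurable
      hch.aestronglyMeasurable]
    rfl
  rw [e1, e2, integral_conj]

theorem memLp_two_lipschitz_prod {N : ℕ} {ν : Measure ℂ} [IsProbabilityMeasure ν]
    (hν : MemLp (fun ξ : ℂ => ξ) 2 ν) {ψ : ℂ → ℂ → ℂ} {K : ℝ≥0}
    (hψ : LipschitzWith K (fun p : ℂ × ℂ => ψ p.1 p.2)) (x : Fin N → ℂ) (i : Fin N) :
    MemLp (fun p : (Fin N → ℂ) × (Fin N → ℂ) => ψ (x ⬝ᵥ p.1) (p.2 i)) 2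
      ((stdVec (Fin N)).prod (noiseLaw N ν)) :=
  memLp_two_of_lipschitzWith (X := fun p : (Fin N → ℂ) × (Fin N → ℂ) => x ⬝ᵥ p.1)
    (Y := fun p => p.2 i) ((memLp_dotProduct_stdVec x).comp_fst _)
    ((memLp_eval_noiseLaw hν i).comp_snd _) hψ

/-- Given the input, distinct components carry independent noise, so off the diagonal only the
noise-averaged nonlinearity is seen. -/
theorem integral_prod_noiseLaw_mul_conj {N : ℕ} {ν : Measure ℂ} [IsProbabilityMeasure ν]
    (hν : MemLp (fun ξ : ℂ => ξ) 2 ν) {ψ : ℂ → ℂ → ℂ} {K : ℝ≥0}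
    (hψ : LipschitzWith K (fun p : ℂ × ℂ => ψ p.1 p.2)) (x y : Fin N → ℂ) {i j : Fin N}
    (hij : i ≠ j) :
    ∫ p : (Fin N → ℂ) × (Fin N → ℂ), ψ (x ⬝ᵥ p.1) (p.2 i) * conj (ψ (y ⬝ᵥ p.1) (p.2 j))
        ∂((stdVec (Fin N)).prod (noiseLaw N ν)) =
      ∫ ζ, (∫ ξ, ψ (x ⬝ᵥ ζ) ξ ∂ν) * conj (∫ ξ, ψ (y ⬝ᵥ ζ) ξ ∂ν) ∂(stdVec (Fin N)) := by
  have hm : ∀ (x : Fin N → ℂ) (i : Fin N),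
      MemLp (fun p : (Fin N → ℂ) × (Fin N → ℂ) => ψ (x ⬝ᵥ p.1) (p.2 i)) 2
        ((stdVec (Fin N)).prod (noiseLaw N ν)) := fun x i =>
    memLp_two_lipschitz_prod hν hψ x i
  have hint : Integrable (fun p : (Fin N → ℂ) × (Fin N → ℂ) =>
      ψ (x ⬝ᵥ p.1) (p.2 i) * conj (ψ (y ⬝ᵥ p.1) (p.2 j)))
        ((stdVec (Fin N)).prod (noiseLaw N ν)) :=
    (hm x i).integrable_mul (hm y j).star
  rw [integral_prod _ hint]
  have hc : ∀ w, Measurable (fun ξ => ψ w ξ) := fun w =>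
    (hψ.continuous.comp (Continuous.prodMk continuous_const continuous_id)).measurable
  refine integral_congr_ae (ae_of_all _ fun ζ => ?_)
  exact integral_noiseLaw_mul_conj (ν := ν) (ψ (x ⬝ᵥ ζ)) (ψ (y ⬝ᵥ ζ)) (hc _) (hc _) hij

theorem integral_dotProduct_prod_noiseLaw {N : ℕ} {ν : Measure ℂ} [IsProbabilityMeasure ν]
    (f : ℂ → ℂ → ℝ) (hf : Continuous (fun p : ℂ × ℂ => f p.1 p.2))
    {x : Fin N → ℂ} (hx : x ⬝ᵥ star x = 1) (i : Fin N) :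
    ∫ p : (Fin N → ℂ) × (Fin N → ℂ), f (x ⬝ᵥ p.1) (p.2 i)
        ∂((stdVec (Fin N)).prod (noiseLaw N ν)) =
      ∫ q : ℂ × ℂ, f q.1 q.2 ∂((complexGaussian 1).prod ν) := by
  have h := measurePreserving_dotProduct_prodMk ν hx i
  rw [← h.map_eq, integral_map h.measurable.aemeasurable hf.aestronglyMeasurable]

/-- The quadratic form of a componentwise nonlinear function of a Gaussian vector, up to second
order in the correlations. -/
theorem exists_norm_integral_quadratic_sub_le {ν : Measure ℂ} [IsProbabilityMeasure ν]
    (hν : MemLp (fun ξ : ℂ => ξ) 2 ν) {ψ : ℂ → ℂ → ℂ} {K : ℝ≥0}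
    (hψ : LipschitzWith K (fun p : ℂ × ℂ => ψ p.1 p.2)) :
    ∃ C : ℝ, 0 ≤ C ∧ ∀ (N : ℕ) (x : Fin N → Fin N → ℂ) (B : Matrix (Fin N) (Fin N) ℂ),
      (∀ i, x i ⬝ᵥ star (x i) = 1) →
      ‖∫ p : (Fin N → ℂ) × (Fin N → ℂ), ∑ i, ∑ j, B j i * (ψ (x i ⬝ᵥ p.1) (p.2 i) *
          conj (ψ (x j ⬝ᵥ p.1) (p.2 j))) ∂((stdVec (Fin N)).prod (noiseLaw N ν)) -
        ∑ i, ∑ j, B j i * (if i = j then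
          ((∫ q : ℂ × ℂ, ‖ψ q.1 q.2‖ ^ 2 ∂((complexGaussian 1).prod ν) : ℝ) : ℂ) else
          ((‖∫ w, ∫ ξ, ψ w ξ ∂ν ∂(complexGaussian 1)‖ ^ 2 : ℝ) +
          (‖∫ w, (∫ ξ, ψ w ξ ∂ν) * conj w ∂(complexGaussian 1)‖ ^ 2 : ℝ) * (x i ⬝ᵥ star (x j)) +
          (‖∫ w, (∫ ξ, ψ w ξ ∂ν) * w ∂(complexGaussian 1)‖ ^ 2 : ℝ) *
            conj (x i ⬝ᵥ star (x j))))‖ ≤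
        C * ∑ i, ∑ j, if i = j then 0 else ‖B j i‖ * ‖x i ⬝ᵥ star (x j)‖ ^ 2 := by
  obtain ⟨C, hC0, hC⟩ := exists_norm_integral_stdVec_sub_le (lipschitzWith_integral_right hν hψ)
  refine ⟨C, hC0, fun N x B hx => ?_⟩
  have hm : ∀ (x : Fin N → ℂ) (i : Fin N),
      MemLp (fun p : (Fin N → ℂ) × (Fin N → ℂ) => ψ (x ⬝ᵥ p.1) (p.2 i)) 2
        ((stdVec (Fin N)).prod (noiseLaw N ν)) := fun x i =>
    memLp_two_lipschitz_prod hν hψ x i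
  have hint : ∀ i j, Integrable (fun p : (Fin N → ℂ) × (Fin N → ℂ) =>
      B j i * (ψ (x i ⬝ᵥ p.1) (p.2 i) * conj (ψ (x j ⬝ᵥ p.1) (p.2 j))))
        ((stdVec (Fin N)).prod (noiseLaw N ν)) := fun i j =>
    ((hm (x i) i).integrable_mul (hm (x j) j).star).const_mul _
  rw [integral_finsetSum _ fun i _ => integrable_finsetSum _ fun j _ => hint i j]
  simp only [fun i => integral_finsetSum Finset.univ fun j _ => hint i j, integral_const_mul]
  rw [← Finset.sum_sub_distrib, Finset.mul_sum]
  refine (norm_sum_le _ _).trans (Finset.sum_le_sum fun i _ => ?_)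
  rw [← Finset.sum_sub_distrib, Finset.mul_sum]
  refine (norm_sum_le _ _).trans (Finset.sum_le_sum fun j _ => ?_)
  rw [← mul_sub, norm_mul]
  -- The diagonal terms are exact: they involve the full second moment, noise included, and
  -- contribute nothing to the error.
  by_cases hij : i = j
  · subst hij
    have h := integral_dotProduct_prod_noiseLaw (ν := ν) (fun w ξ => ‖ψ w ξ‖ ^ 2)
      (hψ.continuous.norm.pow 2) (hx i) i
    have e : ∀ p : (Fin N → ℂ) × (Fin N → ℂ), ψ (x i ⬝ᵥ p.1) (p.2 i) *
        conj (ψ (x i ⬝ᵥ p.1) (p.2 i)) = ((‖ψ (x i ⬝ᵥ p.1) (p.2 i)‖ ^ 2 : ℝ) : ℂ) := by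
      intro p
      rw [Complex.mul_conj']
      push_cast
      rfl
    simp only [e]
    rw [integral_complex_ofReal, h]
    simp
  · simp only [if_neg hij]
    rw [integral_prod_noiseLaw_mul_conj hν hψ _ _ hij]
    calc _ ≤ ‖B j i‖ * (C * ‖x i ⬝ᵥ star (x j)‖ ^ 2) := by
          gcongr
          exact hC N (x i) (x j) (hx i) (hx j)
      _ = _ := by ring


/-! ### Weighted Gram matrices of a unitary matrix -/

/-- The weighted Gram matrix `Vᴴ diag(c) V`. -/
noncomputable def weightedGram {N : ℕ} (V : Matrix (Fin N) (Fin N) ℂ) (c : Fin N → ℝ) :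
    Matrix (Fin N) (Fin N) ℂ :=
  Vᴴ * Matrix.diagonal (fun k => (c k : ℂ)) * V

theorem weightedGram_apply {N : ℕ} (V : Matrix (Fin N) (Fin N) ℂ) (c : Fin N → ℝ) (i j : Fin N) :
    weightedGram V c i j = ∑ k, (c k : ℂ) * (conj (V k i) * V k j) := by
  rw [weightedGram, Matrix.mul_apply]
  refine Finset.sum_congr rfl fun k _ => ?_
  rw [Matrix.mul_diagonal, Matrix.conjTranspose_apply, Complex.star_def]
  ring

theorem conj_weightedGram {N : ℕ} (V : Matrix (Fin N) (Fin N) ℂ) (c : Fin N → ℝ) (i j : Fin N) :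
    conj (weightedGram V c i j) = weightedGram V c j i := by
  rw [weightedGram_apply, weightedGram_apply, map_sum]
  refine Finset.sum_congr rfl fun k _ => ?_
  simp only [map_mul, Complex.conj_ofReal, Complex.conj_conj]
  ring

theorem weightedGram_sum {N M : ℕ} (V : Matrix (Fin N) (Fin N) ℂ) (w : Fin M → ℝ)
    (c : Fin M → Fin N → ℝ) (i j : Fin N) :
    weightedGram V (fun k => ∑ m, w m * c m k) i j = ∑ m, (w m : ℂ) * weightedGram V (c m) i j := by
  simp only [weightedGram_apply, Finset.mul_sum]
  rw [Finset.sum_comm]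
  refine Finset.sum_congr rfl fun k _ => ?_
  push_cast
  rw [Finset.sum_mul]
  exact Finset.sum_congr rfl fun m _ => by ring

theorem weightedGram_diag {N : ℕ} (V : Matrix (Fin N) (Fin N) ℂ) (c : Fin N → ℝ) (i : Fin N) :
    weightedGram V c i i = ((∑ k, c k * ‖V k i‖ ^ 2 : ℝ) : ℂ) := by
  rw [weightedGram_apply]
  push_cast
  exact Finset.sum_congr rfl fun k _ => by rw [Complex.conj_mul']

/-- For a class indicator `c`, this expresses the energy of `V s` inside the class as a quadratic
form in `s`. -/
theorem sum_weightedGram_mul_conj {N : ℕ} (V : Matrix (Fin N) (Fin N) ℂ) (c : Fin N → ℝ)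
    (s : Fin N → ℂ) :
    ∑ i, ∑ j, weightedGram V c j i * (s i * conj (s j)) =
      ((∑ k, c k * ‖(V *ᵥ s) k‖ ^ 2 : ℝ) : ℂ) := by
  have e : ∀ k, ((‖(V *ᵥ s) k‖ ^ 2 : ℝ) : ℂ) =
      ∑ i, ∑ j, (V k i * s i) * conj (V k j * s j) := by
    intro k
    push_cast
    rw [← Complex.mul_conj', Matrix.mulVec, dotProduct, map_sum, Finset.sum_mul_sum]
  simp only [Complex.ofReal_sum, Complex.ofReal_mul, e, Finset.mul_sum]
  rw [Finset.sum_comm]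
  conv_rhs => rw [Finset.sum_comm]
  rw [Finset.sum_comm]
  refine Finset.sum_congr rfl fun i _ => ?_
  conv_rhs => rw [Finset.sum_comm]
  refine Finset.sum_congr rfl fun j _ => ?_
  rw [weightedGram_apply, Finset.sum_mul]
  refine Finset.sum_congr rfl fun k _ => ?_
  rw [map_mul]
  ring

section Unitary

variable {N : ℕ} {V : Matrix (Fin N) (Fin N) ℂ}

/-- The sum is a trace, and `V Vᴴ = 1` collapses the product to that of the diagonal weights. It
supplies both the Frobenius norm and the exact pairing of a class Gram matrix with the covariance of
`Vᴴ z`. -/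
theorem sum_weightedGram_mul_weightedGram (hV : V ∈ Matrix.unitaryGroup (Fin N) ℂ)
    (c d : Fin N → ℝ) :
    ∑ i, ∑ j, weightedGram V c j i * weightedGram V d i j = ((∑ k, c k * d k : ℝ) : ℂ) := by
  have h1 : V * Vᴴ = 1 := Matrix.mem_unitaryGroup_iff.1 hV
  have e : ∑ i, ∑ j, weightedGram V c j i * weightedGram V d i j =
      (weightedGram V c * weightedGram V d).trace := by
    rw [Finset.sum_comm, Matrix.trace]
    exact Finset.sum_congr rfl fun j _ => by rw [Matrix.diag_apply, Matrix.mul_apply]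
  rw [e]
  have e2 : weightedGram V c * weightedGram V d =
      Vᴴ * (Matrix.diagonal (fun k => (c k : ℂ)) * Matrix.diagonal (fun k => (d k : ℂ)) * V) := by
    rw [weightedGram, weightedGram]
    calc _ = Vᴴ * Matrix.diagonal (fun k => (c k : ℂ)) * (V * Vᴴ) *
          Matrix.diagonal (fun k => (d k : ℂ)) * V := by simp only [Matrix.mul_assoc]
      _ = _ := by rw [h1, Matrix.mul_one]; simp only [Matrix.mul_assoc]
  rw [e2, Matrix.trace_mul_comm, Matrix.mul_assoc, h1, Matrix.mul_one, Matrix.diagonal_mul_diagonal,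
    Matrix.trace_diagonal]
  push_cast
  rfl

theorem sum_weightedGram_diag (hV : V ∈ Matrix.unitaryGroup (Fin N) ℂ) (c : Fin N → ℝ) :
    ∑ i, weightedGram V c i i = ((∑ k, c k : ℝ) : ℂ) := by
  have h1 : V * Vᴴ = 1 := Matrix.mem_unitaryGroup_iff.1 hV
  change (weightedGram V c).trace = _
  rw [weightedGram, Matrix.mul_assoc, Matrix.trace_mul_comm, Matrix.mul_assoc, h1, Matrix.mul_one,
    Matrix.trace_diagonal]
  push_cast
  rfl

theorem sum_norm_weightedGram_sq (hV : V ∈ Matrix.unitaryGroup (Fin N) ℂ) (c : Fin N → ℝ) :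
    ∑ i, ∑ j, ‖weightedGram V c i j‖ ^ 2 = ∑ k, c k ^ 2 := by
  have h := sum_weightedGram_mul_weightedGram hV c c
  have e : ∀ i j, weightedGram V c j i * weightedGram V c i j =
      ((‖weightedGram V c i j‖ ^ 2 : ℝ) : ℂ) := by
    intro i j
    rw [← conj_weightedGram V c i j, Complex.conj_mul']
    push_cast
    rfl
  simp only [e, ← pow_two] at h
  exact_mod_cast h

theorem sum_norm_sq_mulVec (hV : V ∈ Matrix.unitaryGroup (Fin N) ℂ) (s : Fin N → ℂ) :
    ∑ k, ‖(V *ᵥ s) k‖ ^ 2 = ∑ k, ‖s k‖ ^ 2 := by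
  have h1 : Vᴴ * V = 1 := Matrix.mem_unitaryGroup_iff'.1 hV
  have h := sum_weightedGram_mul_conj V (fun _ => 1) s
  have e : weightedGram V (fun _ => 1) = 1 := by
    rw [weightedGram]
    simp [h1]
  simp only [e, one_mul, Matrix.one_apply, ite_mul, zero_mul, Finset.sum_ite_eq', Finset.mem_univ,
    if_true, Complex.mul_conj'] at h
  exact_mod_cast h.symm

end Unitary

/-- The sum of the off-diagonal entries of a matrix. -/
def offSum {N : ℕ} (B : Fin N → Fin N → ℂ) : ℂ := ∑ i, ∑ j, if i = j then 0 else B i j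

theorem sum_sum_eq_add_offSum {N : ℕ} (B : Fin N → Fin N → ℂ) :
    ∑ i, ∑ j, B i j = ∑ i, B i i + offSum B := by
  have e : ∀ i, B i i = ∑ j, if i = j then B i j else 0 := fun i => by simp
  simp only [e]
  rw [offSum, ← Finset.sum_add_distrib]
  refine Finset.sum_congr rfl fun i _ => ?_
  rw [← Finset.sum_add_distrib]
  exact Finset.sum_congr rfl fun j _ => by split_ifs <;> simp

theorem offSum_add {N : ℕ} (B D : Fin N → Fin N → ℂ) :
    offSum (fun i j => B i j + D i j) = offSum B + offSum D := by
  simp only [offSum, ← Finset.sum_add_distrib]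
  exact Finset.sum_congr rfl fun i _ => Finset.sum_congr rfl fun j _ => by split_ifs <;> simp

theorem offSum_mul_left {N : ℕ} (z : ℂ) (B : Fin N → Fin N → ℂ) :
    offSum (fun i j => z * B i j) = z * offSum B := by
  simp only [offSum, Finset.mul_sum, mul_ite, mul_zero]

theorem offSum_finset_sum {N : ℕ} {ι : Type*} (s : Finset ι)
    (B : ι → Fin N → Fin N → ℂ) :
    offSum (fun i j => ∑ m ∈ s, B m i j) = ∑ m ∈ s, offSum (B m) := by
  unfold offSum
  conv_rhs => rw [Finset.sum_comm]
  refine Finset.sum_congr rfl fun i _ => ?_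
  conv_rhs => rw [Finset.sum_comm]
  exact Finset.sum_congr rfl fun j _ => by split_ifs <;> simp

theorem norm_offSum_le {N : ℕ} (B : Fin N → Fin N → ℂ) (b : Fin N → Fin N → ℝ)
    (h : ∀ i j, i ≠ j → ‖B i j‖ ≤ b i j) (h0 : ∀ i, 0 ≤ b i i) :
    ‖offSum B‖ ≤ ∑ i, ∑ j, b i j := by
  refine (norm_sum_le _ _).trans (Finset.sum_le_sum fun i _ => ?_)
  refine (norm_sum_le _ _).trans (Finset.sum_le_sum fun j _ => ?_)
  split_ifs with hij
  · subst hij; simpa using h0 i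
  · exact h i j hij

/-- Replacing uniformly convergent row and column scalings by their limit does not change the
normalized off-diagonal pairing of two matrices with bounded normalized Frobenius norms. -/
theorem tendsto_offSum_scaled {A C : (N : ℕ) → Fin N → Fin N → ℂ} {κ : ℝ}
    (hA : ∀ N, ∑ i, ∑ j, ‖A N i j‖ ^ 2 ≤ κ * N) (hC : ∀ N, ∑ i, ∑ j, ‖C N i j‖ ^ 2 ≤ κ * N)
    {e : (N : ℕ) → Fin N → Fin N → ℝ} {e₀ : ℝ}
    (he : ∀ ε > 0, ∀ᶠ N in atTop, ∀ i j, |e N i j - e₀| ≤ ε) {l : ℂ}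
    (h : Tendsto (fun N : ℕ => offSum (fun i j => A N i j * C N i j) / (N : ℂ)) atTop (𝓝 l)) :
    Tendsto (fun N : ℕ => offSum (fun i j => A N i j * (e N i j * C N i j)) / (N : ℂ)) atTop
      (𝓝 (e₀ * l)) := by
  have hdiff : Tendsto (fun N : ℕ => offSum (fun i j => A N i j * ((e N i j - e₀ : ℝ) * C N i j)) /
      (N : ℂ)) atTop (𝓝 0) := by
    rw [tendsto_zero_iff_norm_tendsto_zero, Metric.tendsto_atTop']
    intro ε hε
    have hκ : 0 < |κ| + 1 := by positivity
    -- The tolerance makes the final bound `ε N / 2`: by `2xy ≤ x² + y²` the pairing is controlled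
    -- by the two Frobenius norms, at most `κ N` each. The added 1 avoids division by zero.
    obtain ⟨n, hn⟩ := eventually_atTop.1 (he (ε / (2 * (|κ| + 1))) (by positivity))
    refine ⟨n, fun N hN => ?_⟩
    have hN0 : (0 : ℝ) < N := by exact_mod_cast (Nat.zero_le n).trans_lt hN
    rw [dist_zero_right, norm_norm, norm_div, Complex.norm_natCast, div_lt_iff₀ hN0]
    set η := ε / (2 * (|κ| + 1)) with hη
    have hη0 : 0 < η := by positivity
    calc _ ≤ ∑ i, ∑ j, η * ((‖A N i j‖ ^ 2 + ‖C N i j‖ ^ 2) / 2) := by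
          refine norm_offSum_le _ _ (fun i j _ => ?_) (fun i => by positivity)
          rw [norm_mul, norm_mul, Complex.norm_real, Real.norm_eq_abs]
          have h1 := hn N hN.le i j
          have h2 : ‖A N i j‖ * ‖C N i j‖ ≤ (‖A N i j‖ ^ 2 + ‖C N i j‖ ^ 2) / 2 := by
            nlinarith [sq_nonneg (‖A N i j‖ - ‖C N i j‖)]
          calc _ = |e N i j - e₀| * (‖A N i j‖ * ‖C N i j‖) := by ring
            _ ≤ _ := by gcongr
      _ = η * ((∑ i, ∑ j, ‖A N i j‖ ^ 2 + ∑ i, ∑ j, ‖C N i j‖ ^ 2) / 2) := by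
          simp only [← Finset.mul_sum, ← Finset.sum_div, Finset.sum_add_distrib]
      _ ≤ η * (κ * N) := by
          gcongr
          linarith [hA N, hC N]
      _ ≤ η * ((|κ| + 1) * N) := by
          gcongr
          linarith [le_abs_self κ]
      _ = ε / 2 * N := by
          rw [hη]
          field_simp
      _ < ε * N := by
          gcongr
          linarith
  have := hdiff.add (h.const_mul (e₀ : ℂ))
  rw [zero_add] at this
  refine this.congr fun N => ?_
  rw [← mul_div_assoc, ← add_div, ← offSum_mul_left, ← offSum_add]
  congr 2
  funext i j
  push_cast
  ring


/-! ### Asymptotically isotropic sequences of unitary matrices -/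

/-- The indicator of the `m`-th symbol class. -/
def classInd {M N : ℕ} (a : Fin N → Fin M) (m : Fin M) (k : Fin N) : ℝ := if a k = m then 1 else 0

/-- The Gram matrix of the rows of `V` in the `m`-th symbol class. -/
noncomputable def classGram {M N : ℕ} (a : Fin N → Fin M) (V : Matrix.unitaryGroup (Fin N) ℂ)
    (m : Fin M) : Matrix (Fin N) (Fin N) ℂ :=
  weightedGram (V : Matrix (Fin N) (Fin N) ℂ) (classInd a m)

/-- A sequence of unitary matrices is spread with respect to the symbol classes if the class Gram
matrices behave like those of typical unitary matrices. -/
structure IsSpread {M : ℕ} (δ : Fin M → ℝ≥0) (a : (N : ℕ) → Fin N → Fin M)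
    (V : (N : ℕ) → Matrix.unitaryGroup (Fin N) ℂ) : Prop where
  diag : ∀ m, ∀ ε > 0, ∀ᶠ N in atTop, ∀ i, ‖classGram (a N) (V N) m i i - (δ m : ℝ)‖ ≤ ε
  off : ∀ m, ∀ ε > 0, ∀ᶠ N in atTop, ∀ i j, i ≠ j → ‖classGram (a N) (V N) m i j‖ ≤ ε
  ones : ∀ m, Tendsto (fun N : ℕ => (∑ i, ∑ j, classGram (a N) (V N) m i j) / (N : ℂ)) atTop
    (𝓝 (δ m : ℝ))
  -- Neither factor is conjugated here, so both carry the same phase. With one factor conjugated the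
  -- sum would be coherent and would not vanish in general.
  phase : ∀ m m', Tendsto (fun N : ℕ => offSum (fun i j => classGram (a N) (V N) m i j *
    classGram (a N) (V N) m' i j) / (N : ℂ)) atTop (𝓝 0)

theorem sum_classInd {M N : ℕ} (a : Fin N → Fin M) (m : Fin M) :
    ∑ k, classInd a m k = ((Finset.univ.filter fun k : Fin N => a k = m).card : ℝ) := by
  simp [classInd]

theorem classInd_mul_classInd {M N : ℕ} (a : Fin N → Fin M) (m : Fin M) (P : Fin M → ℝ≥0)
    (k : Fin N) : classInd a m k * P (a k) = P m * classInd a m k := by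
  unfold classInd
  split_ifs with h
  · rw [h]; ring
  · ring

theorem classInd_sq {M N : ℕ} (a : Fin N → Fin M) (m : Fin M) (k : Fin N) :
    classInd a m k ^ 2 = classInd a m k := by
  unfold classInd
  split_ifs <;> simp

theorem classInd_nonneg {M N : ℕ} (a : Fin N → Fin M) (m : Fin M) (k : Fin N) :
    0 ≤ classInd a m k := by
  unfold classInd
  split_ifs <;> simp

theorem classInd_le_one {M N : ℕ} (a : Fin N → Fin M) (m : Fin M) (k : Fin N) :
    classInd a m k ≤ 1 := by
  unfold classInd
  split_ifs <;> simp

theorem sum_mul_classInd {M N : ℕ} (a : Fin N → Fin M) (f : Fin M → ℝ) (k : Fin N) :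
    ∑ m, f m * classInd a m k = f (a k) := by
  simp [classInd]

theorem coe_avgPower {M : ℕ} (δ P : Fin M → ℝ≥0) :
    (avgPower δ P : ℝ) = ∑ m, (δ m : ℝ) * P m := by
  simp [avgPower]

/-- The covariance matrix of `Vᴴ z`. -/
noncomputable def inputCov {M N : ℕ} (P : Fin M → ℝ≥0) (a : Fin N → Fin M)
    (V : Matrix.unitaryGroup (Fin N) ℂ) : Matrix (Fin N) (Fin N) ℂ :=
  weightedGram (V : Matrix (Fin N) (Fin N) ℂ) (fun k => (P (a k) : ℝ))

theorem inputCov_apply {M N : ℕ} (P : Fin M → ℝ≥0) (a : Fin N → Fin M)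
    (V : Matrix.unitaryGroup (Fin N) ℂ) (i j : Fin N) :
    inputCov P a V i j = ∑ m, ((P m : ℝ) : ℂ) * classGram a V m i j := by
  have : (fun k => (P (a k) : ℝ)) = fun k => ∑ m, (P m : ℝ) * classInd a m k := by
    funext k
    rw [sum_mul_classInd a (fun m => (P m : ℝ))]
  rw [inputCov, this, weightedGram_sum]
  rfl

/-- The variance of the `i`-th component of `Vᴴ z`. -/
noncomputable def inputVar {M N : ℕ} (P : Fin M → ℝ≥0) (a : Fin N → Fin M)
    (V : Matrix.unitaryGroup (Fin N) ℂ) (i : Fin N) : ℝ :=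
  ∑ k, (P (a k) : ℝ) * ‖(V : Matrix (Fin N) (Fin N) ℂ) k i‖ ^ 2

theorem inputCov_diag {M N : ℕ} (P : Fin M → ℝ≥0) (a : Fin N → Fin M)
    (V : Matrix.unitaryGroup (Fin N) ℂ) (i : Fin N) :
    inputCov P a V i i = (inputVar P a V i : ℂ) :=
  weightedGram_diag _ _ i

section Spread

variable {M : ℕ} {δ P : Fin M → ℝ≥0} {a : (N : ℕ) → Fin N → Fin M}
  {V : (N : ℕ) → Matrix.unitaryGroup (Fin N) ℂ}

theorem IsSpread.inputVar_sub_le (h : IsSpread δ a V) {ε : ℝ} (hε : 0 < ε) :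
    ∀ᶠ N in atTop, ∀ i, |inputVar P (a N) (V N) i - avgPower δ P| ≤ ε := by
  have hp : 0 < ∑ m, (P m : ℝ) + 1 := by positivity
  have h1 := fun m => h.diag m (ε / (∑ m, (P m : ℝ) + 1)) (by positivity)
  filter_upwards [eventually_all.2 h1] with N hN i
  have e : ((inputVar P (a N) (V N) i - avgPower δ P : ℝ) : ℂ) =
      ∑ m, ((P m : ℝ) : ℂ) * (classGram (a N) (V N) m i i - (δ m : ℝ)) := by
    rw [Complex.ofReal_sub, ← inputCov_diag, inputCov_apply, coe_avgPower, Complex.ofReal_sum,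
      ← Finset.sum_sub_distrib]
    refine Finset.sum_congr rfl fun m _ => ?_
    push_cast
    ring
  rw [← Real.norm_eq_abs, ← Complex.norm_real, e]
  calc _ ≤ ∑ m, (P m : ℝ) * (ε / (∑ m, (P m : ℝ) + 1)) := by
        refine (norm_sum_le _ _).trans (Finset.sum_le_sum fun m _ => ?_)
        rw [norm_mul, Complex.norm_real, Real.norm_of_nonneg (NNReal.coe_nonneg _)]
        exact mul_le_mul_of_nonneg_left (hN m i) (NNReal.coe_nonneg _)
    _ = (∑ m, (P m : ℝ)) / (∑ m, (P m : ℝ) + 1) * ε := by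
        rw [← Finset.sum_mul]
        ring
    _ ≤ 1 * ε := by
        gcongr
        rw [div_le_one hp]
        linarith
    _ = ε := one_mul ε

theorem sum_norm_sq_classGram_le (N : ℕ) (m : Fin M) :
    ∑ i, ∑ j, ‖classGram (a N) (V N) m i j‖ ^ 2 ≤ N := by
  rw [classGram, sum_norm_weightedGram_sq (V N).2]
  calc _ ≤ ∑ k : Fin N, (1 : ℝ) := Finset.sum_le_sum fun k _ => by
        rw [classInd_sq]; exact classInd_le_one _ _ _
    _ = N := by simp

theorem sum_norm_sq_inputCov_le (N : ℕ) :
    ∑ i, ∑ j, ‖inputCov P (a N) (V N) i j‖ ^ 2 ≤ (∑ m, (P m : ℝ) ^ 2) * N := by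
  rw [inputCov, sum_norm_weightedGram_sq (V N).2]
  calc _ ≤ ∑ k : Fin N, (∑ m, (P m : ℝ) ^ 2) := Finset.sum_le_sum fun k _ =>
        Finset.single_le_sum (f := fun m => (P m : ℝ) ^ 2) (fun m _ => by positivity)
          (Finset.mem_univ _)
    _ = _ := by simp [mul_comm]

/-- The diagonal of the covariance is uniformly close to `P̄`, and the diagonal of the class Gram
matrix is nonnegative with sum equal to the class size. -/
theorem IsSpread.tendsto_diag_mul (h : IsSpread δ a V)
    (ha : ∀ m, Tendsto
      (fun N : ℕ => ((Finset.univ.filter fun k : Fin N => a N k = m).card : ℝ) / (N : ℝ))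
      atTop (𝓝 (δ m : ℝ))) (m : Fin M) :
    Tendsto (fun N : ℕ => (∑ i, classGram (a N) (V N) m i i * inputCov P (a N) (V N) i i) / (N : ℂ))
      atTop (𝓝 (((δ m : ℝ) : ℂ) * ((avgPower δ P : ℝ) : ℂ))) := by
  have hδ : Tendsto (fun N : ℕ => (∑ i, classGram (a N) (V N) m i i) / (N : ℂ)) atTop
      (𝓝 ((δ m : ℝ) : ℂ)) := by
    have := (Complex.continuous_ofReal.tendsto _).comp (ha m)
    refine this.congr fun N => ?_
    rw [classGram, sum_weightedGram_diag (V N).2, sum_classInd]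
    simp
  have hdiff : Tendsto (fun N : ℕ => (∑ i, classGram (a N) (V N) m i i *
      (inputCov P (a N) (V N) i i - ((avgPower δ P : ℝ) : ℂ))) / (N : ℂ)) atTop (𝓝 0) := by
    rw [tendsto_zero_iff_norm_tendsto_zero, Metric.tendsto_atTop']
    intro ε hε
    obtain ⟨n, hn⟩ := eventually_atTop.1 (h.inputVar_sub_le (P := P) (half_pos hε))
    refine ⟨n, fun N hN => ?_⟩
    have hN0 : (0 : ℝ) < N := by exact_mod_cast (Nat.zero_le n).trans_lt hN
    rw [dist_zero_right, norm_norm, norm_div, Complex.norm_natCast, div_lt_iff₀ hN0]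
    have hg : ∀ i, ‖classGram (a N) (V N) m i i‖ =
        ∑ k, classInd (a N) m k * ‖(V N : Matrix (Fin N) (Fin N) ℂ) k i‖ ^ 2 := by
      intro i
      rw [classGram, weightedGram_diag, Complex.norm_real, Real.norm_of_nonneg]
      exact Finset.sum_nonneg fun k _ => mul_nonneg (classInd_nonneg _ _ _) (by positivity)
    have hsum : ∑ i, ‖classGram (a N) (V N) m i i‖ ≤ N := by
      have e : ((∑ i, ‖classGram (a N) (V N) m i i‖ : ℝ) : ℂ) = ((∑ k, classInd (a N) m k : ℝ) : ℂ) := by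
        rw [← sum_weightedGram_diag (V N).2 (classInd (a N) m), Complex.ofReal_sum]
        refine Finset.sum_congr rfl fun i _ => ?_
        rw [hg, weightedGram_diag]
      rw [Complex.ofReal_injective e]
      calc _ ≤ ∑ k : Fin N, (1 : ℝ) := Finset.sum_le_sum fun k _ => classInd_le_one _ _ _
        _ = N := by simp
    calc _ ≤ ∑ i, ‖classGram (a N) (V N) m i i‖ * (ε / 2) := by
          refine (norm_sum_le _ _).trans (Finset.sum_le_sum fun i _ => ?_)
          rw [norm_mul, inputCov_diag, ← Complex.ofReal_sub, Complex.norm_real, Real.norm_eq_abs]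
          exact mul_le_mul_of_nonneg_left (hn N hN.le i) (norm_nonneg _)
      _ ≤ N * (ε / 2) := by
          rw [← Finset.sum_mul]
          gcongr
      _ < ε * N := by nlinarith
  have := hdiff.add (hδ.mul_const ((avgPower δ P : ℝ) : ℂ))
  rw [zero_add] at this
  refine this.congr fun N => ?_
  rw [div_mul_eq_mul_div, ← add_div, Finset.sum_mul, ← Finset.sum_add_distrib]
  congr 1
  exact Finset.sum_congr rfl fun i _ => by ring

/-- The full pairing is the trace of a product and equals `P_m` times the class size exactly;
removing the diagonal part leaves `δ_m (P_m - P̄)`. This is how small correlations add up coherently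
and let the output energy of a class remember its input power. -/
theorem IsSpread.tendsto_offSum_linear (h : IsSpread δ a V)
    (ha : ∀ m, Tendsto
      (fun N : ℕ => ((Finset.univ.filter fun k : Fin N => a N k = m).card : ℝ) / (N : ℝ))
      atTop (𝓝 (δ m : ℝ))) (m : Fin M) :
    Tendsto (fun N : ℕ => offSum (fun i j => classGram (a N) (V N) m j i *
      inputCov P (a N) (V N) i j) / (N : ℂ)) atTop
      (𝓝 (((δ m * (P m - avgPower δ P) : ℝ)) : ℂ)) := by
  have h1 := (((Complex.continuous_ofReal.tendsto _).comp (ha m)).const_mul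
    ((P m : ℝ) : ℂ)).sub (h.tendsto_diag_mul (P := P) ha m)
  have e : ((P m : ℝ) : ℂ) * ((δ m : ℝ) : ℂ) - ((δ m : ℝ) : ℂ) * ((avgPower δ P : ℝ) : ℂ) =
      ((δ m * (P m - avgPower δ P) : ℝ) : ℂ) := by push_cast; ring
  rw [e] at h1
  refine h1.congr fun N => ?_
  have h2 := sum_weightedGram_mul_weightedGram (V N).2 (classInd (a N) m)
    (fun k => (P (a N k) : ℝ))
  rw [sum_sum_eq_add_offSum (fun i j => weightedGram (V N : Matrix (Fin N) (Fin N) ℂ)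
    (classInd (a N) m) j i * weightedGram (V N : Matrix (Fin N) (Fin N) ℂ)
    (fun k => (P (a N k) : ℝ)) i j)] at h2
  have h3 : offSum (fun i j => classGram (a N) (V N) m j i * inputCov P (a N) (V N) i j) =
      ((P m : ℝ) : ℂ) * (((Finset.univ.filter fun k : Fin N => a N k = m).card : ℝ) : ℂ) -
      ∑ i, classGram (a N) (V N) m i i * inputCov P (a N) (V N) i i := by
    rw [← sum_classInd, ← Complex.ofReal_mul, Finset.mul_sum,
      Finset.sum_congr rfl fun k _ => (classInd_mul_classInd (a N) m P k).symm, ← h2]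
    simp only [classGram, inputCov]
    ring
  rw [h3]
  simp only [Function.comp_apply]
  push_cast
  ring

/-- Conjugating the Hermitian covariance transposes it, which turns the coherent pairing into the
unconjugated products of the `phase` condition. -/
theorem IsSpread.tendsto_offSum_conj (h : IsSpread δ a V) (m : Fin M) :
    Tendsto (fun N : ℕ => offSum (fun i j => classGram (a N) (V N) m j i *
      conj (inputCov P (a N) (V N) i j)) / (N : ℂ)) atTop (𝓝 0) := by
  have h1 : Tendsto (fun N : ℕ => ∑ m', ((P m' : ℝ) : ℂ) * (offSum (fun i j =>
      classGram (a N) (V N) m i j * classGram (a N) (V N) m' i j) / (N : ℂ))) atTop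
      (𝓝 (∑ m', ((P m' : ℝ) : ℂ) * 0)) :=
    tendsto_finsetSum _ fun m' _ => (h.phase m m').const_mul _
  simp only [mul_zero, Finset.sum_const_zero] at h1
  refine h1.congr fun N => ?_
  simp only [← mul_div_assoc]
  rw [← Finset.sum_div]
  congr 1
  simp only [← offSum_mul_left]
  rw [← offSum_finset_sum]
  have hsymm : ∀ B : Fin N → Fin N → ℂ, offSum (fun i j => B j i) = offSum B := by
    intro B
    unfold offSum
    rw [Finset.sum_comm]
    exact Finset.sum_congr rfl fun i _ => Finset.sum_congr rfl fun j _ => by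
      simp only [eq_comm]
  rw [← hsymm]
  congr 1
  funext i j
  rw [inputCov, conj_weightedGram]
  change _ = _ * inputCov P (a N) (V N) j i
  rw [inputCov_apply, Finset.mul_sum]
  exact Finset.sum_congr rfl fun m' _ => by ring

end Spread


/-! ### Normalized components of `Vᴴ z` and the limit of the quadratic form. -/

section Whitening

variable {M : ℕ} {δ P : Fin M → ℝ≥0} {a : (N : ℕ) → Fin N → Fin M}
  {V : (N : ℕ) → Matrix.unitaryGroup (Fin N) ℂ}

/-- The correlation coefficients of the components of `Vᴴ z`. -/
noncomputable def inputCorr {N : ℕ} (P : Fin M → ℝ≥0) (a : Fin N → Fin M)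
    (V : Matrix.unitaryGroup (Fin N) ℂ) (i j : Fin N) : ℂ :=
  (((Real.sqrt (inputVar P a V i))⁻¹ * (Real.sqrt (inputVar P a V j))⁻¹ : ℝ) : ℂ) *
    inputCov P a V i j

theorem IsSpread.scaling_sub_le (h : IsSpread δ a V) (hP : 0 < avgPower δ P) {ε : ℝ} (hε : 0 < ε) :
    ∀ᶠ N in atTop, ∀ i j, |(Real.sqrt (inputVar P (a N) (V N) i))⁻¹ *
      (Real.sqrt (inputVar P (a N) (V N) j))⁻¹ - (avgPower δ P : ℝ)⁻¹| ≤ ε := by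
  have hP' : (0 : ℝ) < avgPower δ P := by exact_mod_cast hP
  have hc : ContinuousAt (fun q : ℝ × ℝ => (Real.sqrt q.1)⁻¹ * (Real.sqrt q.2)⁻¹)
      ((avgPower δ P : ℝ), (avgPower δ P : ℝ)) := by
    have h1 : Real.sqrt (avgPower δ P : ℝ) ≠ 0 := by positivity
    have f1 : ContinuousAt (fun q : ℝ × ℝ => Real.sqrt q.1)
        ((avgPower δ P : ℝ), (avgPower δ P : ℝ)) := by fun_prop
    have f2 : ContinuousAt (fun q : ℝ × ℝ => Real.sqrt q.2)
        ((avgPower δ P : ℝ), (avgPower δ P : ℝ)) := by fun_prop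
    exact (f1.inv₀ h1).mul (f2.inv₀ h1)
  obtain ⟨η, hη, hcη⟩ := Metric.continuousAt_iff.1 hc ε hε
  filter_upwards [h.inputVar_sub_le (P := P) (half_pos hη)] with N hN i j
  have h2 := @hcη (inputVar P (a N) (V N) i, inputVar P (a N) (V N) j) (by
    rw [Prod.dist_eq, Real.dist_eq, Real.dist_eq]
    exact max_lt ((hN i).trans_lt (half_lt_self hη)) ((hN j).trans_lt (half_lt_self hη)))
  rw [Real.dist_eq] at h2
  simp only at h2
  rw [← mul_inv (Real.sqrt (avgPower δ P : ℝ)), Real.mul_self_sqrt hP'.le] at h2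
  exact h2.le

/-- `S` meets the trace of the Gram matrix. `κ₀` meets its off-diagonal sum, where total sum and
trace have the same limit and cancel. `κ₁` and `κ₂` meet the linear and conjugate pairings, in which
the variance normalizations may be replaced by `P̄⁻¹`. -/
theorem IsSpread.tendsto_quadratic_model (h : IsSpread δ a V) (hP : 0 < avgPower δ P)
    (ha : ∀ m, Tendsto
      (fun N : ℕ => ((Finset.univ.filter fun k : Fin N => a N k = m).card : ℝ) / (N : ℝ))
      atTop (𝓝 (δ m : ℝ))) (m : Fin M) (S κ₀ κ₁ κ₂ : ℂ) :
    Tendsto (fun N : ℕ => (∑ i, ∑ j, classGram (a N) (V N) m j i * (if i = j then S else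
      κ₀ + κ₁ * inputCorr P (a N) (V N) i j + κ₂ * conj (inputCorr P (a N) (V N) i j))) / (N : ℂ))
      atTop (𝓝 (((δ m : ℝ) : ℂ) * S +
        κ₁ * (((avgPower δ P : ℝ)⁻¹ * (δ m * (P m - avgPower δ P)) : ℝ) : ℂ))) := by
  have hA : ∀ N : ℕ, ∑ i, ∑ j, ‖classGram (a N) (V N) m j i‖ ^ 2 ≤
      (max 1 (∑ m, (P m : ℝ) ^ 2)) * N := by
    intro N
    rw [Finset.sum_comm]
    refine (sum_norm_sq_classGram_le N m).trans ?_
    exact le_mul_of_one_le_left (by positivity) (le_max_left _ _)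
  have hC : ∀ N : ℕ, ∑ i, ∑ j, ‖inputCov P (a N) (V N) i j‖ ^ 2 ≤
      (max 1 (∑ m, (P m : ℝ) ^ 2)) * N := by
    intro N
    refine (sum_norm_sq_inputCov_le N).trans ?_
    gcongr
    exact le_max_right _ _
  have hC' : ∀ N : ℕ, ∑ i, ∑ j, ‖conj (inputCov P (a N) (V N) i j)‖ ^ 2 ≤
      (max 1 (∑ m, (P m : ℝ) ^ 2)) * N := by
    intro N
    simpa only [RCLike.norm_conj] using hC N
  have t1 := tendsto_offSum_scaled hA hC (fun ε hε => h.scaling_sub_le hP hε)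
    (h.tendsto_offSum_linear (P := P) ha m)
  have t2 := tendsto_offSum_scaled hA hC' (fun ε hε => h.scaling_sub_le hP hε)
    (h.tendsto_offSum_conj (P := P) m)
  have tδ : Tendsto (fun N : ℕ => (∑ i, classGram (a N) (V N) m i i) / (N : ℂ)) atTop
      (𝓝 ((δ m : ℝ) : ℂ)) := by
    have := (Complex.continuous_ofReal.tendsto _).comp (ha m)
    refine this.congr fun N => ?_
    rw [classGram, sum_weightedGram_diag (V N).2, sum_classInd]
    simp
  have t0 := (h.ones m).sub tδ
  rw [sub_self] at t0
  have t := (((tδ.mul_const S).add (t0.const_mul κ₀)).add (t1.const_mul κ₁)).add (t2.const_mul κ₂)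
  have el : ((δ m : ℝ) : ℂ) * S + κ₀ * 0 + κ₁ * (((avgPower δ P : ℝ)⁻¹ : ℝ) *
      ((δ m * (P m - avgPower δ P) : ℝ) : ℂ)) + κ₂ * (((avgPower δ P : ℝ)⁻¹ : ℝ) * 0) =
      ((δ m : ℝ) : ℂ) * S + κ₁ * (((avgPower δ P : ℝ)⁻¹ * (δ m * (P m - avgPower δ P)) : ℝ) : ℂ) := by
    push_cast
    ring
  rw [el] at t
  refine t.congr fun N => ?_
  rw [sum_sum_eq_add_offSum (fun i j => classGram (a N) (V N) m j i * (if i = j then S else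
      κ₀ + κ₁ * inputCorr P (a N) (V N) i j + κ₂ * conj (inputCorr P (a N) (V N) i j)))]
  have e1 : offSum (fun i j => classGram (a N) (V N) m j i * (if i = j then S else
      κ₀ + κ₁ * inputCorr P (a N) (V N) i j + κ₂ * conj (inputCorr P (a N) (V N) i j))) =
      κ₀ * offSum (fun i j => classGram (a N) (V N) m j i) +
      κ₁ * offSum (fun i j => classGram (a N) (V N) m j i *
        (((Real.sqrt (inputVar P (a N) (V N) i))⁻¹ * (Real.sqrt (inputVar P (a N) (V N) j))⁻¹ : ℝ) *
          inputCov P (a N) (V N) i j)) +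
      κ₂ * offSum (fun i j => classGram (a N) (V N) m j i *
        (((Real.sqrt (inputVar P (a N) (V N) i))⁻¹ * (Real.sqrt (inputVar P (a N) (V N) j))⁻¹ : ℝ) *
          conj (inputCov P (a N) (V N) i j))) := by
    rw [← offSum_mul_left, ← offSum_mul_left, ← offSum_mul_left, ← offSum_add, ← offSum_add]
    unfold offSum
    refine Finset.sum_congr rfl fun i _ => Finset.sum_congr rfl fun j _ => ?_
    split_ifs with hij
    · rfl
    · simp only [if_neg hij, inputCorr, map_mul, Complex.conj_ofReal]
      ring
  have e2 : offSum (fun i j => classGram (a N) (V N) m j i) =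
      ∑ i, ∑ j, classGram (a N) (V N) m i j - ∑ i, classGram (a N) (V N) m i i := by
    have := sum_sum_eq_add_offSum (fun i j => classGram (a N) (V N) m j i)
    rw [Finset.sum_comm] at this
    rw [this]
    ring
  rw [e1, e2]
  simp only [if_true, ← Finset.sum_mul]
  ring

/-- The remainder is cubic in small quantities: one factor is bounded uniformly by the `off`
condition, and the other two form a squared Frobenius norm of order `N`. -/
theorem IsSpread.tendsto_remainder (h : IsSpread δ a V) (hP : 0 < avgPower δ P) (m : Fin M) :
    Tendsto (fun N : ℕ => (∑ i, ∑ j, if i = j then 0 else ‖classGram (a N) (V N) m j i‖ *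
      ‖inputCorr P (a N) (V N) i j‖ ^ 2) / (N : ℝ)) atTop (𝓝 0) := by
  have hP' : (0 : ℝ) < avgPower δ P := by exact_mod_cast hP
  rw [Metric.tendsto_atTop']
  intro ε hε
  -- Eventually each product of two inverse standard deviations is at most `P̄⁻¹ + 1`; `κ` combines
  -- the square of this with the Frobenius bound on the covariance.
  set κ := ((avgPower δ P : ℝ)⁻¹ + 1) ^ 2 * (∑ m, (P m : ℝ) ^ 2) + 1 with hκ
  have hκ0 : 0 < κ := by positivity
  obtain ⟨n, hn⟩ := eventually_atTop.1 ((h.scaling_sub_le (P := P) hP one_pos).and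
    (h.off m (ε / (2 * κ)) (by positivity)))
  refine ⟨n, fun N hN => ?_⟩
  obtain ⟨h1, h2⟩ := hn N hN.le
  have hN0 : (0 : ℝ) < N := by exact_mod_cast (Nat.zero_le n).trans_lt hN
  rw [dist_zero_right, Real.norm_of_nonneg (by positivity), div_lt_iff₀ hN0]
  calc _ ≤ ∑ i, ∑ j, ε / (2 * κ) * (((avgPower δ P : ℝ)⁻¹ + 1) ^ 2 *
        ‖inputCov P (a N) (V N) i j‖ ^ 2) := by
        refine Finset.sum_le_sum fun i _ => Finset.sum_le_sum fun j _ => ?_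
        split_ifs with hij
        · positivity
        · have h3 := h1 i j
          rw [inputCorr, norm_mul, mul_pow, Complex.norm_real, Real.norm_eq_abs]
          have h4 : |(Real.sqrt (inputVar P (a N) (V N) i))⁻¹ *
              (Real.sqrt (inputVar P (a N) (V N) j))⁻¹| ≤ (avgPower δ P : ℝ)⁻¹ + 1 := by
            rw [abs_of_nonneg (by positivity)]
            linarith [le_abs_self ((Real.sqrt (inputVar P (a N) (V N) i))⁻¹ *
              (Real.sqrt (inputVar P (a N) (V N) j))⁻¹ - (avgPower δ P : ℝ)⁻¹)]
          gcongr
          exact h2 j i (Ne.symm hij)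
    _ = ε / (2 * κ) * (((avgPower δ P : ℝ)⁻¹ + 1) ^ 2 *
        ∑ i, ∑ j, ‖inputCov P (a N) (V N) i j‖ ^ 2) := by
        simp only [Finset.mul_sum]
    _ ≤ ε / (2 * κ) * (((avgPower δ P : ℝ)⁻¹ + 1) ^ 2 * ((∑ m, (P m : ℝ) ^ 2) * N)) := by
        gcongr
        exact sum_norm_sq_inputCov_le N
    _ ≤ ε / (2 * κ) * (κ * N) := by
        refine mul_le_mul_of_nonneg_left ?_ (by positivity)
        rw [← mul_assoc]
        refine mul_le_mul_of_nonneg_right ?_ hN0.le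
        linarith
    _ = ε / 2 * N := by field_simp
    _ < ε * N := by nlinarith

/-- The coefficients of the normalized components of `Vᴴ z` as linear functionals of a standard
Gaussian vector. -/
noncomputable def whitened {N : ℕ} (P : Fin M → ℝ≥0) (a : Fin N → Fin M)
    (V : Matrix.unitaryGroup (Fin N) ℂ) (i : Fin N) : Fin N → ℂ := fun k =>
  (((Real.sqrt (inputVar P a V i))⁻¹ : ℝ) : ℂ) *
    (conj ((V : Matrix (Fin N) (Fin N) ℂ) k i) * ((Real.sqrt (P (a k)) : ℝ) : ℂ))

theorem whitened_dotProduct_star {N : ℕ} (P : Fin M → ℝ≥0) (a : Fin N → Fin M)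
    (V : Matrix.unitaryGroup (Fin N) ℂ) (i j : Fin N) :
    whitened P a V i ⬝ᵥ star (whitened P a V j) = inputCorr P a V i j := by
  rw [inputCorr, inputCov, weightedGram_apply, Finset.mul_sum, dotProduct]
  refine Finset.sum_congr rfl fun k _ => ?_
  have e : ((P (a k) : ℝ) : ℂ) = ((Real.sqrt (P (a k)) : ℝ) : ℂ) * ((Real.sqrt (P (a k)) : ℝ) : ℂ) := by
    rw [← Complex.ofReal_mul, Real.mul_self_sqrt (NNReal.coe_nonneg _)]
  rw [e]
  simp only [whitened, Pi.star_apply, Complex.star_def, map_mul, Complex.conj_ofReal,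
    Complex.conj_conj]
  push_cast
  ring

theorem whitened_dotProduct_star_self {N : ℕ} (P : Fin M → ℝ≥0) (a : Fin N → Fin M)
    (V : Matrix.unitaryGroup (Fin N) ℂ) (i : Fin N) (hi : 0 < inputVar P a V i) :
    whitened P a V i ⬝ᵥ star (whitened P a V i) = 1 := by
  rw [whitened_dotProduct_star, inputCorr, inputCov_diag, ← Complex.ofReal_mul, ← mul_inv,
    Real.mul_self_sqrt hi.le, inv_mul_cancel₀ hi.ne', Complex.ofReal_one]

theorem conjTranspose_mulVec_eq_whitened {N : ℕ} (P : Fin M → ℝ≥0) (a : Fin N → Fin M)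
    (V : Matrix.unitaryGroup (Fin N) ℂ) (i : Fin N) (hi : 0 < inputVar P a V i) (ζ : Fin N → ℂ) :
    ((V : Matrix (Fin N) (Fin N) ℂ)ᴴ *ᵥ fun k => ((Real.sqrt (P (a k)) : ℝ) : ℂ) * ζ k) i =
      ((Real.sqrt (inputVar P a V i) : ℝ) : ℂ) * (whitened P a V i ⬝ᵥ ζ) := by
  rw [Matrix.mulVec, dotProduct, dotProduct, Finset.mul_sum]
  refine Finset.sum_congr rfl fun k _ => ?_
  have : ((Real.sqrt (inputVar P a V i) : ℝ) : ℂ) ≠ 0 := by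
    exact_mod_cast (Real.sqrt_pos.2 hi).ne'
  simp only [whitened, Matrix.conjTranspose_apply, Complex.star_def]
  push_cast
  field_simp

end Whitening

theorem measurePreserving_input {M N : ℕ} (P : Fin M → ℝ≥0) (a : Fin N → Fin M) (ν : Measure ℂ)
    [IsProbabilityMeasure ν] :
    MeasurePreserving (fun p : (Fin N → ℂ) × (Fin N → ℂ) =>
      ((fun k => ((Real.sqrt (P (a k)) : ℝ) : ℂ) * p.1 k), p.2))
      ((stdVec (Fin N)).prod (noiseLaw N ν)) ((inputLaw P a).prod (noiseLaw N ν)) := by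
  have h1 : MeasurePreserving (fun ζ : Fin N → ℂ => fun k => ((Real.sqrt (P (a k)) : ℝ) : ℂ) * ζ k)
      (stdVec (Fin N)) (inputLaw P a) :=
    measurePreserving_pi _ _ fun k => ⟨by fun_prop, (complexGaussian_eq_map _).symm⟩
  exact h1.prod (MeasurePreserving.id _)

/-- The channel output `V φ(Vᴴ z, ξ)` for a scalar nonlinearity `φ` acting componentwise. -/
noncomputable def applyLink {N : ℕ} (φ : ℂ → ℂ → ℂ) (V : Matrix.unitaryGroup (Fin N) ℂ)
    (z ξ : Fin N → ℂ) : Fin N → ℂ :=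
  (V : Matrix (Fin N) (Fin N) ℂ) *ᵥ
    fun n => φ (((V : Matrix (Fin N) (Fin N) ℂ)ᴴ *ᵥ z) n) (ξ n)

theorem continuous_applyLink {N : ℕ} {φ : ℂ → ℂ → ℂ} (hφ : Continuous fun p : ℂ × ℂ => φ p.1 p.2)
    (V : Matrix.unitaryGroup (Fin N) ℂ) :
    Continuous fun p : (Fin N → ℂ) × (Fin N → ℂ) => applyLink φ V p.1 p.2 := by
  unfold applyLink
  refine Continuous.matrix_mulVec continuous_const (continuous_pi fun n => ?_)
  exact hφ.comp (Continuous.prodMk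
    ((continuous_apply n).comp (Continuous.matrix_mulVec continuous_const continuous_fst))
    ((continuous_apply n).comp continuous_snd))

section Moments

variable {M N : ℕ} {P : Fin M → ℝ≥0} {a : Fin N → Fin M} {ν : Measure ℂ} [IsProbabilityMeasure ν]

theorem memLp_input (k : Fin N) :
    MemLp (fun p : (Fin N → ℂ) × (Fin N → ℂ) => p.1 k) 2
      ((inputLaw P a).prod (noiseLaw N ν)) := by
  have h : MemLp (fun z : Fin N → ℂ => z k) 2 (inputLaw P a) :=
    (memLp_id_complexGaussian (P (a k))).comp_measurePreserving
      (measurePreserving_eval (fun k : Fin N => complexGaussian (P (a k))) k)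
  exact h.comp_fst _

theorem memLp_link (hν : MemLp (fun ξ : ℂ => ξ) 2 ν) {φ : ℂ → ℂ → ℂ} {K : ℝ≥0}
    (hφ : LipschitzWith K (fun p : ℂ × ℂ => φ p.1 p.2)) (V : Matrix.unitaryGroup (Fin N) ℂ)
    (n : Fin N) :
    MemLp (fun p : (Fin N → ℂ) × (Fin N → ℂ) =>
      φ (((V : Matrix (Fin N) (Fin N) ℂ)ᴴ *ᵥ p.1) n) (p.2 n)) 2
      ((inputLaw P a).prod (noiseLaw N ν)) := by
  refine memLp_two_of_lipschitzWith (X := fun p : (Fin N → ℂ) × (Fin N → ℂ) =>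
    ((V : Matrix (Fin N) (Fin N) ℂ)ᴴ *ᵥ p.1) n) (Y := fun p => p.2 n) ?_
    ((memLp_eval_noiseLaw hν n).comp_snd _) hφ
  unfold Matrix.mulVec dotProduct
  exact memLp_finsetSum _ fun k _ => (memLp_input k).const_mul _

theorem memLp_applyLink (hν : MemLp (fun ξ : ℂ => ξ) 2 ν) {φ : ℂ → ℂ → ℂ} {K : ℝ≥0}
    (hφ : LipschitzWith K (fun p : ℂ × ℂ => φ p.1 p.2)) (V : Matrix.unitaryGroup (Fin N) ℂ)
    (k : Fin N) :
    MemLp (fun p : (Fin N → ℂ) × (Fin N → ℂ) => applyLink φ V p.1 p.2 k) 2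
      ((inputLaw P a).prod (noiseLaw N ν)) := by
  unfold applyLink
  simp only [Matrix.mulVec.eq_1 (V : Matrix (Fin N) (Fin N) ℂ), dotProduct]
  exact memLp_finsetSum _ fun n _ => (memLp_link hν hφ V n).const_mul _

end Moments


/-! ### Asymptotic error and output energies along spread sequences -/

/-- A single component of `Vᴴ z` with its noise has the scalar law with power `inputVar`;
correlations between components play no role here. -/
theorem integral_link_eq {M N : ℕ} {P : Fin M → ℝ≥0} {a : Fin N → Fin M} {ν : Measure ℂ}
    [IsProbabilityMeasure ν] {V : Matrix.unitaryGroup (Fin N) ℂ} {i : Fin N}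
    (hi : 0 < inputVar P a V i) {f : ℂ → ℂ → ℝ} (hf : Continuous (fun p : ℂ × ℂ => f p.1 p.2)) :
    ∫ p : (Fin N → ℂ) × (Fin N → ℂ), f (((V : Matrix (Fin N) (Fin N) ℂ)ᴴ *ᵥ p.1) i) (p.2 i)
        ∂((inputLaw P a).prod (noiseLaw N ν)) =
      ∫ q : ℂ × ℂ, f ((Real.sqrt (inputVar P a V i) : ℝ) * q.1) q.2
        ∂((complexGaussian 1).prod ν) := by
  have h := measurePreserving_input P a ν
  have hc : Continuous fun p : (Fin N → ℂ) × (Fin N → ℂ) =>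
      f (((V : Matrix (Fin N) (Fin N) ℂ)ᴴ *ᵥ p.1) i) (p.2 i) :=
    hf.comp (Continuous.prodMk
      ((continuous_apply i).comp (Continuous.matrix_mulVec continuous_const continuous_fst))
      ((continuous_apply i).comp continuous_snd))
  rw [← h.map_eq, integral_map h.measurable.aemeasurable hc.aestronglyMeasurable]
  simp only [conjTranspose_mulVec_eq_whitened P a V i hi]
  exact integral_dotProduct_prod_noiseLaw
    (fun w ξ => f ((Real.sqrt (inputVar P a V i) : ℝ) * w) ξ)
    (hf.comp (Continuous.prodMk (continuous_const.mul continuous_fst) continuous_snd))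
    (whitened_dotProduct_star_self P a V i hi) i

/-- `ẑ - β z` is `V` applied to the componentwise error, and `V` preserves the norm. The total error
thus depends only on marginals. -/
theorem applyLink_sub_mul {N : ℕ} (φ : ℂ → ℂ → ℂ) (V : Matrix.unitaryGroup (Fin N) ℂ)
    (z ξ : Fin N → ℂ) (β : ℂ) :
    ∑ k, ‖applyLink φ V z ξ k - β * z k‖ ^ 2 =
      ∑ n, ‖φ (((V : Matrix (Fin N) (Fin N) ℂ)ᴴ *ᵥ z) n) (ξ n) -
        β * ((V : Matrix (Fin N) (Fin N) ℂ)ᴴ *ᵥ z) n‖ ^ 2 := by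
  have hz : z = (V : Matrix (Fin N) (Fin N) ℂ) *ᵥ ((V : Matrix (Fin N) (Fin N) ℂ)ᴴ *ᵥ z) := by
    have h1 : (V : Matrix (Fin N) (Fin N) ℂ) * (V : Matrix (Fin N) (Fin N) ℂ)ᴴ = 1 :=
      Matrix.mem_unitaryGroup_iff.1 V.2
    rw [Matrix.mulVec_mulVec, h1, Matrix.one_mulVec]
  rw [← sum_norm_sq_mulVec V.2 (fun n => φ (((V : Matrix (Fin N) (Fin N) ℂ)ᴴ *ᵥ z) n) (ξ n) -
        β * ((V : Matrix (Fin N) (Fin N) ℂ)ᴴ *ᵥ z) n)]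
  refine Finset.sum_congr rfl fun k _ => ?_
  congr 2
  conv_lhs => enter [2]; rw [show z k = ((V : Matrix (Fin N) (Fin N) ℂ) *ᵥ
    ((V : Matrix (Fin N) (Fin N) ℂ)ᴴ *ᵥ z)) k from congrFun hz k]
  rw [applyLink, Matrix.mulVec, Matrix.mulVec, Matrix.mulVec, dotProduct, dotProduct, dotProduct,
    Finset.mul_sum, ← Finset.sum_sub_distrib]
  exact Finset.sum_congr rfl fun n _ => by ring

theorem norm_link_le {φ : ℂ → ℂ → ℂ} {K : ℝ≥0} (hφ : LipschitzWith K (fun p : ℂ × ℂ => φ p.1 p.2))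
    (u ξ : ℂ) : ‖φ u ξ‖ ≤ ‖φ 0 0‖ + K * (‖u‖ + ‖ξ‖) := by
  have h1 := hφ.dist_le_mul (u, ξ) (0, 0)
  rw [dist_eq_norm, Prod.dist_eq] at h1
  simp only [dist_zero_right] at h1
  have h2 : max ‖u‖ ‖ξ‖ ≤ ‖u‖ + ‖ξ‖ :=
    max_le (by linarith [norm_nonneg ξ]) (by linarith [norm_nonneg u])
  have h3 := mul_le_mul_of_nonneg_left h2 K.2
  calc ‖φ u ξ‖ = ‖φ 0 0 + (φ u ξ - φ 0 0)‖ := by congr 1; ring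
    _ ≤ _ := (norm_add_le _ _).trans (by linarith!)

theorem continuousAt_integral_error {ν : Measure ℂ} [IsProbabilityMeasure ν]
    (hν : MemLp (fun ξ : ℂ => ξ) 2 ν) {φ : ℂ → ℂ → ℂ} {K : ℝ≥0}
    (hφ : LipschitzWith K (fun p : ℂ × ℂ => φ p.1 p.2)) (β : ℂ) (c₀ : ℝ) :
    ContinuousAt (fun c : ℝ => ∫ q : ℂ × ℂ, ‖φ ((Real.sqrt c : ℝ) * q.1) q.2 -
      β * ((Real.sqrt c : ℝ) * q.1)‖ ^ 2 ∂((complexGaussian 1).prod ν)) c₀ := by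
  have hφc := hφ.continuous
  have hcont : Continuous fun r : ℝ × (ℂ × ℂ) => ‖φ ((Real.sqrt r.1 : ℝ) * r.2.1) r.2.2 -
      β * ((Real.sqrt r.1 : ℝ) * r.2.1)‖ ^ 2 := by
    have h1 : Continuous fun r : ℝ × (ℂ × ℂ) => φ ((Real.sqrt r.1 : ℝ) * r.2.1) r.2.2 :=
      hφc.comp (f := fun r : ℝ × (ℂ × ℂ) => (((Real.sqrt r.1 : ℝ) * r.2.1, r.2.2) : ℂ × ℂ))
        (by fun_prop)
    fun_prop
  -- `R` bounds the scale `√c` for all `c` near `c₀`, giving one square-integrable majorant for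
  -- dominated convergence.
  set R := Real.sqrt (c₀ + 1) with hR
  have hR0 : 0 ≤ R := Real.sqrt_nonneg _
  have hb : MemLp (fun q : ℂ × ℂ => ‖φ 0 0‖ + K * (R * ‖q.1‖ + ‖q.2‖) + ‖β‖ * (R * ‖q.1‖)) 2
      ((complexGaussian 1).prod ν) := by
    have h1 : MemLp (fun q : ℂ × ℂ => ‖q.1‖) 2 ((complexGaussian 1).prod ν) :=
      ((memLp_id_complexGaussian 1).comp_fst ν).norm
    have h2 : MemLp (fun q : ℂ × ℂ => ‖q.2‖) 2 ((complexGaussian 1).prod ν) :=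
      (hν.comp_snd (complexGaussian 1)).norm
    have h3 : MemLp (fun q : ℂ × ℂ => K * (R * ‖q.1‖ + ‖q.2‖)) 2 ((complexGaussian 1).prod ν) :=
      ((h1.const_mul R).add h2).const_mul (K : ℝ)
    have h4 : MemLp (fun q : ℂ × ℂ => ‖β‖ * (R * ‖q.1‖)) 2 ((complexGaussian 1).prod ν) :=
      (h1.const_mul R).const_mul ‖β‖
    have h5 : MemLp (fun _ : ℂ × ℂ => ‖φ 0 0‖) 2 ((complexGaussian 1).prod ν) := memLp_const _
    exact (h5.add h3).add h4
  refine continuousAt_of_dominated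
    (bound := fun q => (‖φ 0 0‖ + K * (R * ‖q.1‖ + ‖q.2‖) + ‖β‖ * (R * ‖q.1‖)) ^ 2)
    (Eventually.of_forall fun c => ?_) ?_ hb.integrable_sq (ae_of_all _ fun q => ?_)
  · exact (hcont.comp (Continuous.prodMk continuous_const continuous_id)).aestronglyMeasurable
  · filter_upwards [eventually_le_nhds (show c₀ < c₀ + 1 by linarith)] with c hc
    refine ae_of_all _ fun q => ?_
    rw [Real.norm_of_nonneg (by positivity)]
    have hn : ‖((Real.sqrt c : ℝ) : ℂ) * q.1‖ ≤ R * ‖q.1‖ := by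
      rw [norm_mul, Complex.norm_real, Real.norm_of_nonneg (Real.sqrt_nonneg _)]
      exact mul_le_mul_of_nonneg_right (Real.sqrt_le_sqrt hc) (norm_nonneg _)
    gcongr
    refine (norm_sub_le _ _).trans (add_le_add ?_ ?_)
    · refine (norm_link_le hφ _ _).trans ?_
      gcongr
    · rw [norm_mul]
      gcongr
  · exact (hcont.comp (Continuous.prodMk continuous_id continuous_const)).continuousAt

theorem integral_prod_complexGaussian (P : ℝ≥0) {E : Type*} [NormedAddCommGroup E] [NormedSpace ℝ E]
    {ν : Measure ℂ} [IsProbabilityMeasure ν] {f : ℂ × ℂ → E} (hf : Continuous f) :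
    ∫ q, f q ∂((complexGaussian P).prod ν) =
      ∫ q : ℂ × ℂ, f ((Real.sqrt P : ℝ) * q.1, q.2) ∂((complexGaussian 1).prod ν) := by
  have h1 : MeasurePreserving (fun x : ℂ => ((Real.sqrt P : ℝ) : ℂ) * x) (complexGaussian 1)
      (complexGaussian P) := ⟨by fun_prop, (complexGaussian_eq_map P).symm⟩
  have h2 := h1.prod (MeasurePreserving.id ν)
  have : SecondCountableTopologyEither (ℂ × ℂ) E := inferInstance
  rw [← h2.map_eq, integral_map h2.measurable.aemeasurable hf.aestronglyMeasurable]
  rfl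

theorem tendsto_average_of_uniform {x : (N : ℕ) → Fin N → ℝ} {l : ℝ}
    (h : ∀ ε > 0, ∀ᶠ N in atTop, ∀ i, |x N i - l| ≤ ε) :
    Tendsto (fun N : ℕ => (∑ i, x N i) / (N : ℝ)) atTop (𝓝 l) := by
  rw [Metric.tendsto_atTop']
  intro ε hε
  obtain ⟨n, hn⟩ := eventually_atTop.1 (h (ε / 2) (half_pos hε))
  refine ⟨n, fun N hN => ?_⟩
  have hN0 : (0 : ℝ) < N := by exact_mod_cast (Nat.zero_le n).trans_lt hN
  have e : (∑ i, x N i) / (N : ℝ) - l = (∑ i, (x N i - l)) / (N : ℝ) := by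
    rw [Finset.sum_sub_distrib]
    simp
    field_simp
  rw [Real.dist_eq, e, abs_div, abs_of_pos hN0, div_lt_iff₀ hN0]
  calc _ ≤ ∑ i : Fin N, ε / 2 :=
        (Finset.abs_sum_le_sum_abs _ _).trans (Finset.sum_le_sum fun i _ => hn N hN.le i)
    _ = N * (ε / 2) := by simp
    _ < ε * N := by nlinarith

section Spread

variable {M : ℕ} {δ P : Fin M → ℝ≥0} {a : (N : ℕ) → Fin N → Fin M}
  {V : (N : ℕ) → Matrix.unitaryGroup (Fin N) ℂ}

theorem IsSpread.inputVar_pos (h : IsSpread δ a V) (hP : 0 < avgPower δ P) :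
    ∀ᶠ N in atTop, ∀ i, 0 < inputVar P (a N) (V N) i := by
  have hP' : (0 : ℝ) < avgPower δ P := by exact_mod_cast hP
  filter_upwards [h.inputVar_sub_le (P := P) (half_pos hP')] with N hN i
  have := (abs_le.1 (hN i)).1
  linarith

theorem IsSpread.uniform_comp (h : IsSpread δ a V) {f : ℝ → ℝ}
    (hf : ContinuousAt f (avgPower δ P)) {ε : ℝ} (hε : 0 < ε) :
    ∀ᶠ N in atTop, ∀ i, |f (inputVar P (a N) (V N) i) - f (avgPower δ P)| ≤ ε := by
  obtain ⟨η, hη, hcη⟩ := Metric.continuousAt_iff.1 hf ε hε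
  filter_upwards [h.inputVar_sub_le (P := P) (half_pos hη)] with N hN i
  have := hcη (x := inputVar P (a N) (V N) i)
    (by rw [Real.dist_eq]; exact (hN i).trans_lt (half_lt_self hη))
  rw [Real.dist_eq] at this
  exact this.le

theorem IsSpread.tendsto_error (h : IsSpread δ a V) (hP : 0 < avgPower δ P) {ν : Measure ℂ}
    [IsProbabilityMeasure ν] (hν : MemLp (fun ξ : ℂ => ξ) 2 ν) {φ : ℂ → ℂ → ℂ} {K : ℝ≥0}
    (hφ : LipschitzWith K (fun p : ℂ × ℂ => φ p.1 p.2)) (β : ℂ) :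
    Tendsto (fun N : ℕ => (∑ k, ∫ p : (Fin N → ℂ) × (Fin N → ℂ),
        ‖applyLink φ (V N) p.1 p.2 k - β * p.1 k‖ ^ 2
          ∂((inputLaw P (a N)).prod (noiseLaw N ν))) / (N : ℝ)) atTop
      (𝓝 (∫ q : ℂ × ℂ, ‖φ q.1 q.2 - β * q.1‖ ^ 2
        ∂((complexGaussian (avgPower δ P)).prod ν))) := by
  have hφc := hφ.continuous
  have hc : Continuous (fun q : ℂ × ℂ => ‖φ q.1 q.2 - β * q.1‖ ^ 2) := by fun_prop
  rw [integral_prod_complexGaussian _ hc]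
  have ht := tendsto_average_of_uniform
    (fun ε hε => h.uniform_comp (P := P) (continuousAt_integral_error hν hφ β _) hε)
  refine ht.congr' ?_
  filter_upwards [h.inputVar_pos hP] with N hN
  congr 1
  have e1 : ∑ k, ∫ p : (Fin N → ℂ) × (Fin N → ℂ), ‖applyLink φ (V N) p.1 p.2 k - β * p.1 k‖ ^ 2
      ∂((inputLaw P (a N)).prod (noiseLaw N ν)) = ∫ p : (Fin N → ℂ) × (Fin N → ℂ),
      ∑ k, ‖applyLink φ (V N) p.1 p.2 k - β * p.1 k‖ ^ 2
      ∂((inputLaw P (a N)).prod (noiseLaw N ν)) :=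
    (integral_finsetSum _ fun k _ => ((memLp_applyLink hν hφ (V N) k).sub
      ((memLp_input k).const_mul β)).integrable_norm_pow (by norm_num)).symm
  rw [e1]
  simp only [applyLink_sub_mul]
  rw [integral_finsetSum]
  · refine Finset.sum_congr rfl fun i _ => ?_
    exact (integral_link_eq (hN i) (f := fun u ξ => ‖φ u ξ - β * u‖ ^ 2) hc).symm
  · intro i _
    refine ((memLp_link hν hφ (V N) i).sub (MemLp.const_mul ?_ β)).integrable_norm_pow (by norm_num)
    unfold Matrix.mulVec dotProduct
    exact memLp_finsetSum _ fun k _ => (memLp_input k).const_mul _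

end Spread


/-! ### Asymptotic lower bound on the output energy of each class. -/

/-- The reverse triangle inequality with Young's inequality on the cross term. The factor `1 - η`
can be taken close to one once the perturbation `x - y` is negligible. -/
theorem le_norm_sq_of_norm_sub {x y : ℂ} {η : ℝ} (hη : 0 < η) :
    (1 - η) * ‖y‖ ^ 2 - η⁻¹ * ‖x - y‖ ^ 2 ≤ ‖x‖ ^ 2 := by
  have h1 : |‖x - y‖ - ‖y‖| ≤ ‖x‖ := by
    have := abs_norm_sub_norm_le (x - y) (-y)
    simpa using this
  have h2 := pow_le_pow_left₀ (abs_nonneg _) h1 2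
  rw [sq_abs] at h2
  have h3 : 2 * (‖x - y‖ * ‖y‖) ≤ η * ‖y‖ ^ 2 + η⁻¹ * ‖x - y‖ ^ 2 := by
    have h4 := sq_nonneg (η * ‖y‖ - ‖x - y‖)
    have h5 : 0 ≤ η⁻¹ * (η * ‖y‖ - ‖x - y‖) ^ 2 := by positivity
    have h6 : η⁻¹ * (η * ‖y‖ - ‖x - y‖) ^ 2 =
        η * ‖y‖ ^ 2 - 2 * (‖x - y‖ * ‖y‖) + η⁻¹ * ‖x - y‖ ^ 2 := by
      field_simp
      ring
    linarith
  nlinarith [sq_nonneg ‖x - y‖]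

section Spread

variable {M : ℕ} {δ P : Fin M → ℝ≥0} {a : (N : ℕ) → Fin N → Fin M}
  {V : (N : ℕ) → Matrix.unitaryGroup (Fin N) ℂ}

/-- The class energy of the output when the components of `Vᴴ z` are rescaled to have equal
variances. -/
theorem IsSpread.tendsto_normalized_energy (h : IsSpread δ a V) (hP : 0 < avgPower δ P)
    (ha : ∀ m, Tendsto
      (fun N : ℕ => ((Finset.univ.filter fun k : Fin N => a N k = m).card : ℝ) / (N : ℝ))
      atTop (𝓝 (δ m : ℝ)))
    {ν : Measure ℂ} [IsProbabilityMeasure ν] (hν : MemLp (fun ξ : ℂ => ξ) 2 ν) {ψ : ℂ → ℂ → ℂ}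
    {K : ℝ≥0} (hψ : LipschitzWith K (fun p : ℂ × ℂ => ψ p.1 p.2)) (m : Fin M) :
    Tendsto (fun N : ℕ => (∫ p : (Fin N → ℂ) × (Fin N → ℂ), ∑ k, classInd (a N) m k *
        ‖((V N : Matrix (Fin N) (Fin N) ℂ) *ᵥ
          fun n => ψ (whitened P (a N) (V N) n ⬝ᵥ p.1) (p.2 n)) k‖ ^ 2
          ∂((stdVec (Fin N)).prod (noiseLaw N ν))) / (N : ℝ)) atTop
      (𝓝 (δ m * ∫ q : ℂ × ℂ, ‖ψ q.1 q.2‖ ^ 2 ∂((complexGaussian 1).prod ν) +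
        ‖∫ w, (∫ ξ, ψ w ξ ∂ν) * conj w ∂(complexGaussian 1)‖ ^ 2 *
          ((avgPower δ P : ℝ)⁻¹ * (δ m * (P m - avgPower δ P))))) := by
  obtain ⟨C, hC0, hC⟩ := exists_norm_integral_quadratic_sub_le hν hψ
  set S := ∫ q : ℂ × ℂ, ‖ψ q.1 q.2‖ ^ 2 ∂((complexGaussian 1).prod ν)
  set κ₀ := ‖∫ w, ∫ ξ, ψ w ξ ∂ν ∂(complexGaussian 1)‖ ^ 2
  set κ₁ := ‖∫ w, (∫ ξ, ψ w ξ ∂ν) * conj w ∂(complexGaussian 1)‖ ^ 2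
  set κ₂ := ‖∫ w, (∫ ξ, ψ w ξ ∂ν) * w ∂(complexGaussian 1)‖ ^ 2
  have t1 := h.tendsto_quadratic_model (P := P) hP ha m (S : ℂ) (κ₀ : ℂ) (κ₁ : ℂ) (κ₂ : ℂ)
  have t2 := (h.tendsto_remainder (P := P) hP m).const_mul C
  rw [mul_zero] at t2
  set E : ℕ → ℝ := fun N => (∫ p : (Fin N → ℂ) × (Fin N → ℂ), ∑ k, classInd (a N) m k *
        ‖((V N : Matrix (Fin N) (Fin N) ℂ) *ᵥ
          fun n => ψ (whitened P (a N) (V N) n ⬝ᵥ p.1) (p.2 n)) k‖ ^ 2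
          ∂((stdVec (Fin N)).prod (noiseLaw N ν))) / (N : ℝ) with hE
  set Θ : ℕ → ℂ := fun N : ℕ => (∑ i, ∑ j, classGram (a N) (V N) m j i * (if i = j then (S : ℂ) else
      (κ₀ : ℂ) + κ₁ * inputCorr P (a N) (V N) i j +
        κ₂ * conj (inputCorr P (a N) (V N) i j))) / (N : ℂ) with hΘ
  have hdiff : Tendsto (fun N => (E N : ℂ) - Θ N) atTop (𝓝 0) := by
    refine squeeze_zero_norm' ?_ t2
    filter_upwards [h.inputVar_pos hP] with N hN
    have h1 := hC N (whitened P (a N) (V N)) (classGram (a N) (V N) m)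
      (fun i => whitened_dotProduct_star_self P (a N) (V N) i (hN i))
    simp only [whitened_dotProduct_star] at h1
    have e1 : ∀ p : (Fin N → ℂ) × (Fin N → ℂ), ∑ i, ∑ j, classGram (a N) (V N) m j i *
        (ψ (whitened P (a N) (V N) i ⬝ᵥ p.1) (p.2 i) *
          conj (ψ (whitened P (a N) (V N) j ⬝ᵥ p.1) (p.2 j))) =
        ((∑ k, classInd (a N) m k * ‖((V N : Matrix (Fin N) (Fin N) ℂ) *ᵥ
          fun n => ψ (whitened P (a N) (V N) n ⬝ᵥ p.1) (p.2 n)) k‖ ^ 2 : ℝ) : ℂ) := fun p =>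
      sum_weightedGram_mul_conj _ _ (fun n => ψ (whitened P (a N) (V N) n ⬝ᵥ p.1) (p.2 n))
    simp only [e1, integral_complex_ofReal] at h1
    have e2 : (E N : ℂ) = ((∫ p : (Fin N → ℂ) × (Fin N → ℂ), ∑ k, classInd (a N) m k *
        ‖((V N : Matrix (Fin N) (Fin N) ℂ) *ᵥ
          fun n => ψ (whitened P (a N) (V N) n ⬝ᵥ p.1) (p.2 n)) k‖ ^ 2
          ∂((stdVec (Fin N)).prod (noiseLaw N ν)) : ℝ) : ℂ) / (N : ℂ) := by
      rw [hE]
      push_cast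
      rfl
    rw [e2, hΘ]
    simp only
    rw [← sub_div, norm_div, Complex.norm_natCast, mul_div_assoc']
    gcongr
  have t3 := hdiff.add t1
  simp only [sub_add_cancel, zero_add] at t3
  have t4 := (Complex.continuous_re.tendsto _).comp t3
  simp only [Function.comp_def, Complex.ofReal_re] at t4
  convert t4 using 2
  rw [← Complex.ofReal_mul, ← Complex.ofReal_mul, ← Complex.ofReal_add, Complex.ofReal_re]

end Spread

/-- As the weights are at most one, the penalty in any class is at most the full squared norm of `V
(x - y)`, which unitarity identifies with that of `x - y`. -/
theorem weighted_energy_lower_bound {N : ℕ} (V : Matrix.unitaryGroup (Fin N) ℂ) {c : Fin N → ℝ}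
    (hc0 : ∀ k, 0 ≤ c k) (hc1 : ∀ k, c k ≤ 1) {η : ℝ} (hη : 0 < η) (x y : Fin N → ℂ) :
    (1 - η) * ∑ k, c k * ‖((V : Matrix (Fin N) (Fin N) ℂ) *ᵥ y) k‖ ^ 2 -
        η⁻¹ * ∑ n, ‖x n - y n‖ ^ 2 ≤
      ∑ k, c k * ‖((V : Matrix (Fin N) (Fin N) ℂ) *ᵥ x) k‖ ^ 2 := by
  have hsub : ∀ k, ((V : Matrix (Fin N) (Fin N) ℂ) *ᵥ x) k -
      ((V : Matrix (Fin N) (Fin N) ℂ) *ᵥ y) k =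
      ((V : Matrix (Fin N) (Fin N) ℂ) *ᵥ (fun n => x n - y n)) k := by
    intro k
    rw [show (fun n => x n - y n) = x - y from rfl, Matrix.mulVec_sub]
    rfl
  calc _ = (1 - η) * ∑ k, c k * ‖((V : Matrix (Fin N) (Fin N) ℂ) *ᵥ y) k‖ ^ 2 -
        η⁻¹ * ∑ k, ‖((V : Matrix (Fin N) (Fin N) ℂ) *ᵥ x) k -
          ((V : Matrix (Fin N) (Fin N) ℂ) *ᵥ y) k‖ ^ 2 := by
        simp only [hsub]
        rw [sum_norm_sq_mulVec V.2]
    _ ≤ ∑ k, c k * ((1 - η) * ‖((V : Matrix (Fin N) (Fin N) ℂ) *ᵥ y) k‖ ^ 2 -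
        η⁻¹ * ‖((V : Matrix (Fin N) (Fin N) ℂ) *ᵥ x) k -
          ((V : Matrix (Fin N) (Fin N) ℂ) *ᵥ y) k‖ ^ 2) := by
        rw [Finset.mul_sum, Finset.mul_sum, ← Finset.sum_sub_distrib]
        refine Finset.sum_le_sum fun k _ => ?_
        have h2 : 0 ≤ η⁻¹ * ‖((V : Matrix (Fin N) (Fin N) ℂ) *ᵥ x) k -
          ((V : Matrix (Fin N) (Fin N) ℂ) *ᵥ y) k‖ ^ 2 := by positivity
        have h3 := mul_le_mul_of_nonneg_right (hc1 k) h2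
        linarith
    _ ≤ _ := by
        refine Finset.sum_le_sum fun k _ => ?_
        exact mul_le_mul_of_nonneg_left (le_norm_sq_of_norm_sub hη) (hc0 k)

theorem lipschitzWith_comp_mul_left {φ : ℂ → ℂ → ℂ} {K : ℝ≥0}
    (hφ : LipschitzWith K (fun p : ℂ × ℂ => φ p.1 p.2)) (σ : ℝ) :
    LipschitzWith (K * (max ‖σ‖₊ 1)) (fun p : ℂ × ℂ => φ ((σ : ℂ) * p.1) p.2) := by
  have h1 : LipschitzWith (max ‖σ‖₊ 1) (fun p : ℂ × ℂ => (((σ : ℂ) * p.1, p.2) : ℂ × ℂ)) := by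
    have h2 : LipschitzWith ‖σ‖₊ (fun p : ℂ × ℂ => (σ : ℂ) * p.1) :=
      LipschitzWith.of_dist_le_mul fun p q => by
        rw [dist_eq_norm, ← mul_sub, norm_mul, Complex.norm_real, coe_nnnorm, ← dist_eq_norm]
        gcongr
        exact le_max_left _ _
    exact h2.prodMk LipschitzWith.prod_snd
  exact hφ.comp h1

/-- Identifies the coefficient of the linear term of the correlation expansion with `|α|² P̄`. -/
theorem norm_alphaRx_sq {ν : Measure ℂ} [IsProbabilityMeasure ν]
    (hν : MemLp (fun ξ : ℂ => ξ) 2 ν) {φ : ℂ → ℂ → ℂ} {K : ℝ≥0}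
    (hφ : LipschitzWith K (fun p : ℂ × ℂ => φ p.1 p.2)) {P : ℝ≥0} (hP : 0 < P) :
    ‖alphaRx φ ν P‖ ^ 2 = ‖∫ w, (∫ ξ, φ (((Real.sqrt P : ℝ) : ℂ) * w) ξ ∂ν) * conj w
      ∂(complexGaussian 1)‖ ^ 2 * (P : ℝ)⁻¹ := by
  have hP' : (0 : ℝ) < P := by exact_mod_cast hP
  have hφc := hφ.continuous
  have hψ := lipschitzWith_comp_mul_left hφ (Real.sqrt P)
  have hm1 : MemLp (fun q : ℂ × ℂ => φ (((Real.sqrt P : ℝ) : ℂ) * q.1) q.2) 2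
      ((complexGaussian 1).prod ν) :=
    memLp_two_of_lipschitzWith (X := fun q : ℂ × ℂ => q.1) (Y := fun q => q.2)
      (ψ := fun w ξ => φ (((Real.sqrt P : ℝ) : ℂ) * w) ξ)
      ((memLp_id_complexGaussian 1).comp_fst ν) (hν.comp_snd _) hψ
  have hm2 : MemLp (fun q : ℂ × ℂ => conj q.1) 2 ((complexGaussian 1).prod ν) :=
    ((memLp_id_complexGaussian 1).comp_fst ν).star
  have hint : Integrable (fun q : ℂ × ℂ => φ (((Real.sqrt P : ℝ) : ℂ) * q.1) q.2 * conj q.1)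
      ((complexGaussian 1).prod ν) := hm1.integrable_mul hm2
  have e1 : ∫ p : ℂ × ℂ, conj (φ p.1 p.2) * p.1 ∂((complexGaussian P).prod ν) =
      ((Real.sqrt P : ℝ) : ℂ) * conj (∫ w, (∫ ξ, φ (((Real.sqrt P : ℝ) : ℂ) * w) ξ ∂ν) * conj w
        ∂(complexGaussian 1)) := by
    rw [integral_prod_complexGaussian _ (f := fun p : ℂ × ℂ => conj (φ p.1 p.2) * p.1)
      (by fun_prop)]
    have e2 := integral_prod _ hint
    simp only [integral_mul_const] at e2
    rw [← e2, ← integral_conj, ← integral_const_mul]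
    refine integral_congr_ae (ae_of_all _ fun q => ?_)
    simp only [map_mul, Complex.conj_conj]
    ring
  rw [alphaRx, e1, norm_mul, norm_mul, RCLike.norm_conj, norm_div, Complex.norm_real,
    Complex.norm_real, norm_one, Real.norm_of_nonneg (Real.sqrt_nonneg _),
    Real.norm_of_nonneg hP'.le, mul_pow, mul_pow, Real.sq_sqrt hP'.le]
  field_simp

/-- The quadratic expansion needs one nonlinearity common to all components, while the components of
`Vᴴ z` have different variances. Replacing each standard deviation by `σ` costs, by the Lipschitz
property, `K²` times the squared deviation, since the normalized component has unit second moment.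
-/
theorem integral_energy_lower_bound {M N : ℕ} {P : Fin M → ℝ≥0} {a : Fin N → Fin M}
    {V : Matrix.unitaryGroup (Fin N) ℂ} {ν : Measure ℂ} [IsProbabilityMeasure ν]
    (hν : MemLp (fun ξ : ℂ => ξ) 2 ν) {φ : ℂ → ℂ → ℂ} {K : ℝ≥0}
    (hφ : LipschitzWith K (fun p : ℂ × ℂ => φ p.1 p.2)) (σ : ℝ) {c : Fin N → ℝ}
    (hc0 : ∀ k, 0 ≤ c k) (hc1 : ∀ k, c k ≤ 1) {η : ℝ} (hη : 0 < η)
    (hpos : ∀ i, 0 < inputVar P a V i) :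
    (1 - η) * (∫ p : (Fin N → ℂ) × (Fin N → ℂ), ∑ k, c k *
        ‖((V : Matrix (Fin N) (Fin N) ℂ) *ᵥ
          fun n => φ ((σ : ℂ) * (whitened P a V n ⬝ᵥ p.1)) (p.2 n)) k‖ ^ 2
          ∂((stdVec (Fin N)).prod (noiseLaw N ν))) -
      η⁻¹ * K ^ 2 * ∑ n, (Real.sqrt (inputVar P a V n) - σ) ^ 2 ≤
      ∑ k, c k * ∫ p : (Fin N → ℂ) × (Fin N → ℂ),
        ‖applyLink φ V p.1 p.2 k‖ ^ 2 ∂((inputLaw P a).prod (noiseLaw N ν)) := by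
  have hφc := hφ.continuous
  have hψ := lipschitzWith_comp_mul_left hφ σ
  have hmp := measurePreserving_input P a ν
  have hML : ∀ k, MemLp (fun p : (Fin N → ℂ) × (Fin N → ℂ) => applyLink φ V
      (fun k => ((Real.sqrt (P (a k)) : ℝ) : ℂ) * p.1 k) p.2 k) 2
      ((stdVec (Fin N)).prod (noiseLaw N ν)) := by
    intro k
    have h := (memLp_applyLink (P := P) (a := a) hν hφ V k).comp_measurePreserving hmp
    simpa only [Function.comp_def] using h
  have hs : ∀ n, MemLp (fun p : (Fin N → ℂ) × (Fin N → ℂ) =>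
      φ ((σ : ℂ) * (whitened P a V n ⬝ᵥ p.1)) (p.2 n)) 2
      ((stdVec (Fin N)).prod (noiseLaw N ν)) := by
    intro n
    have h := memLp_two_lipschitz_prod (ψ := fun w ξ => φ ((σ : ℂ) * w) ξ) hν hψ (whitened P a V n) n
    simpa only using h
  have hVs : ∀ k, MemLp (fun p : (Fin N → ℂ) × (Fin N → ℂ) =>
      ((V : Matrix (Fin N) (Fin N) ℂ) *ᵥ
          fun n => φ ((σ : ℂ) * (whitened P a V n ⬝ᵥ p.1)) (p.2 n)) k) 2
      ((stdVec (Fin N)).prod (noiseLaw N ν)) := by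
    intro k
    simp only [Matrix.mulVec.eq_1 (V : Matrix (Fin N) (Fin N) ℂ), dotProduct.eq_1 (fun j => (V : Matrix (Fin N) (Fin N) ℂ) k j)]
    exact memLp_finsetSum _ fun n _ => (hs n).const_mul _
  have e1 : ∑ k, c k * ∫ p : (Fin N → ℂ) × (Fin N → ℂ),
      ‖applyLink φ V p.1 p.2 k‖ ^ 2 ∂((inputLaw P a).prod (noiseLaw N ν)) =
      ∫ p : (Fin N → ℂ) × (Fin N → ℂ), ∑ k, c k * ‖applyLink φ V
      (fun k => ((Real.sqrt (P (a k)) : ℝ) : ℂ) * p.1 k) p.2 k‖ ^ 2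
      ∂((stdVec (Fin N)).prod (noiseLaw N ν)) := by
    rw [integral_finsetSum _ fun k _ => ((hML k).integrable_norm_pow (by norm_num)).const_mul _]
    refine Finset.sum_congr rfl fun k _ => ?_
    rw [integral_const_mul, ← hmp.map_eq, integral_map hmp.measurable.aemeasurable]
    exact ((((continuous_apply k).comp (continuous_applyLink hφc V)).norm).pow
      2).aestronglyMeasurable
  have hdm : ∀ n, MemLp (fun p : (Fin N → ℂ) × (Fin N → ℂ) =>
      whitened P a V n ⬝ᵥ p.1) 2 ((stdVec (Fin N)).prod (noiseLaw N ν)) := fun n =>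
    (memLp_dotProduct_stdVec _).comp_fst _
  have hdi : ∀ n, ∫ p : (Fin N → ℂ) × (Fin N → ℂ), ‖whitened P a V n ⬝ᵥ p.1‖ ^ 2
      ∂((stdVec (Fin N)).prod (noiseLaw N ν)) = 1 := by
    intro n
    rw [integral_dotProduct_prod_noiseLaw (ν := ν) (fun w _ => ‖w‖ ^ 2) (by fun_prop)
      (whitened_dotProduct_star_self P a V n (hpos n)) n,
      integral_fun_fst (fun w : ℂ => ‖w‖ ^ 2), integral_norm_sq_complexGaussian_one]
    simp
  have e2 : η⁻¹ * K ^ 2 * ∑ n, (Real.sqrt (inputVar P a V n) - σ) ^ 2 =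
      ∫ p : (Fin N → ℂ) × (Fin N → ℂ), η⁻¹ * ∑ n, (K ^ 2 *
        (Real.sqrt (inputVar P a V n) - σ) ^ 2) * ‖whitened P a V n ⬝ᵥ p.1‖ ^ 2
      ∂((stdVec (Fin N)).prod (noiseLaw N ν)) := by
    rw [integral_const_mul, integral_finsetSum _ fun n _ =>
      ((hdm n).integrable_norm_pow (by norm_num)).const_mul _]
    simp only [integral_const_mul, hdi, mul_one]
    rw [← Finset.mul_sum, mul_assoc]
  have hi1 : Integrable (fun p : (Fin N → ℂ) × (Fin N → ℂ) => ∑ k, c k *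
        ‖((V : Matrix (Fin N) (Fin N) ℂ) *ᵥ
          fun n => φ ((σ : ℂ) * (whitened P a V n ⬝ᵥ p.1)) (p.2 n)) k‖ ^ 2)
      ((stdVec (Fin N)).prod (noiseLaw N ν)) :=
    integrable_finsetSum _ fun k _ => ((hVs k).integrable_norm_pow (by norm_num)).const_mul _
  have hi2 : Integrable (fun p : (Fin N → ℂ) × (Fin N → ℂ) => η⁻¹ * ∑ n, (K ^ 2 *
        (Real.sqrt (inputVar P a V n) - σ) ^ 2) * ‖whitened P a V n ⬝ᵥ p.1‖ ^ 2)
      ((stdVec (Fin N)).prod (noiseLaw N ν)) :=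
    (integrable_finsetSum _ fun n _ =>
      ((hdm n).integrable_norm_pow (by norm_num)).const_mul _).const_mul _
  have hi3 : Integrable (fun p : (Fin N → ℂ) × (Fin N → ℂ) => ∑ k, c k * ‖applyLink φ V
      (fun k => ((Real.sqrt (P (a k)) : ℝ) : ℂ) * p.1 k) p.2 k‖ ^ 2)
      ((stdVec (Fin N)).prod (noiseLaw N ν)) :=
    integrable_finsetSum _ fun k _ => ((hML k).integrable_norm_pow (by norm_num)).const_mul _
  rw [e1, e2, ← integral_const_mul, ← integral_sub (hi1.const_mul _) hi2]
  refine integral_mono ((hi1.const_mul _).sub hi2) hi3 fun p => ?_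
  refine le_trans ?_ (weighted_energy_lower_bound V hc0 hc1 hη
    (fun n => φ (((V : Matrix (Fin N) (Fin N) ℂ)ᴴ *ᵥ
      fun k => ((Real.sqrt (P (a k)) : ℝ) : ℂ) * p.1 k) n) (p.2 n))
    (fun n => φ ((σ : ℂ) * (whitened P a V n ⬝ᵥ p.1)) (p.2 n)))
  have hxy : ∀ n, ‖φ (((V : Matrix (Fin N) (Fin N) ℂ)ᴴ *ᵥ
      fun k => ((Real.sqrt (P (a k)) : ℝ) : ℂ) * p.1 k) n) (p.2 n) -
      φ ((σ : ℂ) * (whitened P a V n ⬝ᵥ p.1)) (p.2 n)‖ ^ 2 ≤ (K ^ 2 *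
        (Real.sqrt (inputVar P a V n) - σ) ^ 2) * ‖whitened P a V n ⬝ᵥ p.1‖ ^ 2 := by
    intro n
    rw [conjTranspose_mulVec_eq_whitened P a V n (hpos n)]
    have h1 := hφ.dist_le_mul (((Real.sqrt (inputVar P a V n) : ℝ) : ℂ) *
      (whitened P a V n ⬝ᵥ p.1), p.2 n) ((σ : ℂ) * (whitened P a V n ⬝ᵥ p.1), p.2 n)
    rw [dist_eq_norm, Prod.dist_eq, dist_self, max_eq_left dist_nonneg, dist_eq_norm, ← sub_mul,
      ← Complex.ofReal_sub, norm_mul, Complex.norm_real, Real.norm_eq_abs] at h1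
    have h2 := pow_le_pow_left₀ (norm_nonneg _) h1 2
    rw [mul_pow, mul_pow, sq_abs, ← mul_assoc] at h2
    exact h2
  exact sub_le_sub_left (mul_le_mul_of_nonneg_left (Finset.sum_le_sum fun n _ => hxy n)
    (inv_nonneg.2 hη.le)) _

theorem IsSpread.energy_lower_bound {M : ℕ} {δ P : Fin M → ℝ≥0} {a : (N : ℕ) → Fin N → Fin M}
    {V : (N : ℕ) → Matrix.unitaryGroup (Fin N) ℂ} (h : IsSpread δ a V) (hP : 0 < avgPower δ P)
    (ha : ∀ m, Tendsto
      (fun N : ℕ => ((Finset.univ.filter fun k : Fin N => a N k = m).card : ℝ) / (N : ℝ))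
      atTop (𝓝 (δ m : ℝ)))
    {ν : Measure ℂ} [IsProbabilityMeasure ν] (hν : MemLp (fun ξ : ℂ => ξ) 2 ν) {φ : ℂ → ℂ → ℂ}
    {K : ℝ≥0} (hφ : LipschitzWith K (fun p : ℂ × ℂ => φ p.1 p.2)) (m : Fin M) {ε : ℝ}
    (hε : 0 < ε) :
    ∀ᶠ N : ℕ in atTop,
      δ m * ∫ q : ℂ × ℂ, ‖φ q.1 q.2‖ ^ 2 ∂((complexGaussian (avgPower δ P)).prod ν) +
        ‖alphaRx φ ν (avgPower δ P)‖ ^ 2 * (δ m * (P m - avgPower δ P)) - ε ≤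
      (∑ k, classInd (a N) m k * ∫ p : (Fin N → ℂ) × (Fin N → ℂ),
        ‖applyLink φ (V N) p.1 p.2 k‖ ^ 2 ∂((inputLaw P (a N)).prod (noiseLaw N ν))) / (N : ℝ) := by
  have hP' : (0 : ℝ) < avgPower δ P := by exact_mod_cast hP
  have hφc := hφ.continuous
  have hψ := lipschitzWith_comp_mul_left hφ (Real.sqrt (avgPower δ P))
  have hS := integral_prod_complexGaussian (avgPower δ P) (ν := ν)
    (f := fun q : ℂ × ℂ => ‖φ q.1 q.2‖ ^ 2) (by fun_prop)
  simp only at hS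
  rw [hS, norm_alphaRx_sq hν hφ hP, mul_assoc]
  have t1 := h.tendsto_normalized_energy (P := P) hP ha hν
    (ψ := fun w ξ => φ (((Real.sqrt (avgPower δ P) : ℝ) : ℂ) * w) ξ) hψ m
  generalize hLm : (δ m : ℝ) * ∫ q : ℂ × ℂ, ‖φ (((Real.sqrt (avgPower δ P) : ℝ) : ℂ) * q.1) q.2‖ ^ 2
    ∂((complexGaussian 1).prod ν) + ‖∫ w, (∫ ξ, φ (((Real.sqrt (avgPower δ P) : ℝ) : ℂ) * w) ξ ∂ν) *
      conj w ∂(complexGaussian 1)‖ ^ 2 *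
      ((avgPower δ P : ℝ)⁻¹ * (δ m * (P m - avgPower δ P))) = Lm at t1 ⊢
  have t2 := tendsto_average_of_uniform (fun ε hε => h.uniform_comp (P := P)
    (f := fun c => (Real.sqrt c - Real.sqrt (avgPower δ P)) ^ 2) (by fun_prop) hε)
  simp only [sub_self, ne_eq, OfNat.ofNat_ne_zero, not_false_eq_true, zero_pow] at t2
  -- `η = ε / (|Lm| + 1)` makes the loss `η Lm` less than `ε`; with `η` fixed, the penalty with
  -- factor `η⁻¹` still tends to zero.
  obtain ⟨η, hη, hηL⟩ : ∃ η : ℝ, 0 < η ∧ Lm - ε < (1 - η) * Lm := by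
    refine ⟨ε / (|Lm| + 1), by positivity, ?_⟩
    have h1 : ε / (|Lm| + 1) * Lm < ε := by
      rw [div_mul_eq_mul_div, div_lt_iff₀ (by positivity)]
      nlinarith [le_abs_self Lm]
    linarith
  have t3 := (t1.const_mul (1 - η)).sub (t2.const_mul (η⁻¹ * K ^ 2))
  rw [mul_zero, sub_zero] at t3
  filter_upwards [t3.eventually_const_lt hηL, h.inputVar_pos hP] with N hN hpos
  refine hN.le.trans ?_
  rw [← mul_div_assoc, ← mul_div_assoc, ← sub_div]
  exact div_le_div_of_nonneg_right (integral_energy_lower_bound hν hφ _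
    (classInd_nonneg _ _) (classInd_le_one _ _) hη hpos) (Nat.cast_nonneg N)


/-! ### Haar distributed unitary matrices -/

section Haar

variable {N : ℕ}

instance instCompactSpaceUnitary (N : ℕ) : CompactSpace (Matrix.unitaryGroup (Fin N) ℂ) := by
  have hc : IsClosed ((Matrix.unitaryGroup (Fin N) ℂ : Set (Matrix (Fin N) (Fin N) ℂ))) := by
    have : ((Matrix.unitaryGroup (Fin N) ℂ : Set (Matrix (Fin N) (Fin N) ℂ))) =
        {A | A * star A = 1} := by
      ext A
      exact Matrix.mem_unitaryGroup_iff
    rw [this]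
    exact isClosed_eq (by fun_prop) continuous_const
  have hK : IsCompact (Set.univ.pi fun _ : Fin N => Set.univ.pi fun _ : Fin N =>
      Metric.closedBall (0 : ℂ) 1) :=
    isCompact_univ_pi fun _ => isCompact_univ_pi fun _ => isCompact_closedBall 0 1
  refine isCompact_iff_compactSpace.1 (hK.of_isClosed_subset hc fun A hA i _ j _ => ?_)
  rw [mem_closedBall_zero_iff]
  exact entry_norm_bound_of_unitary hA i j

/-- The image of Haar measure under right multiplication is again left invariant; uniqueness on a
compact group makes it a multiple, and total mass one fixes the multiple. -/
theorem measurePreserving_mul_right (H : Measure (Matrix.unitaryGroup (Fin N) ℂ))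
    [H.IsHaarMeasure] [IsProbabilityMeasure H] (g : Matrix.unitaryGroup (Fin N) ℂ) :
    MeasurePreserving (fun V => V * g) H H := by
  have hm : Measurable fun V : Matrix.unitaryGroup (Fin N) ℂ => V * g :=
    (continuous_id.mul continuous_const).measurable
  refine ⟨hm, ?_⟩
  have hp : IsProbabilityMeasure (H.map fun V => V * g) :=
    Measure.isProbabilityMeasure_map hm.aemeasurable
  have h := Measure.isMulInvariant_eq_smul_of_compactSpace (H.map fun V => V * g) H
  have h1 := congrArg (fun m : Measure _ => m Set.univ) h
  simp only [measure_univ, Measure.smul_apply, ENNReal.smul_def, smul_eq_mul, mul_one] at h1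
  rw [h]
  ext s _
  rw [Measure.smul_apply, ENNReal.smul_def, ← h1, one_smul]

theorem continuous_entry (i j : Fin N) :
    Continuous fun V : Matrix.unitaryGroup (Fin N) ℂ => (V : Matrix (Fin N) (Fin N) ℂ) i j :=
  continuous_subtype_val.matrix_elem i j

theorem measurable_unitary_mulVec (k : Fin N) :
    Measurable fun p : Matrix.unitaryGroup (Fin N) ℂ × (Fin N → ℂ) =>
      ((p.1 : Matrix (Fin N) (Fin N) ℂ) *ᵥ p.2) k := by
  simp only [Matrix.mulVec, dotProduct]
  refine Finset.measurable_sum _ fun j _ => ?_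
  exact ((continuous_entry k j).measurable.comp measurable_fst).mul
    ((measurable_pi_apply j).comp measurable_snd)

theorem exists_unitary_mulVec_single [NeZero N] (w : Fin N → ℂ) (hw : ∑ k, ‖w k‖ ^ 2 = 1) :
    ∃ U : Matrix.unitaryGroup (Fin N) ℂ,
      (U : Matrix (Fin N) (Fin N) ℂ) *ᵥ Pi.single 0 1 = w := by
  have hn : ‖(WithLp.toLp 2 w : EuclideanSpace ℂ (Fin N))‖ = 1 := by
    rw [EuclideanSpace.norm_eq, hw, Real.sqrt_one]
  obtain ⟨b, hb⟩ := Orthonormal.exists_orthonormalBasis_extension_of_card_eq (𝕜 := ℂ)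
    (E := EuclideanSpace ℂ (Fin N)) (ι := Fin N) (by simp)
    (v := fun _ => WithLp.toLp 2 w) (s := {0}) (by
      rw [orthonormal_iff_ite]
      intro i j
      have : i = j := Subsingleton.elim _ _
      subst this
      simp [hn])
  refine ⟨⟨_, (EuclideanSpace.basisFun (Fin N) ℂ).toMatrix_orthonormalBasis_mem_unitary b⟩, ?_⟩
  ext k
  rw [Matrix.mulVec_single_one]
  have := hb 0 rfl
  simp [Module.Basis.toMatrix_apply, this]

theorem exists_unitary_mulVec_eq {w w' : Fin N → ℂ} (hw : ∑ k, ‖w k‖ ^ 2 = 1)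
    (hw' : ∑ k, ‖w' k‖ ^ 2 = 1) :
    ∃ U : Matrix.unitaryGroup (Fin N) ℂ, (U : Matrix (Fin N) (Fin N) ℂ) *ᵥ w = w' := by
  have hN : NeZero N := ⟨by rintro rfl; simp at hw⟩
  obtain ⟨U, hU⟩ := exists_unitary_mulVec_single w hw
  obtain ⟨U', hU'⟩ := exists_unitary_mulVec_single w' hw'
  refine ⟨U' * U⁻¹, ?_⟩
  rw [← hU, ← hU', Matrix.mulVec_mulVec, ← Submonoid.coe_mul, inv_mul_cancel_right]

/-- Unitary matrices act transitively on the unit sphere, so right invariance makes the law of `V w`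
the same for all unit vectors `w`. -/
theorem lintegral_mulVec_eq (H : Measure (Matrix.unitaryGroup (Fin N) ℂ))
    [H.IsHaarMeasure] [IsProbabilityMeasure H] {f : (Fin N → ℂ) → ℝ≥0∞} (hf : Measurable f)
    {w w' : Fin N → ℂ} (hw : ∑ k, ‖w k‖ ^ 2 = 1) (hw' : ∑ k, ‖w' k‖ ^ 2 = 1) :
    ∫⁻ V, f ((V : Matrix (Fin N) (Fin N) ℂ) *ᵥ w') ∂H =
      ∫⁻ V, f ((V : Matrix (Fin N) (Fin N) ℂ) *ᵥ w) ∂H := by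
  obtain ⟨U, rfl⟩ := exists_unitary_mulVec_eq hw hw'
  have hm : Measurable fun V : Matrix.unitaryGroup (Fin N) ℂ =>
      f ((V : Matrix (Fin N) (Fin N) ℂ) *ᵥ w) :=
    hf.comp (measurable_pi_lambda _ fun k =>
      (measurable_unitary_mulVec k).comp (measurable_id.prodMk measurable_const))
  rw [← (measurePreserving_mul_right H U).lintegral_comp hm]
  simp only [Submonoid.coe_mul, Matrix.mulVec_mulVec]

/-- The average of a function of degree `2d` over the sphere, through a Gaussian vector. -/
theorem lintegral_mulVec_mul_le (H : Measure (Matrix.unitaryGroup (Fin N) ℂ))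
    [H.IsHaarMeasure] [IsProbabilityMeasure H] {f : (Fin N → ℂ) → ℝ≥0∞} (hf : Measurable f)
    {d : ℕ} (hd0 : d ≠ 0) (hd : ∀ (r : ℝ) (x : Fin N → ℂ), 0 < r →
      f ((r : ℂ) • x) = ENNReal.ofReal (r ^ 2) ^ d * f x)
    {w : Fin N → ℂ} (hw : ∑ k, ‖w k‖ ^ 2 = 1) :
    (∫⁻ V, f ((V : Matrix (Fin N) (Fin N) ℂ) *ᵥ w) ∂H) *
      ∫⁻ x, ENNReal.ofReal (∑ k, ‖x k‖ ^ 2) ^ d ∂(stdVec (Fin N)) ≤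
      ∫⁻ x, f x ∂(stdVec (Fin N)) := by
  have hN : NeZero N := ⟨by rintro rfl; simp at hw⟩
  have hmf : Measurable fun p : Matrix.unitaryGroup (Fin N) ℂ × (Fin N → ℂ) =>
      f ((p.1 : Matrix (Fin N) (Fin N) ℂ) *ᵥ p.2) :=
    hf.comp (measurable_pi_lambda _ measurable_unitary_mulVec)
  have h1 : ∀ V : Matrix.unitaryGroup (Fin N) ℂ,
      ∫⁻ x, f ((V : Matrix (Fin N) (Fin N) ℂ) *ᵥ x) ∂(stdVec (Fin N)) =
        ∫⁻ x, f x ∂(stdVec (Fin N)) := fun V => by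
    rw [← lintegral_map hf (measurable_mulVec _), map_mulVec_stdVec_eq _ (1 : Matrix _ _ ℂ) (by
      rw [Matrix.conjTranspose_one, Matrix.one_mul]
      exact Matrix.mem_unitaryGroup_iff.1 V.2)]
    simp
  -- The Gaussian law is unitarily invariant, so a Haar average may be inserted for free and Tonelli
  -- brings it inside.
  have h2 : ∫⁻ x, f x ∂(stdVec (Fin N)) = ∫⁻ x, ∫⁻ V, f ((V : Matrix (Fin N) (Fin N) ℂ) *ᵥ x)
      ∂H ∂(stdVec (Fin N)) := by
    rw [← lintegral_lintegral_swap hmf.aemeasurable]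
    simp only [h1, lintegral_const, measure_univ, mul_one]
  rw [h2, ← lintegral_const_mul _ (by fun_prop)]
  -- For `x ≠ 0` homogeneity extracts the norm and the remaining average over the sphere does not
  -- depend on the direction. At `x = 0` the left side vanishes because `d ≠ 0`.
  refine lintegral_mono fun x => ?_
  rcases eq_or_ne (∑ k, ‖x k‖ ^ 2) 0 with h0 | h0
  · simp only [h0, ENNReal.ofReal_zero, zero_pow hd0, mul_zero, zero_le]
  have hp : 0 < ∑ k, ‖x k‖ ^ 2 := lt_of_le_of_ne (by positivity) (Ne.symm h0)
  set r := √(∑ k, ‖x k‖ ^ 2) with hr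
  have hr0 : 0 < r := Real.sqrt_pos.2 hp
  have hr2 : r ^ 2 = ∑ k, ‖x k‖ ^ 2 := Real.sq_sqrt hp.le
  have hx : x = (r : ℂ) • (((r⁻¹ : ℝ) : ℂ) • x) := by
    rw [smul_smul, ← Complex.ofReal_mul, mul_inv_cancel₀ hr0.ne', Complex.ofReal_one, one_smul]
  have hu : ∑ k, ‖((((r⁻¹ : ℝ) : ℂ) • x) k)‖ ^ 2 = 1 := by
    simp only [Pi.smul_apply, norm_smul, Complex.norm_real, mul_pow, ← Finset.mul_sum]
    rw [← hr2, norm_inv, Real.norm_of_nonneg hr0.le]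
    field_simp
  have e : ∀ V : Matrix.unitaryGroup (Fin N) ℂ, f ((V : Matrix (Fin N) (Fin N) ℂ) *ᵥ x) =
      ENNReal.ofReal (r ^ 2) ^ d *
        f ((V : Matrix (Fin N) (Fin N) ℂ) *ᵥ (((r⁻¹ : ℝ) : ℂ) • x)) := fun V => by
    rw [← hd r _ hr0, ← Matrix.mulVec_smul, ← hx]
  simp only [e]
  rw [lintegral_const_mul' _ _ (ENNReal.pow_ne_top ENNReal.ofReal_ne_top),
    lintegral_mulVec_eq H hf hw hu, ← hr2, mul_comm]

end Haar


/-! ### Moments of quadratic forms on the sphere -/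

section EnergyMoments

variable {N : ℕ}

/-- The quadratic form `∑ c_k |x_k|²`. -/
noncomputable def weightedEnergy (c : Fin N → ℝ) (x : Fin N → ℂ) : ℝ := ∑ k, c k * ‖x k‖ ^ 2

theorem measurable_weightedEnergy (c : Fin N → ℝ) : Measurable (weightedEnergy c) := by
  unfold weightedEnergy
  fun_prop

theorem weightedEnergy_smul (c : Fin N → ℝ) (r : ℂ) (x : Fin N → ℂ) :
    weightedEnergy c (r • x) = ‖r‖ ^ 2 * weightedEnergy c x := by
  simp only [weightedEnergy, Finset.mul_sum, Pi.smul_apply, norm_smul, mul_pow]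
  exact Finset.sum_congr rfl fun k _ => by ring

theorem inv_one_sub_mul_exp_neg_le {t : ℝ} (ht : |t| ≤ 1 / 2) :
    (1 - t)⁻¹ ≤ Real.exp (t + 2 * t ^ 2) := by
  obtain ⟨h1, h2⟩ := abs_le.1 ht
  have h3 : 0 < 1 - t := by linarith
  rw [inv_le_iff_one_le_mul₀ h3]
  -- `(1 + t + 2t²)(1 - t) = 1 + t²(1 - 2t)`, which is at least one for `t ≤ 1/2`.
  have h4 := mul_le_mul_of_nonneg_right (Real.add_one_le_exp (t + 2 * t ^ 2)) h3.le
  nlinarith [mul_nonneg (sq_nonneg t) (by linarith : 0 ≤ 1 - 2 * t)]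

/-- The exponential moment is a product of factors `(1 - s c_k)⁻¹`. Since the weights sum to zero,
the first-order exponents cancel and an exponent of order `s² N` remains. -/
theorem lintegral_exp_weightedEnergy_le {c : Fin N → ℝ} (hc : ∀ k, |c k| ≤ 1)
    (hs : ∑ k, c k = 0) {s : ℝ} (h : |s| ≤ 1 / 2) :
    ∫⁻ x, ENNReal.ofReal (Real.exp (s * weightedEnergy c x)) ∂(stdVec (Fin N)) ≤
      ENNReal.ofReal (Real.exp (2 * (s ^ 2 * N))) := by
  have hsc : ∀ k, |s * c k| ≤ 1 / 2 := fun k => by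
    rw [abs_mul]
    nlinarith [hc k, abs_nonneg (c k), abs_nonneg s]
  have hq : ∀ k, Integrable (fun x : ℂ => Real.exp (s * c k * ‖x‖ ^ 2)) (complexGaussian 1) ∧
      ∫ x, Real.exp (s * c k * ‖x‖ ^ 2) ∂(complexGaussian 1) = (1 - s * c k)⁻¹ := fun k => by
    have := integrable_exp_quadratic (t := -(s * c k))
      (by have := (abs_le.1 (hsc k)).2; linarith) 0
    simpa [sub_eq_add_neg] using this
  have e : ∀ x : Fin N → ℂ, Real.exp (s * weightedEnergy c x) =
      ∏ k, Real.exp (s * c k * ‖x k‖ ^ 2) := fun x => by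
    rw [← Real.exp_sum, weightedEnergy, Finset.mul_sum]
    simp only [mul_assoc]
  have hi : Integrable (fun x : Fin N → ℂ => Real.exp (s * weightedEnergy c x))
      (stdVec (Fin N)) := by
    simp only [e]
    exact Integrable.fintype_prod fun k => (hq k).1
  rw [← ofReal_integral_eq_lintegral_ofReal hi (ae_of_all _ fun x => (Real.exp_pos _).le)]
  refine ENNReal.ofReal_le_ofReal ?_
  simp only [e]
  have h2 := integral_fintype_prod_eq_prod (𝕜 := ℝ) (μ := fun _ : Fin N => complexGaussian 1)
    (fun k x => Real.exp (s * c k * ‖x‖ ^ 2))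
  rw [stdVec, h2]
  calc ∏ k, ∫ x, Real.exp (s * c k * ‖x‖ ^ 2) ∂(complexGaussian 1)
      ≤ ∏ k, Real.exp (s * c k + 2 * (s * c k) ^ 2) := by
        refine Finset.prod_le_prod (fun k _ => integral_nonneg fun _ => (Real.exp_pos _).le)
          fun k _ => ?_
        rw [(hq k).2]
        exact inv_one_sub_mul_exp_neg_le (hsc k)
    _ = Real.exp (2 * ∑ k, (s * c k) ^ 2) := by
        rw [← Real.exp_sum, Finset.sum_add_distrib, ← Finset.mul_sum, hs, mul_zero, zero_add,
          Finset.mul_sum]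
    _ ≤ Real.exp (2 * (s ^ 2 * N)) := by
        refine Real.exp_le_exp.2 (mul_le_mul_of_nonneg_left ?_ zero_le_two)
        calc ∑ k, (s * c k) ^ 2 ≤ ∑ _k : Fin N, s ^ 2 := by
              refine Finset.sum_le_sum fun k _ => ?_
              rw [mul_pow]
              have := (sq_le_one_iff_abs_le_one _).2 (hc k)
              nlinarith [sq_nonneg s]
          _ = s ^ 2 * N := by simp [mul_comm]

/-- The constant in the bounds for eighth moments. -/
noncomputable def momentConst : ℝ := 512 * (Nat.factorial 8 : ℝ) * Real.exp (2 * (1 / 4))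

theorem momentConst_nonneg : 0 ≤ momentConst := by
  unfold momentConst
  positivity

theorem pow_eight_le_exp_add_exp (x : ℝ) :
    x ^ 8 ≤ (Nat.factorial 8 : ℝ) * (Real.exp x + Real.exp (-x)) := by
  have h8 : (0 : ℝ) < (Nat.factorial 8 : ℝ) := by positivity
  rcases le_total 0 x with h | h
  · have := (div_le_iff₀' h8).1 (Real.pow_div_factorial_le_exp x h 8)
    nlinarith [Real.exp_pos (-x)]
  · have := (div_le_iff₀' h8).1 (Real.pow_div_factorial_le_exp (-x) (by linarith) 8)
    rw [Even.neg_pow (by decide)] at this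
    nlinarith [Real.exp_pos x]

theorem lintegral_weightedEnergy_pow_le {c : Fin N → ℝ} (hc : ∀ k, |c k| ≤ 1)
    (hs : ∑ k, c k = 0) (hN : 0 < N) :
    ∫⁻ x, ENNReal.ofReal (weightedEnergy c x ^ 8) ∂(stdVec (Fin N)) ≤
      ENNReal.ofReal (momentConst * N ^ 4) := by
  have hN' : (1 : ℝ) ≤ N := by exact_mod_cast hN
  -- With this scale `s² N = 1/4`, so the exponential moments stay bounded and the eighth moment is
  -- of order `s⁻⁸ = 256 N⁴`.
  set s : ℝ := (2 * √N)⁻¹ with hsdef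
  have hsq : √(N : ℝ) ^ 2 = N := Real.sq_sqrt (by positivity)
  have hs1 : 1 ≤ √(N : ℝ) := Real.one_le_sqrt.2 hN'
  have hs0 : 0 < s := by positivity
  have hs2 : s ^ 2 * N = 1 / 4 := by
    rw [hsdef, inv_pow, mul_pow, hsq]
    field_simp
    norm_num
  have hs3 : |s| ≤ 1 / 2 := by
    rw [abs_of_pos hs0, hsdef, inv_eq_one_div]
    exact one_div_le_one_div_of_le (by norm_num) (by linarith)
  have hs8 : 256 * (N : ℝ) ^ 4 * s ^ 8 = 1 := by
    calc 256 * (N : ℝ) ^ 4 * s ^ 8 = 256 * (s ^ 2 * N) ^ 4 := by ring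
      _ = 1 := by rw [hs2]; norm_num
  have hpt : ∀ x : Fin N → ℂ, weightedEnergy c x ^ 8 ≤
      256 * N ^ 4 * (Nat.factorial 8 : ℝ) * (Real.exp (s * weightedEnergy c x) +
        Real.exp (-s * weightedEnergy c x)) := fun x => by
    have h := pow_eight_le_exp_add_exp (s * weightedEnergy c x)
    calc weightedEnergy c x ^ 8
        = (256 * N ^ 4 * s ^ 8) * weightedEnergy c x ^ 8 := by rw [hs8, one_mul]
      _ = 256 * N ^ 4 * (s * weightedEnergy c x) ^ 8 := by ring
      _ ≤ 256 * N ^ 4 * _ := mul_le_mul_of_nonneg_left h (by positivity)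
      _ = _ := by rw [neg_mul]; ring
  have hm : ∀ s : ℝ, Measurable fun x : Fin N → ℂ =>
      ENNReal.ofReal (Real.exp (s * weightedEnergy c x)) := fun s =>
    ((measurable_weightedEnergy c).const_mul s).exp.ennreal_ofReal
  calc ∫⁻ x, ENNReal.ofReal (weightedEnergy c x ^ 8) ∂(stdVec (Fin N))
      ≤ ∫⁻ x, ENNReal.ofReal (256 * N ^ 4 * (Nat.factorial 8 : ℝ)) *
          (ENNReal.ofReal (Real.exp (s * weightedEnergy c x)) +
            ENNReal.ofReal (Real.exp (-s * weightedEnergy c x))) ∂(stdVec (Fin N)) := by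
        refine lintegral_mono fun x => ?_
        rw [← ENNReal.ofReal_add (Real.exp_pos _).le (Real.exp_pos _).le,
          ← ENNReal.ofReal_mul (by positivity)]
        exact ENNReal.ofReal_le_ofReal (hpt x)
    _ = ENNReal.ofReal (256 * N ^ 4 * (Nat.factorial 8 : ℝ)) *
          (∫⁻ x, ENNReal.ofReal (Real.exp (s * weightedEnergy c x)) ∂(stdVec (Fin N)) +
            ∫⁻ x, ENNReal.ofReal (Real.exp (-s * weightedEnergy c x)) ∂(stdVec (Fin N))) := by
        rw [lintegral_const_mul' _ _ ENNReal.ofReal_ne_top, lintegral_add_left (hm _)]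
    _ ≤ ENNReal.ofReal (256 * N ^ 4 * (Nat.factorial 8 : ℝ)) *
          (ENNReal.ofReal (Real.exp (2 * (1 / 4))) + ENNReal.ofReal (Real.exp (2 * (1 / 4)))) := by
        gcongr
        · exact (lintegral_exp_weightedEnergy_le hc hs hs3).trans (by rw [hs2])
        · exact (lintegral_exp_weightedEnergy_le hc hs (by rwa [abs_neg])).trans
            (by rw [neg_sq, hs2])
    _ = ENNReal.ofReal (momentConst * N ^ 4) := by
        rw [← ENNReal.ofReal_add (Real.exp_pos _).le (Real.exp_pos _).le,
          ← ENNReal.ofReal_mul (by positivity), momentConst]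
        congr 1
        ring

/-- Jensen's inequality, obtained by integrating the tangent line `y⁸ ≥ 8 N⁷ y - 7 N⁸` at the mean
`N`. -/
theorem le_lintegral_energy_pow (N : ℕ) :
    ENNReal.ofReal (N ^ 8) ≤
      ∫⁻ x, ENNReal.ofReal (∑ k, ‖x k‖ ^ 2) ^ 8 ∂(stdVec (Fin N)) := by
  have h1 : ∫⁻ x, ENNReal.ofReal (∑ k, ‖x k‖ ^ 2) ∂(stdVec (Fin N)) = ENNReal.ofReal N := by
    have hi : ∀ k : Fin N, Integrable (fun x : Fin N → ℂ => ‖x k‖ ^ 2) (stdVec (Fin N)) :=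
      fun k => (measurePreserving_eval (fun _ : Fin N => complexGaussian 1) k).integrable_comp_of_integrable
        (integrable_norm_sq_complexGaussian 1)
    rw [← ofReal_integral_eq_lintegral_ofReal (integrable_finsetSum _ fun k _ => hi k)
      (ae_of_all _ fun x => by positivity), integral_finsetSum _ fun k _ => hi k]
    have : ∀ k : Fin N, ∫ x, ‖x k‖ ^ 2 ∂(stdVec (Fin N)) = 1 := fun k => by
      have h := integral_comp_eval (μ := fun _ : Fin N => complexGaussian 1) (i := k)
        (integrable_norm_sq_complexGaussian 1).aestronglyMeasurable
      rw [integral_norm_sq_complexGaussian] at h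
      simpa [stdVec] using h
    simp [this]
  have h2 : ∀ x : Fin N → ℂ, ENNReal.ofReal (8 * N ^ 7) * ENNReal.ofReal (∑ k, ‖x k‖ ^ 2) ≤
      ENNReal.ofReal (∑ k, ‖x k‖ ^ 2) ^ 8 + ENNReal.ofReal (7 * N ^ 8) := fun x => by
    have hx : 0 ≤ ∑ k, ‖x k‖ ^ 2 := by positivity
    set y := ∑ k, ‖x k‖ ^ 2
    rw [← ENNReal.ofReal_pow hx, ← ENNReal.ofReal_add (by positivity) (by positivity),
      ← ENNReal.ofReal_mul (by positivity)]
    refine ENNReal.ofReal_le_ofReal ?_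
    rcases Nat.eq_zero_or_pos N with h0 | h0
    · rw [h0]
      simp only [Nat.cast_zero]
      nlinarith [pow_nonneg hx 8]
    have hN : (0 : ℝ) < N := by exact_mod_cast h0
    have hb := one_add_mul_le_pow (a := y / N - 1) (by have : 0 ≤ y / N := by positivity
                                                       linarith) 8
    have := mul_le_mul_of_nonneg_left hb (by positivity : (0 : ℝ) ≤ (N : ℝ) ^ 8)
    rw [add_sub_cancel, div_pow, mul_div_cancel₀ _ (by positivity)] at this
    have e : (N : ℝ) ^ 8 * (1 + ((8 : ℕ) : ℝ) * (y / N - 1)) = 8 * N ^ 7 * y - 7 * N ^ 8 := by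
      push_cast
      field_simp
      ring
    linarith
  have h3 := lintegral_mono (μ := stdVec (Fin N)) h2
  rw [lintegral_const_mul _ (by fun_prop), h1, lintegral_add_right _ (by fun_prop),
    lintegral_const, measure_univ, mul_one, ← ENNReal.ofReal_mul (by positivity)] at h3
  refine (ENNReal.add_le_add_iff_right (a := ENNReal.ofReal (7 * N ^ 8))
    ENNReal.ofReal_ne_top).1 (le_trans (le_of_eq ?_) h3)
  rw [← ENNReal.ofReal_add (by positivity) (by positivity)]
  congr 1
  ring

/-- The spherical moment is at most the Gaussian moment, of order `N⁴`, divided by the eighth moment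
of the squared norm, at least `N⁸`. -/
theorem lintegral_weightedEnergy_mulVec_pow_le (H : Measure (Matrix.unitaryGroup (Fin N) ℂ))
    [H.IsHaarMeasure] [IsProbabilityMeasure H] {c : Fin N → ℝ} (hc : ∀ k, |c k| ≤ 1)
    (hs : ∑ k, c k = 0) {w : Fin N → ℂ} (hw : ∑ k, ‖w k‖ ^ 2 = 1) :
    ∫⁻ V, ENNReal.ofReal (weightedEnergy c ((V : Matrix (Fin N) (Fin N) ℂ) *ᵥ w) ^ 8) ∂H ≤
      ENNReal.ofReal (momentConst / N ^ 4) := by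
  have hN : 0 < N := Nat.pos_of_ne_zero (by rintro rfl; simp at hw)
  have hN' : (0 : ℝ) < N := by exact_mod_cast hN
  have h := lintegral_mulVec_mul_le H
    (f := fun x => ENNReal.ofReal (weightedEnergy c x ^ 8))
    ((measurable_weightedEnergy c).pow_const 8).ennreal_ofReal (d := 8) (by norm_num)
    (fun r x _ => by
      rw [weightedEnergy_smul, mul_pow, ENNReal.ofReal_mul (by positivity),
        ENNReal.ofReal_pow (by positivity), Complex.norm_real, Real.norm_eq_abs, sq_abs]) hw
  have h1 := (mul_le_mul_right (le_lintegral_energy_pow N) _).trans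
    (h.trans (lintegral_weightedEnergy_pow_le hc hs hN))
  rw [← ENNReal.le_div_iff_mul_le (Or.inl (by simp [hN.ne'])) (Or.inl ENNReal.ofReal_ne_top),
    ← ENNReal.ofReal_div_of_pos (by positivity)] at h1
  refine h1.trans (ENNReal.ofReal_le_ofReal (le_of_eq ?_))
  field_simp

end EnergyMoments


/-! ### Moments of weighted Gram matrices -/

section GramMoments

variable {N : ℕ}

theorem continuous_weightedGram (c : Fin N → ℝ) (i j : Fin N) :
    Continuous fun V : Matrix.unitaryGroup (Fin N) ℂ =>
      weightedGram (V : Matrix (Fin N) (Fin N) ℂ) c i j := by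
  simp only [weightedGram_apply]
  refine continuous_finsetSum _ fun k _ => continuous_const.mul ?_
  exact (Complex.continuous_conj.comp (continuous_entry k i)).mul (continuous_entry k j)

theorem integrable_of_continuous_unitary {E : Type*} [NormedAddCommGroup E]
    (H : Measure (Matrix.unitaryGroup (Fin N) ℂ)) [IsProbabilityMeasure H]
    {f : Matrix.unitaryGroup (Fin N) ℂ → E} (hf : Continuous f) : Integrable f H :=
  hf.integrable_of_hasCompactSupport (HasCompactSupport.of_compactSpace _)

/-- The vector `(e_i + θ e_j) / √2`. -/
noncomputable def pairVec (i j : Fin N) (θ : ℂ) : Fin N → ℂ :=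
  (((√2)⁻¹ : ℝ) : ℂ) • (Pi.single i 1 + θ • Pi.single j 1)

theorem sum_norm_sq_pairVec {i j : Fin N} (hij : i ≠ j) {θ : ℂ} (hθ : ‖θ‖ = 1) :
    ∑ k, ‖pairVec i j θ k‖ ^ 2 = 1 := by
  have e : ∀ k, ‖pairVec i j θ k‖ ^ 2 =
      2⁻¹ * ((if k = i then 1 else 0) + (if k = j then 1 else 0)) := fun k => by
    simp only [pairVec, Pi.smul_apply, Pi.add_apply, Pi.single_apply, smul_eq_mul]
    rw [norm_mul, mul_pow, Complex.norm_real, Real.norm_of_nonneg (by positivity), inv_pow, Real.sq_sqrt (by norm_num)]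
    congr 1
    by_cases h1 : k = i
    · have : k ≠ j := fun h => hij (h1.symm.trans h)
      simp [h1, hij]
    · by_cases h2 : k = j <;> simp [h1, h2, hθ, hij.symm]
  simp only [e, ← Finset.mul_sum, Finset.sum_add_distrib, Finset.sum_ite_eq', Finset.mem_univ,
    if_true]
  norm_num

theorem weightedEnergy_mulVec_pairVec (V : Matrix (Fin N) (Fin N) ℂ) (c : Fin N → ℝ)
    (i j : Fin N) (θ : ℂ) :
    weightedEnergy c (V *ᵥ pairVec i j θ) = 2⁻¹ * ∑ k, c k * ‖V k i + θ * V k j‖ ^ 2 := by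
  rw [pairVec, Matrix.mulVec_smul, weightedEnergy_smul, Complex.norm_real,
    Real.norm_of_nonneg (by positivity), inv_pow, Real.sq_sqrt (by norm_num), weightedEnergy]
  simp only [Matrix.mulVec_add, Matrix.mulVec_smul, Matrix.mulVec_single_one, Pi.add_apply,
    Pi.smul_apply, smul_eq_mul, Matrix.col_apply]

/-- Polarization reduces off-diagonal entries to quadratic forms at the vectors `pairVec`, of unit
norm for `i ≠ j`, where the spherical moment bound applies. -/
theorem weightedGram_eq_polarization (V : Matrix (Fin N) (Fin N) ℂ) (c : Fin N → ℝ)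
    (i j : Fin N) :
    weightedGram V c i j = 2⁻¹ * (weightedEnergy c (V *ᵥ pairVec i j 1) -
      weightedEnergy c (V *ᵥ pairVec i j (-1)) -
      Complex.I * weightedEnergy c (V *ᵥ pairVec i j Complex.I) +
      Complex.I * weightedEnergy c (V *ᵥ pairVec i j (-Complex.I))) := by
  simp only [weightedEnergy_mulVec_pairVec, weightedGram_apply]
  push_cast
  simp only [Finset.mul_sum, ← Finset.sum_sub_distrib, ← Finset.sum_add_distrib]
  refine Finset.sum_congr rfl fun k _ => ?_
  have e : ∀ θ : ℂ, ((‖V k i + θ * V k j‖ : ℂ)) ^ 2 =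
      (conj (V k i) + conj θ * conj (V k j)) * (V k i + θ * V k j) := fun θ => by
    rw [← Complex.conj_mul', map_add, map_mul]
  simp only [e, map_one, map_neg, Complex.conj_I]
  ring_nf
  simp only [Complex.I_sq]
  ring

theorem weightedGram_diag_eq (V : Matrix (Fin N) (Fin N) ℂ) (c : Fin N → ℝ) (i : Fin N) :
    weightedGram V c i i = weightedEnergy c (V *ᵥ Pi.single i 1) := by
  rw [weightedGram_diag, Matrix.mulVec_single_one]
  rfl

theorem norm_weightedGram_pow_le (V : Matrix (Fin N) (Fin N) ℂ) (c : Fin N → ℝ)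
    (i j : Fin N) :
    ‖weightedGram V c i j‖ ^ 8 ≤ 64 * (weightedEnergy c (V *ᵥ pairVec i j 1) ^ 8 +
      weightedEnergy c (V *ᵥ pairVec i j (-1)) ^ 8 +
      weightedEnergy c (V *ᵥ pairVec i j Complex.I) ^ 8 +
      weightedEnergy c (V *ᵥ pairVec i j (-Complex.I)) ^ 8) := by
  rw [weightedGram_eq_polarization]
  set a := weightedEnergy c (V *ᵥ pairVec i j 1)
  set b := weightedEnergy c (V *ᵥ pairVec i j (-1))
  set d := weightedEnergy c (V *ᵥ pairVec i j Complex.I)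
  set e := weightedEnergy c (V *ᵥ pairVec i j (-Complex.I))
  have h1 : ‖(2⁻¹ * ((a : ℂ) - b - Complex.I * d + Complex.I * e) : ℂ)‖ ≤
      2⁻¹ * ((|a| + |b|) + (|d| + |e|)) := by
    rw [norm_mul]
    have h2 : ‖(2⁻¹ : ℂ)‖ = 2⁻¹ := by simp
    rw [h2]
    refine mul_le_mul_of_nonneg_left ?_ (by norm_num)
    refine (norm_add_le _ _).trans ?_
    have h3 := norm_sub_le ((a : ℂ) - b) (Complex.I * d)
    have h4 := norm_sub_le (a : ℂ) b
    simp only [norm_mul, Complex.norm_I, one_mul, Complex.norm_real, Real.norm_eq_abs] at h3 h4 ⊢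
    linarith
  refine (pow_le_pow_left₀ (norm_nonneg _) h1 8).trans ?_
  -- Convexity costs `4⁷` for four summands, and the prefactor `2⁻⁸` brings this down to 64.
  have h5 := add_pow_le (add_nonneg (abs_nonneg a) (abs_nonneg b))
    (add_nonneg (abs_nonneg d) (abs_nonneg e)) 8
  have h6 := add_pow_le (abs_nonneg a) (abs_nonneg b) 8
  have h7 := add_pow_le (abs_nonneg d) (abs_nonneg e) 8
  rw [mul_pow]
  simp only [Even.pow_abs (show Even 8 by decide)] at h6 h7
  norm_num at h5 h6 h7 ⊢
  linarith

theorem lintegral_weightedGram_pow_le (H : Measure (Matrix.unitaryGroup (Fin N) ℂ))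
    [H.IsHaarMeasure] [IsProbabilityMeasure H] {c : Fin N → ℝ} (hc : ∀ k, |c k| ≤ 1)
    (hs : ∑ k, c k = 0) (i j : Fin N) :
    ∫⁻ V, ENNReal.ofReal (‖weightedGram (V : Matrix (Fin N) (Fin N) ℂ) c i j‖ ^ 8) ∂H ≤
      ENNReal.ofReal (256 * momentConst / N ^ 4) := by
  have hmc := momentConst_nonneg
  by_cases hij : i = j
  · subst hij
    simp only [weightedGram_diag_eq, Complex.norm_real, Real.norm_eq_abs,
      Even.pow_abs (show Even 8 by decide)]
    refine (lintegral_weightedEnergy_mulVec_pow_le H hc hs ?_).trans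
      (ENNReal.ofReal_le_ofReal ?_)
    · rw [Finset.sum_eq_single i (fun k _ hk => by simp [hk]) (by simp)]
      simp
    · gcongr
      linarith
  have hθ : ∀ θ : ℂ, ‖θ‖ = 1 → ∫⁻ V, ENNReal.ofReal
      (weightedEnergy c ((V : Matrix (Fin N) (Fin N) ℂ) *ᵥ pairVec i j θ) ^ 8) ∂H ≤
      ENNReal.ofReal (momentConst / N ^ 4) := fun θ h =>
    lintegral_weightedEnergy_mulVec_pow_le H hc hs (sum_norm_sq_pairVec hij h)
  have hm : ∀ θ : ℂ, Measurable fun V : Matrix.unitaryGroup (Fin N) ℂ => ENNReal.ofReal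
      (weightedEnergy c ((V : Matrix (Fin N) (Fin N) ℂ) *ᵥ pairVec i j θ) ^ 8) := fun θ =>
    (((measurable_weightedEnergy c).comp (measurable_pi_lambda _ fun k =>
      (measurable_unitary_mulVec k).comp
        (measurable_id.prodMk measurable_const))).pow_const 8).ennreal_ofReal
  have h8 : ∀ x : ℝ, 0 ≤ x ^ 8 := fun x => Even.pow_nonneg (by decide) x
  calc _ ≤ ∫⁻ V, ENNReal.ofReal 64 * (ENNReal.ofReal
        (weightedEnergy c ((V : Matrix (Fin N) (Fin N) ℂ) *ᵥ pairVec i j 1) ^ 8) +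
        ENNReal.ofReal
        (weightedEnergy c ((V : Matrix (Fin N) (Fin N) ℂ) *ᵥ pairVec i j (-1)) ^ 8) +
        ENNReal.ofReal
        (weightedEnergy c ((V : Matrix (Fin N) (Fin N) ℂ) *ᵥ pairVec i j Complex.I) ^ 8) +
        ENNReal.ofReal
        (weightedEnergy c ((V : Matrix (Fin N) (Fin N) ℂ) *ᵥ pairVec i j (-Complex.I)) ^ 8)) ∂H := by
        refine lintegral_mono fun V => ?_
        rw [← ENNReal.ofReal_add (h8 _) (h8 _), ← ENNReal.ofReal_add (add_nonneg (h8 _) (h8 _)) (h8 _),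
          ← ENNReal.ofReal_add (add_nonneg (add_nonneg (h8 _) (h8 _)) (h8 _)) (h8 _),
          ← ENNReal.ofReal_mul (by norm_num)]
        exact ENNReal.ofReal_le_ofReal (norm_weightedGram_pow_le _ c i j)
    _ ≤ ENNReal.ofReal 64 * (ENNReal.ofReal (momentConst / N ^ 4) +
          ENNReal.ofReal (momentConst / N ^ 4) + ENNReal.ofReal (momentConst / N ^ 4) +
          ENNReal.ofReal (momentConst / N ^ 4)) := by
        rw [lintegral_const_mul' _ _ ENNReal.ofReal_ne_top,
          lintegral_add_right _ (hm _), lintegral_add_right _ (hm _), lintegral_add_right _ (hm _)]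
        gcongr <;> exact hθ _ (by simp)
    _ = ENNReal.ofReal (256 * momentConst / N ^ 4) := by
        have h0 : 0 ≤ momentConst / N ^ 4 := by positivity
        rw [← ENNReal.ofReal_add h0 h0, ← ENNReal.ofReal_add (by linarith) h0,
          ← ENNReal.ofReal_add (by linarith) h0, ← ENNReal.ofReal_mul (by norm_num)]
        congr 1
        ring

theorem integrable_norm_weightedGram_pow (H : Measure (Matrix.unitaryGroup (Fin N) ℂ))
    [IsProbabilityMeasure H] (c : Fin N → ℝ) (i j : Fin N) (n : ℕ) :
    Integrable (fun V : Matrix.unitaryGroup (Fin N) ℂ =>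
      ‖weightedGram (V : Matrix (Fin N) (Fin N) ℂ) c i j‖ ^ n) H :=
  integrable_of_continuous_unitary H ((continuous_weightedGram c i j).norm.pow n)

theorem integral_weightedGram_pow_le (H : Measure (Matrix.unitaryGroup (Fin N) ℂ))
    [H.IsHaarMeasure] [IsProbabilityMeasure H] {c : Fin N → ℝ} (hc : ∀ k, |c k| ≤ 1)
    (hs : ∑ k, c k = 0) (i j : Fin N) :
    ∫ V, ‖weightedGram (V : Matrix (Fin N) (Fin N) ℂ) c i j‖ ^ 8 ∂H ≤
      256 * momentConst / N ^ 4 := by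
  have hmc := momentConst_nonneg
  have h := lintegral_weightedGram_pow_le H hc hs i j
  rw [← ofReal_integral_eq_lintegral_ofReal
    (integrable_norm_weightedGram_pow H c i j 8)
    (ae_of_all _ fun V => by positivity)] at h
  exact (ENNReal.ofReal_le_ofReal_iff (by positivity)).1 h

theorem weightedGram_mul_diagonal (V : Matrix (Fin N) (Fin N) ℂ) (d : Fin N → ℂ)
    (c : Fin N → ℝ) (i j : Fin N) :
    weightedGram (V * Matrix.diagonal d) c i j = conj (d i) * d j * weightedGram V c i j := by
  simp only [weightedGram_apply, Matrix.mul_diagonal, map_mul, Finset.mul_sum]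
  exact Finset.sum_congr rfl fun k _ => by ring

theorem exists_sq_eq_I : ∃ ζ : ℂ, ζ ^ 2 = Complex.I ∧ ‖ζ‖ = 1 := by
  obtain ⟨ζ, hζ⟩ := IsAlgClosed.exists_pow_nat_eq Complex.I (n := 2) (by norm_num)
  refine ⟨ζ, hζ, (pow_eq_one_iff_of_nonneg (norm_nonneg ζ) two_ne_zero).1 ?_⟩
  rw [← norm_pow, hζ, Complex.norm_I]

theorem diagonal_mem_unitaryGroup {d : Fin N → ℂ} (hd : ∀ k, ‖d k‖ = 1) :
    Matrix.diagonal d ∈ Matrix.unitaryGroup (Fin N) ℂ := by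
  rw [Matrix.mem_unitaryGroup_iff, Matrix.star_eq_conjTranspose, Matrix.diagonal_conjTranspose,
    Matrix.diagonal_mul_diagonal, ← Matrix.diagonal_one]
  congr 1
  ext k
  rw [Pi.star_apply, Complex.star_def, Complex.mul_conj', hd]
  norm_num

/-- Multiplying one column of `V` by a phase preserves Haar measure but multiplies the integrand by
a constant other than one, so the integral is zero. Each factor is a product of two entries and
carries the squared phase, whence the square root `ζ` of `I`. -/
theorem integral_gram_cross_eq_zero (H : Measure (Matrix.unitaryGroup (Fin N) ℂ))
    [H.IsHaarMeasure] [IsProbabilityMeasure H] (c d : Fin N → ℝ) {i j k l : Fin N}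
    (hij : i ≠ j) (h : ¬ (i = k ∧ j = l)) :
    ∫ V : Matrix.unitaryGroup (Fin N) ℂ,
      (weightedGram (V : Matrix (Fin N) (Fin N) ℂ) c i j * weightedGram V d i j) *
        conj (weightedGram (V : Matrix (Fin N) (Fin N) ℂ) c k l * weightedGram V d k l) ∂H = 0 := by
  have hR : H.IsMulRightInvariant := ⟨fun g => (measurePreserving_mul_right H g).map_eq⟩
  obtain ⟨ζ, hζ, hζ1⟩ := exists_sq_eq_I
  have key : ∀ r : Fin N, ∀ e : Fin N → ℂ, (e = fun s => if s = r then Complex.I else 1) →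
      conj (e i) * e j * (e k * conj (e l)) ≠ 1 →
      ∫ V : Matrix.unitaryGroup (Fin N) ℂ,
      (weightedGram (V : Matrix (Fin N) (Fin N) ℂ) c i j * weightedGram V d i j) *
        conj (weightedGram (V : Matrix (Fin N) (Fin N) ℂ) c k l * weightedGram V d k l) ∂H = 0 := by
    intro r e he hne
    have hw : ∀ s, ‖(if s = r then ζ else 1 : ℂ)‖ = 1 := fun s => by split_ifs <;> simp [hζ1]
    have hw2 : ∀ s, (if s = r then ζ else 1 : ℂ) ^ 2 = e s := fun s => by
      rw [he]
      dsimp only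
      split_ifs <;> simp [hζ]
    set w : Fin N → ℂ := fun s => if s = r then ζ else 1 with hwdef
    have h1 := integral_mul_right_eq_self (μ := H) (fun V : Matrix.unitaryGroup (Fin N) ℂ =>
      (weightedGram (V : Matrix (Fin N) (Fin N) ℂ) c i j * weightedGram V d i j) *
        conj (weightedGram (V : Matrix (Fin N) (Fin N) ℂ) c k l * weightedGram V d k l))
      ⟨Matrix.diagonal w, diagonal_mem_unitaryGroup hw⟩
    simp only [Submonoid.coe_mul, weightedGram_mul_diagonal] at h1
    have h2 : ∀ V : Matrix.unitaryGroup (Fin N) ℂ,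
        conj (w i) * w j * weightedGram (V : Matrix (Fin N) (Fin N) ℂ) c i j *
          (conj (w i) * w j * weightedGram (V : Matrix (Fin N) (Fin N) ℂ) d i j) *
        conj (conj (w k) * w l * weightedGram (V : Matrix (Fin N) (Fin N) ℂ) c k l *
          (conj (w k) * w l * weightedGram (V : Matrix (Fin N) (Fin N) ℂ) d k l)) =
        conj (e i) * e j * (e k * conj (e l)) *
        ((weightedGram (V : Matrix (Fin N) (Fin N) ℂ) c i j * weightedGram V d i j) *
        conj (weightedGram (V : Matrix (Fin N) (Fin N) ℂ) c k l * weightedGram V d k l)) :=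
      fun V => by
        simp only [← hw2, map_mul, map_pow, Complex.conj_conj, hwdef]
        ring
    simp only [h2] at h1
    rw [integral_const_mul] at h1
    by_contra h0
    exact hne (mul_right_cancel₀ h0 (h1.trans (one_mul _).symm))
  have hI1 : -Complex.I ≠ 1 := fun h => by simpa using congrArg Complex.re h
  have hI2 : Complex.I ≠ 1 := fun h => by simpa using congrArg Complex.re h
  by_cases hik : i = k
  · have hjl : j ≠ l := fun hj => h ⟨hik, hj⟩
    refine key j _ rfl ?_
    simp [hij, hjl.symm, ← hik, hI2]
  · refine key i _ rfl ?_
    -- If `l = i`, as for the transposed pair, the phase enters twice and the constant is `(-I)² =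
    -- -1`. A phase whose square is `-1` would give 1 here and prove nothing.
    by_cases hli : l = i
    · simp only [hij.symm, Ne.symm hik, hli]
      simp
      norm_num
    · simp [hij.symm, Ne.symm hik, hli, hI1]

/-- Expanding the square leaves only the `N²` diagonal terms, each `O(N⁻²)` by the eighth-moment
bound. Without this orthogonality the sum could be as large as order `N`. -/
theorem integral_norm_offSum_sq_le (H : Measure (Matrix.unitaryGroup (Fin N) ℂ))
    [H.IsHaarMeasure] [IsProbabilityMeasure H] {c d : Fin N → ℝ} (hc : ∀ k, |c k| ≤ 1)
    (hd : ∀ k, |d k| ≤ 1) (hcs : ∑ k, c k = 0) (hds : ∑ k, d k = 0) :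
    ∫ V : Matrix.unitaryGroup (Fin N) ℂ,
      ‖offSum fun i j => weightedGram (V : Matrix (Fin N) (Fin N) ℂ) c i j *
        weightedGram (V : Matrix (Fin N) (Fin N) ℂ) d i j‖ ^ 2 ∂H ≤
      1 + 256 * momentConst := by
  have hmc := momentConst_nonneg
  rcases Nat.eq_zero_or_pos N with h0 | h0
  · subst h0
    simp [offSum]
    linarith
  have hN : (0 : ℝ) < N := by exact_mod_cast h0
  set g : Fin N × Fin N → Matrix.unitaryGroup (Fin N) ℂ → ℂ := fun p V =>
    if p.1 = p.2 then 0 else weightedGram (V : Matrix (Fin N) (Fin N) ℂ) c p.1 p.2 *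
        weightedGram (V : Matrix (Fin N) (Fin N) ℂ) d p.1 p.2 with hg
  have hgc : ∀ p, Continuous (g p) := fun p => by
    simp only [hg]
    split_ifs
    · exact continuous_const
    · exact (continuous_weightedGram c _ _).mul (continuous_weightedGram d _ _)
  have hcr : ∀ p q, p ≠ q → ∫ V, g p V * conj (g q V) ∂H = 0 := fun p q hpq => by
    simp only [hg]
    by_cases h1 : p.1 = p.2
    · simp [h1]
    by_cases h2 : q.1 = q.2
    · simp [h2]
    simp only [h1, h2, if_false]
    exact integral_gram_cross_eq_zero H c d h1 fun h => hpq (Prod.ext h.1 h.2)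
  have e1 : ∀ V : Matrix.unitaryGroup (Fin N) ℂ,
      (((‖offSum fun i j => weightedGram (V : Matrix (Fin N) (Fin N) ℂ) c i j *
        weightedGram (V : Matrix (Fin N) (Fin N) ℂ) d i j‖ ^ 2 : ℝ)) : ℂ) =
      ∑ p, ∑ q, g p V * conj (g q V) := fun V => by
    have : (offSum fun i j => weightedGram (V : Matrix (Fin N) (Fin N) ℂ) c i j *
        weightedGram (V : Matrix (Fin N) (Fin N) ℂ) d i j) = ∑ p, g p V := by
      rw [offSum, Fintype.sum_prod_type]
    rw [this, Complex.ofReal_pow, ← Complex.mul_conj', map_sum, Finset.sum_mul_sum]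
  have hint : ∀ p q, Integrable (fun V => g p V * conj (g q V)) H := fun p q =>
    integrable_of_continuous_unitary H ((hgc p).mul (Complex.continuous_conj.comp (hgc q)))
  have e2 : ∫ V : Matrix.unitaryGroup (Fin N) ℂ,
      ‖offSum fun i j => weightedGram (V : Matrix (Fin N) (Fin N) ℂ) c i j *
        weightedGram (V : Matrix (Fin N) (Fin N) ℂ) d i j‖ ^ 2 ∂H = ∑ p, ∫ V, ‖g p V‖ ^ 2 ∂H := by
    apply Complex.ofReal_injective
    rw [← integral_complex_ofReal]
    simp only [e1]
    rw [integral_finsetSum _ fun p _ => integrable_finsetSum _ fun q _ => hint p q]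
    push_cast
    refine Finset.sum_congr rfl fun p _ => ?_
    rw [integral_finsetSum _ fun q _ => hint p q, Finset.sum_eq_single p
      (fun q _ hq => hcr p q hq.symm) (by simp), ← integral_complex_ofReal]
    simp only [Complex.mul_conj', Complex.ofReal_pow]
  rw [e2]
  have e3 : ∀ p, ∫ V, ‖g p V‖ ^ 2 ∂H ≤ (1 + 256 * momentConst) / N ^ 2 := fun p => by
    have hA := integrable_norm_weightedGram_pow H c p.1 p.2 8
    have hB := integrable_norm_weightedGram_pow H d p.1 p.2 8
    have hpt : ∀ V, ‖g p V‖ ^ 2 ≤ 1 / N ^ 2 +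
        (N ^ 2 / 2 * ‖weightedGram (V : Matrix (Fin N) (Fin N) ℂ) c p.1 p.2‖ ^ 8 +
        N ^ 2 / 2 * ‖weightedGram (V : Matrix (Fin N) (Fin N) ℂ) d p.1 p.2‖ ^ 8) := fun V => by
      set x := ‖weightedGram (V : Matrix (Fin N) (Fin N) ℂ) c p.1 p.2‖
      set y := ‖weightedGram (V : Matrix (Fin N) (Fin N) ℂ) d p.1 p.2‖
      have h1 : ‖g p V‖ ^ 2 ≤ x ^ 2 * y ^ 2 := by
        simp only [hg]
        split_ifs
        · simp
          positivity
        · rw [norm_mul, mul_pow]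
      -- The weights `N⁻²` and `N²` balance the inequality: eighth moments are of order `N⁻⁴`, so
      -- both terms become `N⁻²` after integration.
      have h4 : ∀ z : ℝ, z ^ 4 ≤ 1 / N ^ 2 + N ^ 2 * z ^ 8 := fun z => by
        have h5 := sq_nonneg (1 / (N : ℝ) - N * z ^ 4)
        have h6 : (1 / (N : ℝ) - N * z ^ 4) ^ 2 =
            1 / (N : ℝ) ^ 2 - 2 * z ^ 4 + N ^ 2 * z ^ 8 := by
          field_simp
          ring
        have h7 : 0 ≤ z ^ 4 := Even.pow_nonneg (by decide) z
        linarith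
      have := h4 x
      have := h4 y
      nlinarith [sq_nonneg (x ^ 2 - y ^ 2)]
    calc ∫ V, ‖g p V‖ ^ 2 ∂H ≤ ∫ V, (1 / (N : ℝ) ^ 2 +
        (N ^ 2 / 2 * ‖weightedGram (V : Matrix (Fin N) (Fin N) ℂ) c p.1 p.2‖ ^ 8 +
        N ^ 2 / 2 * ‖weightedGram (V : Matrix (Fin N) (Fin N) ℂ) d p.1 p.2‖ ^ 8)) ∂H :=
          integral_mono (integrable_of_continuous_unitary H ((hgc p).norm.pow 2))
            ((integrable_const _).add ((hA.const_mul _).add (hB.const_mul _))) hpt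
      _ = 1 / (N : ℝ) ^ 2 +
        (N ^ 2 / 2 * ∫ V, ‖weightedGram (V : Matrix (Fin N) (Fin N) ℂ) c p.1 p.2‖ ^ 8 ∂H +
        N ^ 2 / 2 * ∫ V, ‖weightedGram (V : Matrix (Fin N) (Fin N) ℂ) d p.1 p.2‖ ^ 8 ∂H) := by
          have hAB := (hA.const_mul (N ^ 2 / 2 : ℝ)).add (hB.const_mul (N ^ 2 / 2 : ℝ))
          simp only [Pi.add_def] at hAB
          rw [integral_add (integrable_const _) hAB, integral_add (hA.const_mul _) (hB.const_mul _), integral_const_mul,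
            integral_const_mul]
          simp
      _ ≤ 1 / (N : ℝ) ^ 2 + (N ^ 2 / 2 * (256 * momentConst / N ^ 4) +
            N ^ 2 / 2 * (256 * momentConst / N ^ 4)) := by
          gcongr
          · exact integral_weightedGram_pow_le H hc hcs _ _
          · exact integral_weightedGram_pow_le H hd hds _ _
      _ = (1 + 256 * momentConst) / N ^ 2 := by
          field_simp
          ring
  calc ∑ p, ∫ V, ‖g p V‖ ^ 2 ∂H ≤ ∑ _p : Fin N × Fin N, (1 + 256 * momentConst) / N ^ 2 :=
        Finset.sum_le_sum fun p _ => e3 p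
    _ = 1 + 256 * momentConst := by
        simp only [Finset.sum_const, Finset.card_univ, Fintype.card_prod, Fintype.card_fin,
          nsmul_eq_mul]
        push_cast
        field_simp

end GramMoments


/-! ### Haar distributed sequences are almost surely spread -/

theorem tendsto_zero_of_pow {f : ℕ → ℝ} {n : ℕ}
    (h : Tendsto (fun N => f N ^ n) atTop (𝓝 0)) : Tendsto f atTop (𝓝 0) := by
  rw [Metric.tendsto_nhds]
  intro ε hε
  filter_upwards [Metric.tendsto_nhds.1 h (ε ^ n) (pow_pos hε n)] with N hN
  rw [dist_zero_right, norm_pow] at hN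
  rw [dist_zero_right]
  exact lt_of_pow_lt_pow_left₀ n hε.le hN

theorem le_sum_sum {N : ℕ} {f : Fin N → Fin N → ℝ} (hf : ∀ i j, 0 ≤ f i j) (i j : Fin N) :
    f i j ≤ ∑ i, ∑ j, f i j :=
  (Finset.single_le_sum (fun j _ => hf i j) (Finset.mem_univ j)).trans
    (Finset.single_le_sum (f := fun i => ∑ j, f i j)
      (fun i _ => Finset.sum_nonneg fun j _ => hf i j) (Finset.mem_univ i))

/-- Summable expectations make the series of the `f N` almost surely finite, so its terms tend to
zero. No independence is used, hence the joint law of the matrices is arbitrary. The shift by one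
avoids `N = 0`. -/
theorem ae_tendsto_zero_of_lintegral_le {Ω : Type*} [MeasurableSpace Ω] {μ : Measure Ω}
    {f : ℕ → Ω → ℝ} (hf : ∀ N ω, 0 ≤ f N ω) (hm : ∀ N, Measurable (f N)) {C : ℝ}
    (h : ∀ N, 0 < N → ∫⁻ ω, ENNReal.ofReal (f N ω) ∂μ ≤ ENNReal.ofReal (C / (N : ℝ) ^ 2)) :
    ∀ᵐ ω ∂μ, Tendsto (fun N => f N ω) atTop (𝓝 0) := by
  have hs : Summable fun N : ℕ => C / ((N + 1 : ℕ) : ℝ) ^ 2 := by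
    have h1 : Summable fun N : ℕ => C * (1 / (N : ℝ) ^ 2) :=
      (Real.summable_one_div_nat_pow.2 one_lt_two).mul_left C
    have h2 := (summable_nat_add_iff 1).2 h1
    simpa only [mul_one_div] using h2
  have hm' : ∀ N, Measurable fun ω => ENNReal.ofReal (f (N + 1) ω) := fun N =>
    (hm _).ennreal_ofReal
  have hfin : ∫⁻ ω, ∑' N : ℕ, ENNReal.ofReal (f (N + 1) ω) ∂μ ≠ ∞ := by
    rw [lintegral_tsum fun N => (hm' N).aemeasurable]
    refine ne_top_of_le_ne_top ?_ (ENNReal.tsum_le_tsum fun N => h (N + 1) N.succ_pos)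
    exact hs.tsum_ofReal_ne_top
  filter_upwards [ae_lt_top (Measurable.tsum hm') hfin] with ω hω
  have h1 := ENNReal.tendsto_atTop_zero_of_tsum_ne_top hω.ne
  rw [← tendsto_add_atTop_iff_nat 1]
  have h2 := (ENNReal.tendsto_toReal ENNReal.zero_ne_top).comp h1
  simpa [Function.comp_def, ENNReal.toReal_ofReal (hf _ _)] using h2

section AlmostSure

variable {N : ℕ}

/-- The indicator of a class, minus its mean. -/
noncomputable def centredInd {M : ℕ} (a : Fin N → Fin M) (m : Fin M) (k : Fin N) : ℝ :=
  classInd a m k - (∑ l, classInd a m l) / N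

theorem sum_classInd_div_mem {M : ℕ} (a : Fin N → Fin M) (m : Fin M) :
    0 ≤ (∑ l, classInd a m l) / N ∧ (∑ l, classInd a m l) / N ≤ 1 := by
  refine ⟨div_nonneg (Finset.sum_nonneg fun l _ => classInd_nonneg a m l) (by positivity),
    div_le_one_of_le₀ ?_ (by positivity)⟩
  calc ∑ l, classInd a m l ≤ ∑ _l : Fin N, (1 : ℝ) :=
        Finset.sum_le_sum fun l _ => classInd_le_one a m l
    _ = N := by simp

theorem abs_centredInd_le {M : ℕ} (a : Fin N → Fin M) (m : Fin M) (k : Fin N) :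
    |centredInd a m k| ≤ 1 := by
  obtain ⟨h1, h2⟩ := sum_classInd_div_mem a m
  have h3 := classInd_nonneg a m k
  have h4 := classInd_le_one a m k
  rw [centredInd, abs_le]
  constructor <;> linarith

theorem sum_centredInd {M : ℕ} (a : Fin N → Fin M) (m : Fin M) :
    ∑ k, centredInd a m k = 0 := by
  rcases Nat.eq_zero_or_pos N with h0 | h0
  · subst h0
    simp
  have hN : (N : ℝ) ≠ 0 := by exact_mod_cast h0.ne'
  simp only [centredInd, Finset.sum_sub_distrib, Finset.sum_const, Finset.card_univ,
    Fintype.card_fin, nsmul_eq_mul]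
  field_simp
  ring

/-- Because `Vᴴ V = 1`, centring the weights changes only the diagonal. The moment bounds for
weights of zero sum thus apply to the off-diagonal entries as they are. -/
theorem weightedGram_centredInd {M : ℕ} (a : Fin N → Fin M)
    (V : Matrix.unitaryGroup (Fin N) ℂ) (m : Fin M) (i j : Fin N) :
    weightedGram (V : Matrix (Fin N) (Fin N) ℂ) (centredInd a m) i j = classGram a V m i j -
      if i = j then (((∑ l, classInd a m l) / N : ℝ) : ℂ) else 0 := by
  have h1 : (V : Matrix (Fin N) (Fin N) ℂ)ᴴ * (V : Matrix (Fin N) (Fin N) ℂ) = 1 :=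
    Matrix.mem_unitaryGroup_iff'.1 V.2
  have h2 : ∑ k, conj ((V : Matrix (Fin N) (Fin N) ℂ) k i) * (V : Matrix (Fin N) (Fin N) ℂ) k j =
      if i = j then 1 else 0 := by
    have := congrFun (congrFun h1 i) j
    rwa [Matrix.mul_apply, Matrix.one_apply] at this
  rw [classGram, weightedGram_apply, weightedGram_apply]
  simp only [centredInd, Complex.ofReal_sub, sub_mul, Finset.sum_sub_distrib, ← Finset.mul_sum, h2,
    mul_ite, mul_one, mul_zero]

/-- The average of all Gram entries is a quadratic form at the unit vector with equal components, so
it concentrates like a diagonal entry. -/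
theorem weightedEnergy_centredInd_ones {M : ℕ} (hN : 0 < N) (a : Fin N → Fin M)
    (V : Matrix.unitaryGroup (Fin N) ℂ) (m : Fin M) :
    (weightedEnergy (centredInd a m)
      ((V : Matrix (Fin N) (Fin N) ℂ) *ᵥ fun _ => (((√(N : ℝ))⁻¹ : ℝ) : ℂ)) : ℂ) =
    (∑ i, ∑ j, classGram a V m i j) / (N : ℂ) -
      (((∑ l, classInd a m l) / N : ℝ) : ℂ) := by
  have hN' : (N : ℝ) ≠ 0 := by exact_mod_cast hN.ne'
  have e : (fun _ : Fin N => (((√(N : ℝ))⁻¹ : ℝ) : ℂ)) =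
      (((√(N : ℝ))⁻¹ : ℝ) : ℂ) • fun _ => (1 : ℂ) := by
    ext k
    simp
  have h1 := sum_weightedGram_mul_conj (V : Matrix (Fin N) (Fin N) ℂ) (classInd a m) fun _ => 1
  have h2 := sum_norm_sq_mulVec V.2 fun _ => 1
  simp only [map_one, mul_one] at h1
  rw [Finset.sum_comm] at h1
  rw [classGram, h1, e, Matrix.mulVec_smul, weightedEnergy_smul, Complex.norm_real,
    Real.norm_of_nonneg (by positivity), inv_pow, Real.sq_sqrt (by positivity), weightedEnergy]
  simp only [centredInd, sub_mul, Finset.sum_sub_distrib, ← Finset.mul_sum, h2]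
  simp only [norm_one, one_pow, Finset.sum_const, Finset.card_univ, Fintype.card_fin,
    nsmul_eq_mul, mul_one]
  rw [← Complex.ofReal_natCast, ← Complex.ofReal_div, ← Complex.ofReal_sub]
  congr 1
  field_simp

section

variable {Ω : Type*} [MeasurableSpace Ω] {μ : Measure Ω} [IsProbabilityMeasure μ]
  {M : ℕ} (a : (N : ℕ) → Fin N → Fin M)
  {V : (N : ℕ) → Ω → Matrix.unitaryGroup (Fin N) ℂ}

/-- The sum over `N²` entries of eighth moments of order `N⁻⁴` is `O(N⁻²)`, summable in `N`. The
exponent eight is chosen for this union bound. -/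
theorem ae_tendsto_sum_gram (hVm : ∀ N, Measurable (V N))
    (hV : ∀ N, (μ.map (V N)).IsHaarMeasure) (m : Fin M) :
    ∀ᵐ ω ∂μ, Tendsto (fun N => ∑ i, ∑ j, ‖weightedGram (V N ω : Matrix (Fin N) (Fin N) ℂ)
      (centredInd (a N) m) i j‖ ^ 8) atTop (𝓝 0) := by
  have hmc := momentConst_nonneg
  have hc : ∀ N (i j : Fin N), Measurable fun U : Matrix.unitaryGroup (Fin N) ℂ =>
      ‖weightedGram (U : Matrix (Fin N) (Fin N) ℂ) (centredInd (a N) m) i j‖ ^ 8 := fun N i j =>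
    ((continuous_weightedGram _ i j).norm.pow 8).measurable
  refine ae_tendsto_zero_of_lintegral_le (fun N ω => by positivity)
    (fun N => Finset.measurable_sum _ fun i _ => Finset.measurable_sum _ fun j _ =>
      (hc N i j).comp (hVm N)) (C := 256 * momentConst) fun N hN => ?_
  have hp : IsProbabilityMeasure (μ.map (V N)) :=
    Measure.isProbabilityMeasure_map (hVm N).aemeasurable
  have hH := hV N
  have hN' : (0 : ℝ) < N := by exact_mod_cast hN
  have e : ∀ ω, ENNReal.ofReal (∑ i, ∑ j, ‖weightedGram (V N ω : Matrix (Fin N) (Fin N) ℂ)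
      (centredInd (a N) m) i j‖ ^ 8) = ∑ i, ∑ j, ENNReal.ofReal
        (‖weightedGram (V N ω : Matrix (Fin N) (Fin N) ℂ) (centredInd (a N) m) i j‖ ^ 8) :=
    fun ω => by
      rw [ENNReal.ofReal_sum_of_nonneg fun i _ => by positivity]
      exact Finset.sum_congr rfl fun i _ => ENNReal.ofReal_sum_of_nonneg fun j _ => by positivity
  simp only [e]
  have hmeas : ∀ i j, Measurable fun ω => ENNReal.ofReal
      (‖weightedGram (V N ω : Matrix (Fin N) (Fin N) ℂ) (centredInd (a N) m) i j‖ ^ 8) :=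
    fun i j => ((hc N i j).comp (hVm N)).ennreal_ofReal
  rw [lintegral_finsetSum _ fun i _ => Finset.measurable_sum _ fun j _ => hmeas i j]
  calc ∑ i, ∫⁻ ω, ∑ j, ENNReal.ofReal
        (‖weightedGram (V N ω : Matrix (Fin N) (Fin N) ℂ) (centredInd (a N) m) i j‖ ^ 8) ∂μ
      = ∑ i, ∑ j, ∫⁻ U, ENNReal.ofReal
        (‖weightedGram (U : Matrix (Fin N) (Fin N) ℂ) (centredInd (a N) m) i j‖ ^ 8)
          ∂(μ.map (V N)) := by
        refine Finset.sum_congr rfl fun i _ => ?_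
        rw [lintegral_finsetSum _ fun j _ => hmeas i j]
        exact Finset.sum_congr rfl fun j _ =>
          (lintegral_map (hc N i j).ennreal_ofReal (hVm N)).symm
    _ ≤ ∑ _i : Fin N, ∑ _j : Fin N, ENNReal.ofReal (256 * momentConst / N ^ 4) :=
        Finset.sum_le_sum fun i _ => Finset.sum_le_sum fun j _ =>
          lintegral_weightedGram_pow_le _ (abs_centredInd_le _ _) (sum_centredInd _ _) i j
    _ = ENNReal.ofReal (256 * momentConst / N ^ 2) := by
        simp only [Finset.sum_const, Finset.card_univ, Fintype.card_fin, nsmul_eq_mul]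
        rw [← ENNReal.ofReal_natCast, ← ENNReal.ofReal_mul (by positivity),
          ← ENNReal.ofReal_mul (by positivity)]
        congr 1
        field_simp

theorem ae_tendsto_energy_ones (hVm : ∀ N, Measurable (V N))
    (hV : ∀ N, (μ.map (V N)).IsHaarMeasure) (m : Fin M) :
    ∀ᵐ ω ∂μ, Tendsto (fun N => weightedEnergy (centredInd (a N) m)
      ((V N ω : Matrix (Fin N) (Fin N) ℂ) *ᵥ fun _ => (((√(N : ℝ))⁻¹ : ℝ) : ℂ)) ^ 8)
      atTop (𝓝 0) := by
  have hmc := momentConst_nonneg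
  have hm : ∀ N, Measurable fun U : Matrix.unitaryGroup (Fin N) ℂ =>
      weightedEnergy (centredInd (a N) m)
      ((U : Matrix (Fin N) (Fin N) ℂ) *ᵥ fun _ => (((√(N : ℝ))⁻¹ : ℝ) : ℂ)) ^ 8 := fun N =>
    ((measurable_weightedEnergy _).comp (measurable_pi_lambda _ fun k =>
      (measurable_unitary_mulVec k).comp (measurable_id.prodMk measurable_const))).pow_const 8
  refine ae_tendsto_zero_of_lintegral_le (fun N ω => Even.pow_nonneg (by decide) _)
    (fun N => (hm N).comp (hVm N)) (C := momentConst) fun N hN => ?_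
  have hp : IsProbabilityMeasure (μ.map (V N)) :=
    Measure.isProbabilityMeasure_map (hVm N).aemeasurable
  have hH := hV N
  have hN' : (1 : ℝ) ≤ N := by exact_mod_cast hN
  rw [← lintegral_map (hm N).ennreal_ofReal (hVm N)]
  refine (lintegral_weightedEnergy_mulVec_pow_le _ (abs_centredInd_le _ _) (sum_centredInd _ _)
    ?_).trans (ENNReal.ofReal_le_ofReal ?_)
  · simp only [Complex.norm_real, Finset.sum_const, Finset.card_univ, Fintype.card_fin,
      nsmul_eq_mul]
    rw [Real.norm_of_nonneg (by positivity), inv_pow, Real.sq_sqrt (by positivity),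
      mul_inv_cancel₀ (by positivity)]
  · gcongr
    norm_num

theorem ae_tendsto_offSum_phase (hVm : ∀ N, Measurable (V N))
    (hV : ∀ N, (μ.map (V N)).IsHaarMeasure) (m m' : Fin M) :
    ∀ᵐ ω ∂μ, Tendsto (fun N : ℕ => ‖(offSum fun i j =>
      weightedGram (V N ω : Matrix (Fin N) (Fin N) ℂ) (centredInd (a N) m) i j *
        weightedGram (V N ω : Matrix (Fin N) (Fin N) ℂ) (centredInd (a N) m') i j) / (N : ℂ)‖ ^ 2)
      atTop (𝓝 0) := by
  have hmc := momentConst_nonneg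
  have hc : ∀ N, Continuous fun U : Matrix.unitaryGroup (Fin N) ℂ => ‖(offSum fun i j =>
      weightedGram (U : Matrix (Fin N) (Fin N) ℂ) (centredInd (a N) m) i j *
        weightedGram (U : Matrix (Fin N) (Fin N) ℂ) (centredInd (a N) m') i j) / (N : ℂ)‖ ^ 2 :=
    fun N => by
      refine ((Continuous.div_const ?_ _).norm).pow 2
      unfold offSum
      refine continuous_finsetSum _ fun i _ => continuous_finsetSum _ fun j _ => ?_
      split_ifs
      · exact continuous_const
      · exact (continuous_weightedGram _ i j).mul (continuous_weightedGram _ i j)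
  refine ae_tendsto_zero_of_lintegral_le (fun N ω => by positivity)
    (fun N => (hc N).measurable.comp (hVm N)) (C := 1 + 256 * momentConst)
    fun N hN => ?_
  have hp : IsProbabilityMeasure (μ.map (V N)) :=
    Measure.isProbabilityMeasure_map (hVm N).aemeasurable
  have hH := hV N
  rw [← lintegral_map (hc N).measurable.ennreal_ofReal (hVm N),
    ← ofReal_integral_eq_lintegral_ofReal (integrable_of_continuous_unitary _ (hc N))
      (ae_of_all _ fun U => by positivity)]
  refine ENNReal.ofReal_le_ofReal ?_
  simp only [norm_div, div_pow, Complex.norm_natCast]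
  rw [integral_div]
  gcongr
  exact integral_norm_offSum_sq_le _ (abs_centredInd_le _ _) (abs_centredInd_le _ _)
    (sum_centredInd _ _) (sum_centredInd _ _)

theorem ae_isSpread (hVm : ∀ N, Measurable (V N))
    (hV : ∀ N, (μ.map (V N)).IsHaarMeasure) {δ : Fin M → ℝ≥0}
    (ha : ∀ m, Tendsto
      (fun N : ℕ => ((Finset.univ.filter fun k : Fin N => a N k = m).card : ℝ) / (N : ℝ))
      atTop (𝓝 (δ m : ℝ))) :
    ∀ᵐ ω ∂μ, IsSpread δ a (fun N => V N ω) := by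
  have h1 := ae_all_iff.2 fun m => ae_tendsto_sum_gram a hVm hV m
  have h2 := ae_all_iff.2 fun m => ae_tendsto_energy_ones a hVm hV m
  have h3 := ae_all_iff.2 fun m => ae_all_iff.2 fun m' => ae_tendsto_offSum_phase a hVm hV m m'
  filter_upwards [h1, h2, h3] with ω h1 h2 h3
  have hmean : ∀ m, Tendsto (fun N : ℕ => (∑ l, classInd (a N) m l) / N) atTop
      (𝓝 (δ m : ℝ)) := fun m => by
    simpa only [sum_classInd] using ha m
  have hsmall : ∀ m, ∀ ε > 0, ∀ᶠ N in atTop, ∀ i j,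
      ‖weightedGram (V N ω : Matrix (Fin N) (Fin N) ℂ) (centredInd (a N) m) i j‖ ≤ ε := by
    intro m ε hε
    filter_upwards [(h1 m).eventually (gt_mem_nhds (pow_pos hε 8))] with N hN i j
    have h5 := le_sum_sum (f := fun i j => ‖weightedGram
      (V N ω : Matrix (Fin N) (Fin N) ℂ) (centredInd (a N) m) i j‖ ^ 8)
      (fun i j => by positivity) i j
    exact le_of_pow_le_pow_left₀ (n := 8) (by norm_num) hε.le (h5.trans hN.le)
  refine ⟨fun m ε hε => ?_, fun m ε hε => ?_, fun m => ?_, fun m m' => ?_⟩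
  · filter_upwards [hsmall m (ε / 2) (by positivity),
      (hmean m).eventually (Metric.closedBall_mem_nhds _ (half_pos hε))] with N h4 h5 i
    have h6 := h4 i i
    rw [weightedGram_centredInd, if_pos rfl] at h6
    rw [Real.dist_eq] at h5
    have h7 : ‖(((∑ l, classInd (a N) m l) / N : ℝ) : ℂ) - ((δ m : ℝ) : ℂ)‖ ≤ ε / 2 := by
      rw [← Complex.ofReal_sub, Complex.norm_real]
      exact h5
    have h8 := norm_add_le (classGram (a N) (V N ω) m i i -
      (((∑ l, classInd (a N) m l) / N : ℝ) : ℂ))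
      ((((∑ l, classInd (a N) m l) / N : ℝ) : ℂ) - ((δ m : ℝ) : ℂ))
    rw [sub_add_sub_cancel] at h8
    linarith
  · filter_upwards [hsmall m ε hε] with N h4 i j hij
    have h6 := h4 i j
    rwa [weightedGram_centredInd, if_neg hij, sub_zero] at h6
  · have h4 : Tendsto (fun N => weightedEnergy (centredInd (a N) m)
      ((V N ω : Matrix (Fin N) (Fin N) ℂ) *ᵥ fun _ => (((√(N : ℝ))⁻¹ : ℝ) : ℂ))) atTop
        (𝓝 0) := tendsto_zero_of_pow (h2 m)
    have h5 : Tendsto (fun N : ℕ => ((weightedEnergy (centredInd (a N) m)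
      ((V N ω : Matrix (Fin N) (Fin N) ℂ) *ᵥ fun _ => (((√(N : ℝ))⁻¹ : ℝ) : ℂ)) +
        (∑ l, classInd (a N) m l) / N : ℝ) : ℂ)) atTop (𝓝 (((0 + δ m : ℝ)) : ℂ)) :=
      (Complex.continuous_ofReal.tendsto _).comp (h4.add (hmean m))
    rw [zero_add] at h5
    refine h5.congr' ?_
    filter_upwards [eventually_gt_atTop 0] with N hN
    rw [Complex.ofReal_add, weightedEnergy_centredInd_ones hN, sub_add_cancel]
  · have h4 : Tendsto (fun N : ℕ => (offSum fun i j =>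
      weightedGram (V N ω : Matrix (Fin N) (Fin N) ℂ) (centredInd (a N) m) i j *
        weightedGram (V N ω : Matrix (Fin N) (Fin N) ℂ) (centredInd (a N) m') i j) / (N : ℂ))
        atTop (𝓝 0) := by
      rw [tendsto_zero_iff_norm_tendsto_zero]
      exact tendsto_zero_of_pow (h3 m m')
    refine h4.congr fun N => ?_
    congr 1
    unfold offSum
    refine Finset.sum_congr rfl fun i _ => Finset.sum_congr rfl fun j _ => ?_
    split_ifs with hij
    · rfl
    · simp [weightedGram_centredInd, hij]

end

end AlmostSure


/-! ### The rate bound -/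

/-- The error as a quadratic function of `β`, minimal at `conj α`. It yields the decomposition
`E|S|² = T + |α|² P̄` and the comparison of the two versions of the bound. -/
theorem integral_norm_sub_mul_sq {ν : Measure ℂ} [IsProbabilityMeasure ν]
    (hν : MemLp (fun ξ : ℂ => ξ) 2 ν) {φ : ℂ → ℂ → ℂ} {K : ℝ≥0}
    (hφ : LipschitzWith K (fun p : ℂ × ℂ => φ p.1 p.2)) {P : ℝ≥0} (hP : 0 < P) (β : ℂ) :
    ∫ q : ℂ × ℂ, ‖φ q.1 q.2 - β * q.1‖ ^ 2 ∂((complexGaussian P).prod ν) =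
      ∫ q : ℂ × ℂ, ‖φ q.1 q.2‖ ^ 2 ∂((complexGaussian P).prod ν) -
        2 * (β * alphaRx φ ν P).re * P + ‖β‖ ^ 2 * P := by
  have hP' : (P : ℂ) ≠ 0 := by exact_mod_cast hP.ne'
  have hu : MemLp (fun q : ℂ × ℂ => q.1) 2 ((complexGaussian P).prod ν) :=
    (memLp_id_complexGaussian P).comp_fst ν
  have hs : MemLp (fun q : ℂ × ℂ => φ q.1 q.2) 2 ((complexGaussian P).prod ν) :=
    memLp_two_of_lipschitzWith hu (hν.comp_snd _) hφ
  have hsu : Integrable (fun q : ℂ × ℂ => conj (φ q.1 q.2) * q.1)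
      ((complexGaussian P).prod ν) := hs.star.integrable_mul hu
  have hα : ∫ q : ℂ × ℂ, conj (φ q.1 q.2) * q.1 ∂((complexGaussian P).prod ν) =
      alphaRx φ ν P * P := by
    rw [alphaRx]
    field_simp
  have e : ∀ q : ℂ × ℂ, ‖φ q.1 q.2 - β * q.1‖ ^ 2 = ‖φ q.1 q.2‖ ^ 2 -
      2 * (β * (conj (φ q.1 q.2) * q.1)).re + ‖β‖ ^ 2 * ‖q.1‖ ^ 2 := fun q => by
    simp only [← Complex.normSq_eq_norm_sq, Complex.normSq_apply, Complex.sub_re, Complex.sub_im,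
      Complex.mul_re, Complex.mul_im, Complex.conj_re, Complex.conj_im]
    ring
  have hs2 : Integrable (fun q : ℂ × ℂ => ‖φ q.1 q.2‖ ^ 2) ((complexGaussian P).prod ν) :=
    hs.integrable_norm_pow two_ne_zero
  have hu2 : Integrable (fun q : ℂ × ℂ => ‖β‖ ^ 2 * ‖q.1‖ ^ 2) ((complexGaussian P).prod ν) :=
    (hu.integrable_norm_pow two_ne_zero).const_mul _
  have hre : Integrable (fun q : ℂ × ℂ => 2 * (β * (conj (φ q.1 q.2) * q.1)).re)
      ((complexGaussian P).prod ν) := (hsu.const_mul β).re.const_mul 2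
  have hsre : Integrable (fun q : ℂ × ℂ => ‖φ q.1 q.2‖ ^ 2 -
      2 * (β * (conj (φ q.1 q.2) * q.1)).re) ((complexGaussian P).prod ν) := hs2.sub hre
  simp only [e]
  rw [integral_add hsre hu2, integral_sub hs2 hre, integral_const_mul,
    integral_const_mul]
  have e1 : ∫ q : ℂ × ℂ, (β * (conj (φ q.1 q.2) * q.1)).re ∂((complexGaussian P).prod ν) =
      (β * alphaRx φ ν P).re * P := by
    have h1 := integral_re (hsu.const_mul β)
    rw [integral_const_mul, hα] at h1
    refine (h1.trans ?_)
    rw [← mul_assoc]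
    exact Complex.re_mul_ofReal _ _
  have e2 : ∫ q : ℂ × ℂ, ‖q.1‖ ^ 2 ∂((complexGaussian P).prod ν) = P := by
    rw [integral_fun_fst (f := fun x : ℂ => ‖x‖ ^ 2), integral_norm_sq_complexGaussian]
    simp
  rw [e1, e2]
  ring

theorem sum_eq_one_of_tendsto {M : ℕ} {δ : Fin M → ℝ≥0} {a : (N : ℕ) → Fin N → Fin M}
    (ha : ∀ m, Tendsto
      (fun N : ℕ => ((Finset.univ.filter fun k : Fin N => a N k = m).card : ℝ) / (N : ℝ))
      atTop (𝓝 (δ m : ℝ))) : ∑ m, (δ m : ℝ) = 1 := by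
  have h1 := tendsto_finsetSum Finset.univ fun m _ => ha m
  refine tendsto_nhds_unique h1 (tendsto_const_nhds.congr' ?_)
  filter_upwards [eventually_gt_atTop 0] with N hN
  have hN' : (N : ℝ) ≠ 0 := by exact_mod_cast hN.ne'
  rw [← Finset.sum_div, ← Nat.cast_sum, ← Finset.card_eq_sum_card_fiberwise (by simp)]
  simp [hN']

theorem sum_div_eq_sum_class {M N : ℕ} (a : Fin N → Fin M) (L W : Fin M → ℝ) (R E : Fin N → ℝ)
    (v : ℝ) :
    (∑ k, (L (a k) - R k / v + W (a k) * E k)) / N =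
      ∑ m, L m * ((∑ k, classInd a m k) / N) - ((∑ k, R k) / N) / v +
        ∑ m, W m * ((∑ k, classInd a m k * E k) / N) := by
  have e1 : ∑ m, L m * ((∑ k, classInd a m k) / N) = (∑ k, L (a k)) / N := by
    simp only [← mul_div_assoc, ← Finset.sum_div, Finset.mul_sum]
    rw [Finset.sum_comm]
    simp only [sum_mul_classInd]
  have e2 : ∑ m, W m * ((∑ k, classInd a m k * E k) / N) = (∑ k, W (a k) * E k) / N := by
    simp only [← mul_div_assoc, ← Finset.sum_div, Finset.mul_sum, ← mul_assoc]
    rw [Finset.sum_comm]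
    simp only [← Finset.sum_mul, sum_mul_classInd]
  rw [e1, e2, Finset.sum_add_distrib, Finset.sum_sub_distrib, ← Finset.sum_div]
  ring

section

variable {M : ℕ} {δ P : Fin M → ℝ≥0} {a : (N : ℕ) → Fin N → Fin M}
  {V : (N : ℕ) → Matrix.unitaryGroup (Fin N) ℂ}

/-- The noise level `v` of the test channel is free above the true error `T`. This leaves room to
let `v` tend to zero when `T = 0`, where the choice `v = T` is not available. -/
theorem IsSpread.ofReal_sum_log_le_linearRate (h : IsSpread δ a V) (hP : 0 < avgPower δ P)
    (ha : ∀ m, Tendsto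
      (fun N : ℕ => ((Finset.univ.filter fun k : Fin N => a N k = m).card : ℝ) / (N : ℝ))
      atTop (𝓝 (δ m : ℝ)))
    {ν : Measure ℂ} [IsProbabilityMeasure ν] (hν : MemLp (fun ξ : ℂ => ξ) 2 ν)
    {Qtx Qrx : ℂ → ℂ} {F : ℂ → ℂ → ℂ} {K : ℝ≥0}
    (hφ : LipschitzWith K (fun p : ℂ × ℂ => scalarLink Qtx F Qrx p.1 p.2)) {v : ℝ} (hv : 0 < v)
    (hv' : ∫ q : ℂ × ℂ, ‖scalarLink Qtx F Qrx q.1 q.2 -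
      conj (alphaRx (scalarLink Qtx F Qrx) ν (avgPower δ P)) * q.1‖ ^ 2
        ∂((complexGaussian (avgPower δ P)).prod ν) ≤ v) :
    ENNReal.ofReal (∑ m, (δ m : ℝ) * Real.log
      (1 + ‖alphaRx (scalarLink Qtx F Qrx) ν (avgPower δ P)‖ ^ 2 * P m / v)) ≤
      linearRate Qtx F Qrx P ν a V := by
  set φ := scalarLink Qtx F Qrx with hφdef
  set α := alphaRx φ ν (avgPower δ P) with hα
  set T := ∫ q : ℂ × ℂ, ‖φ q.1 q.2 - conj α * q.1‖ ^ 2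
        ∂((complexGaussian (avgPower δ P)).prod ν) with hT
  set A := ∫ q : ℂ × ℂ, ‖φ q.1 q.2‖ ^ 2 ∂((complexGaussian (avgPower δ P)).prod ν) with hA
  have hT0 : 0 ≤ T := integral_nonneg fun q => by positivity
  have hTA : A = T + ‖α‖ ^ 2 * avgPower δ P := by
    have h1 := integral_norm_sub_mul_sq hν hφ hP (conj α)
    have h2 : (conj α * α).re = ‖α‖ ^ 2 := by
      rw [Complex.conj_mul', ← Complex.ofReal_pow, Complex.ofReal_re]
    rw [← hα, h2, RCLike.norm_conj] at h1
    linarith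
  set L : Fin M → ℝ := fun m => Real.log (1 + ‖α‖ ^ 2 * P m / v) with hL
  set W : Fin M → ℝ := fun m => (‖α‖ ^ 2 * P m + v)⁻¹ with hW
  have hW0 : ∀ m, 0 ≤ W m := fun m => by positivity
  -- The error term costs `T / v`; the energy term returns the `δ`-average of `(T + x) / (x + v)`
  -- with `x = |α|² P_m`, which is no smaller because `T ≤ v`.
  have hkey : T / v ≤ ∑ m, W m * (δ m * A + ‖α‖ ^ 2 * (δ m * (P m - avgPower δ P))) := by
    calc T / v = ∑ m, (δ m : ℝ) * (T / v) := by
          rw [← Finset.sum_mul, sum_eq_one_of_tendsto ha, one_mul]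
      _ ≤ _ := by
          refine Finset.sum_le_sum fun m _ => ?_
          have e : W m * (δ m * A + ‖α‖ ^ 2 * (δ m * (P m - avgPower δ P))) =
              δ m * ((T + ‖α‖ ^ 2 * P m) / (‖α‖ ^ 2 * P m + v)) := by
            rw [hTA, hW]
            dsimp only
            rw [div_eq_mul_inv]
            ring
          rw [e]
          refine mul_le_mul_of_nonneg_left ?_ (δ m).2
          rw [div_le_div_iff₀ hv (by positivity)]
          have : 0 ≤ ‖α‖ ^ 2 * (P m : ℝ) := by positivity
          nlinarith
  -- One `ε` pays for the limits of the logarithmic and error terms, and `ε W m` for the energy of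
  -- class `m`; a lower energy bound suffices because `W m` is nonnegative.
  have hfinal : ∀ ε : ℝ, 0 < ε → ENNReal.ofReal (∑ m, (δ m : ℝ) * L m - ε * (1 + ∑ m, W m)) ≤
      linearRate Qtx F Qrx P ν a V := by
    intro ε hε
    have hlim := ((tendsto_finsetSum Finset.univ fun m _ => (ha m).const_mul (L m)).sub
      ((h.tendsto_error hP hν hφ (conj α)).div_const v)).eventually
        (lt_mem_nhds (sub_lt_self _ hε))
    have hE := eventually_all.2 fun m => h.energy_lower_bound hP ha hν hφ m hε
    refine le_liminf_of_le (by isBoundedDefault) ?_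
    filter_upwards [hlim, hE, eventually_gt_atTop 0] with N h1 h2 hN
    have hN' : (0 : ℝ) < N := by exact_mod_cast hN
    have hmi := ofReal_sum_le_mutualInfo (μ := (inputLaw P (a N)).prod (noiseLaw N ν))
      (X := fun p => p.1) (Y := fun p => applyLink φ (V N) p.1 p.2) (P := fun k => P (a N k))
      measurable_fst (continuous_applyLink hφ.continuous (V N)).measurable
      (by rw [Measure.map_fst_prod, measure_univ, one_smul]; rfl)
      (fun k => memLp_input k) (fun k => memLp_applyLink hν hφ (V N) k) (conj α) hv
    have hli : linkInfo Qtx F Qrx P ν (a N) (V N) = mutualInfo (fun p => p.1)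
        (fun p => applyLink φ (V N) p.1 p.2) ((inputLaw P (a N)).prod (noiseLaw N ν)) := rfl
    rw [← hli, RCLike.norm_conj] at hmi
    refine le_trans ?_ (ENNReal.div_le_div_right hmi _)
    rw [← ENNReal.ofReal_natCast, ← ENNReal.ofReal_div_of_pos hN']
    refine ENNReal.ofReal_le_ofReal ?_
    have e := sum_div_eq_sum_class (a N) L W
      (fun k => ∫ p, ‖applyLink φ (V N) p.1 p.2 k - conj α * p.1 k‖ ^ 2
        ∂((inputLaw P (a N)).prod (noiseLaw N ν)))
      (fun k => ∫ p, ‖applyLink φ (V N) p.1 p.2 k‖ ^ 2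
        ∂((inputLaw P (a N)).prod (noiseLaw N ν))) v
    have h3 : ∑ m, W m * (δ m * A + ‖α‖ ^ 2 * (δ m * (P m - avgPower δ P)) - ε) ≤ _ :=
      Finset.sum_le_sum fun m _ => mul_le_mul_of_nonneg_left (h2 m) (hW0 m)
    have h4 : ∑ m, W m * (δ m * A + ‖α‖ ^ 2 * (δ m * (P m - avgPower δ P)) - ε) =
        ∑ m, W m * (δ m * A + ‖α‖ ^ 2 * (δ m * (P m - avgPower δ P))) - ε * ∑ m, W m := by
      rw [Finset.mul_sum, ← Finset.sum_sub_distrib]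
      exact Finset.sum_congr rfl fun m _ => by ring
    have h5 : ∑ m, (δ m : ℝ) * L m = ∑ m, L m * δ m :=
      Finset.sum_congr rfl fun m _ => mul_comm _ _
    have e' : ∀ k, Real.log (1 + ‖α‖ ^ 2 * (P (a N k) : ℝ) / v) -
        (∫ p, ‖applyLink φ (V N) p.1 p.2 k - conj α * p.1 k‖ ^ 2
          ∂((inputLaw P (a N)).prod (noiseLaw N ν))) / v +
        (∫ p, ‖applyLink φ (V N) p.1 p.2 k‖ ^ 2 ∂((inputLaw P (a N)).prod (noiseLaw N ν))) /
          (‖α‖ ^ 2 * (P (a N k) : ℝ) + v) = L (a N k) -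
        (∫ p, ‖applyLink φ (V N) p.1 p.2 k - conj α * p.1 k‖ ^ 2
          ∂((inputLaw P (a N)).prod (noiseLaw N ν))) / v +
        W (a N k) * (∫ p, ‖applyLink φ (V N) p.1 p.2 k‖ ^ 2
          ∂((inputLaw P (a N)).prod (noiseLaw N ν))) := fun k => by
      rw [div_eq_inv_mul _ (‖α‖ ^ 2 * (P (a N k) : ℝ) + v)]
    rw [Finset.sum_congr rfl fun k _ => e' k, e]
    simp only [sum_classInd]
    linarith
  have hcont : Tendsto (fun ε : ℝ => ENNReal.ofReal
      (∑ m, (δ m : ℝ) * L m - ε * (1 + ∑ m, W m))) (𝓝[>] 0)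
      (𝓝 (ENNReal.ofReal (∑ m, (δ m : ℝ) * L m - 0 * (1 + ∑ m, W m)))) :=
    ((ENNReal.continuous_ofReal.comp (continuous_const.sub
      (continuous_id.mul continuous_const))).tendsto 0).mono_left nhdsWithin_le_nhds
  rw [zero_mul, sub_zero] at hcont
  exact le_of_tendsto hcont (eventually_nhdsWithin_of_forall fun ε hε => hfinal ε hε)

end

theorem gaussianRate_eq_of_pos {M : ℕ} {δ P : Fin M → ℝ≥0} {α : ℂ} {τ : ℝ}
    (hτ : 0 < τ * avgPower δ P) :
    gaussianRate δ P α τ = (ENNReal.ofReal (∑ m, (δ m : ℝ) *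
      Real.log (1 + ‖α‖ ^ 2 * P m / (τ * avgPower δ P))) : EReal) := by
  have h0 : ∀ m, 0 ≤ ‖α‖ ^ 2 * P m / (τ * avgPower δ P) := fun m => by positivity
  have e : ∀ m, ENNReal.log (1 + ENNReal.ofReal (‖α‖ ^ 2 * P m) /
      ENNReal.ofReal (τ * avgPower δ P)) =
      ((Real.log (1 + ‖α‖ ^ 2 * P m / (τ * avgPower δ P)) : ℝ) : EReal) := fun m => by
    rw [← ENNReal.ofReal_div_of_pos hτ, ← ENNReal.ofReal_one,
      ← ENNReal.ofReal_add zero_le_one (h0 m),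
      ENNReal.log_ofReal_of_pos (by linarith [h0 m])]
  have hs : 0 ≤ ∑ m, (δ m : ℝ) * Real.log (1 + ‖α‖ ^ 2 * P m / (τ * avgPower δ P)) :=
    Finset.sum_nonneg fun m _ => mul_nonneg (δ m).2 (Real.log_nonneg (by linarith [h0 m]))
  rw [EReal.coe_ennreal_ofReal, max_eq_left hs, gaussianRate]
  simp only [e, ← EReal.coe_mul]
  exact (map_sum (⟨⟨Real.toEReal, EReal.coe_zero⟩, EReal.coe_add⟩ : ℝ →+ EReal) _ _).symm

/-- For a positive denominator take `v = τ P̄`. If it vanishes then `T = 0`: either `α = 0` and the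
rate is zero, or some class has positive proportion and power, and letting `v` tend to zero forces
`R = ∞`. -/
theorem gaussianRate_le_of_forall {M : ℕ} {δ P : Fin M → ℝ≥0} (hP : 0 < avgPower δ P) {α : ℂ}
    {τ T : ℝ} {R : ℝ≥0∞} (hT0 : 0 ≤ T) (hT : T ≤ τ * avgPower δ P)
    (h : ∀ v : ℝ, 0 < v → T ≤ v →
      ENNReal.ofReal (∑ m, (δ m : ℝ) * Real.log (1 + ‖α‖ ^ 2 * P m / v)) ≤ R) :
    gaussianRate δ P α τ ≤ (R : EReal) := by
  rcases (hT0.trans hT).lt_or_eq with hτ | hτ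
  · rw [gaussianRate_eq_of_pos hτ]
    exact EReal.coe_ennreal_le_coe_ennreal_iff.2 (h _ hτ hT)
  have hT00 : T = 0 := le_antisymm (hτ ▸ hT) hT0
  by_cases hα : α = 0
  · have : gaussianRate δ P α τ = 0 := by
      rw [gaussianRate]
      refine Finset.sum_eq_zero fun m _ => ?_
      simp [hα]
    rw [this]
    exact EReal.coe_ennreal_nonneg R
  have hR : R = ⊤ := by
    obtain ⟨m, hm⟩ : ∃ m, 0 < δ m * P m := by
      by_contra! hc
      exact absurd (Finset.sum_nonpos fun m _ => hc m) (not_le.2 hP)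
    have hδ : 0 < (δ m : ℝ) := by
      exact_mod_cast pos_of_mul_pos_left hm zero_le
    have hPm : 0 < (P m : ℝ) := by
      exact_mod_cast pos_of_mul_pos_right hm zero_le
    have hα' : 0 < ‖α‖ := norm_pos_iff.2 hα
    refine ENNReal.eq_top_of_forall_nnreal_le fun r => ?_
    -- This `v` makes the signal-to-noise ratio of class `m` equal to `exp(r / δ_m)`, so that class
    -- alone contributes at least `r`.
    set v := ‖α‖ ^ 2 * P m / Real.exp (r / δ m) with hv
    have hv0 : 0 < v := by positivity
    refine le_trans ?_ (h v hv0 (hT00.le.trans hv0.le))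
    rw [← ENNReal.ofReal_coe_nnreal]
    refine ENNReal.ofReal_le_ofReal ?_
    have h0 : ∀ m, 0 ≤ (δ m : ℝ) * Real.log (1 + ‖α‖ ^ 2 * P m / v) := fun m =>
      mul_nonneg (δ m).2 (Real.log_nonneg (by
        have : 0 ≤ ‖α‖ ^ 2 * P m / v := by positivity
        linarith))
    refine le_trans ?_ (Finset.single_le_sum (f := fun m => (δ m : ℝ) *
      Real.log (1 + ‖α‖ ^ 2 * P m / v)) (fun m _ => h0 m) (Finset.mem_univ m))
    have e : ‖α‖ ^ 2 * P m / v = Real.exp (r / δ m) := by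
      rw [hv]
      field_simp
    rw [e]
    have h1 : (r : ℝ) / δ m ≤ Real.log (1 + Real.exp (r / δ m)) := by
      rw [Real.le_log_iff_exp_le (by positivity)]
      linarith
    calc (r : ℝ) = δ m * (r / δ m) := by field_simp
      _ ≤ _ := mul_le_mul_of_nonneg_left h1 hδ.le
  rw [hR, EReal.coe_ennreal_top]
  exact le_top

theorem exists_lipschitzWith_scalarLink {Qtx Qrx : ℂ → ℂ} {F : ℂ → ℂ → ℂ}
    (hQtx : ∃ K : ℝ≥0, LipschitzWith K Qtx) (hQrx : ∃ K : ℝ≥0, LipschitzWith K Qrx)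
    (hF : ∃ K : ℝ≥0, LipschitzWith K (fun p : ℂ × ℂ => F p.1 p.2)) :
    ∃ K : ℝ≥0, LipschitzWith K (fun p : ℂ × ℂ => scalarLink Qtx F Qrx p.1 p.2) := by
  obtain ⟨K₁, h₁⟩ := hQtx
  obtain ⟨K₂, h₂⟩ := hQrx
  obtain ⟨K₃, h₃⟩ := hF
  exact ⟨_, h₂.comp (h₃.comp ((h₁.comp LipschitzWith.prod_fst).prodMk LipschitzWith.prod_snd))⟩

end QuantizedLink

/-! ### The almost sure rate bound in both forms. -/

theorem theorem2
    {Ω : Type*} [MeasurableSpace Ω] (μ : Measure Ω) [IsProbabilityMeasure μ]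
    {M : ℕ} (δ P : Fin M → ℝ≥0)
    (hP : 0 < QuantizedLink.avgPower δ P)
    (a : (N : ℕ) → Fin N → Fin M)
    (ha : ∀ m, Tendsto
      (fun N : ℕ => ((Finset.univ.filter fun k : Fin N => a N k = m).card : ℝ) / (N : ℝ))
      atTop (𝓝 (δ m : ℝ)))
    (V : (N : ℕ) → Ω → Matrix.unitaryGroup (Fin N) ℂ)
    (hVmeas : ∀ N, Measurable (V N))
    (hVhaar : ∀ N, (μ.map (V N)).IsHaarMeasure)
    (Qtx Qrx : ℂ → ℂ) (F : ℂ → ℂ → ℂ)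
    (hQtx : ∃ K : ℝ≥0, LipschitzWith K Qtx)
    (hQrx : ∃ K : ℝ≥0, LipschitzWith K Qrx)
    (hF : ∃ K : ℝ≥0, LipschitzWith K (fun p : ℂ × ℂ => F p.1 p.2))
    (ν : Measure ℂ) [IsProbabilityMeasure ν]
    (hν : Integrable (fun ξ : ℂ => ‖ξ‖ ^ 2) ν)
    (φ : ℂ → ℂ → ℂ) (hφ : φ = QuantizedLink.scalarLink Qtx F Qrx)
    (α : ℂ) (hα : α = QuantizedLink.alphaRx φ ν (QuantizedLink.avgPower δ P)) :
    ∀ᵐ ω ∂μ,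
      QuantizedLink.gaussianRate δ P α
          (QuantizedLink.tauRx φ ν (QuantizedLink.avgPower δ P) α)
        ≤ (QuantizedLink.linearRate Qtx F Qrx P ν a (fun N => V N ω) : EReal) ∧
      QuantizedLink.gaussianRate δ P (conj α)
          (QuantizedLink.tauRx φ ν (QuantizedLink.avgPower δ P) (conj α))
        ≤ (QuantizedLink.linearRate Qtx F Qrx P ν a (fun N => V N ω) : EReal) := by
  have hν2 : MemLp (fun ξ : ℂ => ξ) 2 ν :=
    (memLp_two_iff_integrable_sq_norm measurable_id.aestronglyMeasurable).2 hν
  obtain ⟨K, hK⟩ := QuantizedLink.exists_lipschitzWith_scalarLink hQtx hQrx hF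
  have hP' : (0 : ℝ) < QuantizedLink.avgPower δ P := by exact_mod_cast hP
  filter_upwards [QuantizedLink.ae_isSpread a hVmeas hVhaar ha] with ω hω
  have hmain := fun v hv hv' => hω.ofReal_sum_log_le_linearRate hP ha hν2 hK (v := v) hv hv'
  rw [← hφ, ← hα] at hmain
  have hτ : ∀ β, QuantizedLink.tauRx φ ν (QuantizedLink.avgPower δ P) β *
      QuantizedLink.avgPower δ P = ∫ p : ℂ × ℂ, ‖φ p.1 p.2 - β * p.1‖ ^ 2
        ∂((QuantizedLink.complexGaussian (QuantizedLink.avgPower δ P)).prod ν) := fun β => by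
    rw [QuantizedLink.tauRx]
    field_simp
  -- The errors differ only in the cross term, and `Re(α²) ≤ |α|²`. The estimate for `conj α`
  -- therefore implies the one for `α`, whose error is larger and whose modulus is the same.
  have hle : ∫ p : ℂ × ℂ, ‖φ p.1 p.2 - conj α * p.1‖ ^ 2
        ∂((QuantizedLink.complexGaussian (QuantizedLink.avgPower δ P)).prod ν) ≤
      ∫ p : ℂ × ℂ, ‖φ p.1 p.2 - α * p.1‖ ^ 2
        ∂((QuantizedLink.complexGaussian (QuantizedLink.avgPower δ P)).prod ν) := by
    rw [hφ, QuantizedLink.integral_norm_sub_mul_sq hν2 hK hP,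
      QuantizedLink.integral_norm_sub_mul_sq hν2 hK hP, ← hφ, ← hα, RCLike.norm_conj]
    have h1 : (α * α).re ≤ (conj α * α).re := by
      simp only [Complex.mul_re, Complex.conj_re, Complex.conj_im]
      nlinarith [sq_nonneg α.im]
    nlinarith
  have h0 : 0 ≤ ∫ p : ℂ × ℂ, ‖φ p.1 p.2 - conj α * p.1‖ ^ 2
        ∂((QuantizedLink.complexGaussian (QuantizedLink.avgPower δ P)).prod ν) :=
    integral_nonneg fun p => by positivity
  exact ⟨QuantizedLink.gaussianRate_le_of_forall hP h0 (hle.trans (hτ α).ge) hmain,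
    QuantizedLink.gaussianRate_le_of_forall hP h0 (hτ (conj α)).ge
      (by simpa only [RCLike.norm_conj] using hmain)⟩
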